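/- Let $Q=(I,\Omega)$ be a finite quiver (finitely many vertices and arrows; loops and multiple arrows are allowed). For a representation $X$ of $Q$ over a field $K$, of finite dimension vector $\alpha\in\mathbb{N}^I$, let $\mathcal{H}_X\subseteq\mathbb{N}^I$ be the set of the dimension vectors of the indecomposable components of $X\otimes_K\overline{K}$. The representation $X$ is absolutely indecomposable if $X\otimes_K\overline{K}$ is indecomposable (in particular nonzero), and $X$ is said to be of level at most $V\subseteq\mathbb{N}^I$ if $\mathcal{H}_X\subseteq V$. For $\beta\in\mathbb{N}^I$ let $a_{Q,\beta}(t)\in\mathbb{Z}[t]$ be the Kac polynomial, i.e. the (existing and unique) polynomial such that, for every finite field $\mathbb{F}_q$, $a_{Q,\beta}(q)$ is the number of isomorphism classes of absolutely indecomposable representations of $Q$ over $\mathbb{F}_q$ of dimension vector $\beta$; in particular $a_{Q,0}=0$. Let $\operatorname{Plexp}$ be the plethystic exponential: for $f\in\mathbb{Q}(t)[[y_i]]_{i\in I}$ without constant term, $$\operatorname{Plexp}(f)=\exp\Bigl(\sum_{n\ge 1}\frac{\psi_n(f)}{n}\Bigr),\qquad \psi_n(f)(t,y)=f(t^n,y^n).$$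 Then for every $V\subseteq\mathbb{N}^I$ and every $\alpha\in\mathbb{N}^I$ there is a polynomial $M_{Q,\alpha,V}(t)\in\mathbb{Z}[t]$ such that, for every finite field $\mathbb{F}_q$, $M_{Q,\alpha,V}(q)$ is the number of isomorphism classes of representations of $Q$ over $\mathbb{F}_q$ of dimension vector $\alpha$ and of level at most $V$. Moreover, for every $V\subseteq\mathbb{N}^I$, the following identity holds in $\mathbb{Q}(t)[[y_i]]_{i\in I}$, where $y^\beta=\prod_{i\in I}y_i^{\beta_i}$: $$\operatorname{Plexp}\Bigl(\sum_{\beta\in V}a_{Q,\beta}(t)\,y^{\beta}\Bigr)=\sum_{\alpha\in\mathbb{N}^I}M_{Q,\alpha,V}(t)\,y^{\alpha}.$$ -/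

import Mathlib

open scoped TensorProduct Polynomial

universe w u v

noncomputable section

/-! ### Representations of a quiver -/

/-- A representation over `K` of a quiver with vertex set `I`, on a family `V` of `K`-vector
spaces indexed by the vertices: a linear map `V i → V j` for each arrow `i ⟶ j`. -/
abbrev QuiverRep (K : Type*) [Field K] {I : Type*} [Quiver I] (V : I → Type*)
    [∀ i, AddCommGroup (V i)] [∀ i, Module K (V i)] : Type _ :=
  ∀ i j : I, (i ⟶ j) → (V i →ₗ[K] V j)

namespace QuiverRep

section general

variable {K : Type*} [Field K] {I : Type*} [Quiver I]
  {V : I → Type*} [∀ i, AddCommGroup (V i)] [∀ i, Module K (V i)]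
  {W : I → Type*} [∀ i, AddCommGroup (W i)] [∀ i, Module K (W i)]
  {U : I → Type*} [∀ i, AddCommGroup (U i)] [∀ i, Module K (U i)]

/-- Two representations are isomorphic: there are linear isomorphisms at the vertices that
commute with the maps along the arrows. -/
def Isomorphic (X : QuiverRep K V) (Y : QuiverRep K W) : Prop :=
  ∃ e : ∀ i, V i ≃ₗ[K] W i,
    ∀ (i j : I) (a : i ⟶ j) (v : V i), e j (X i j a v) = Y i j a (e i v)

theorem Isomorphic.refl (X : QuiverRep K V) : Isomorphic X X :=
  ⟨fun _ => LinearEquiv.refl K _, fun _ _ _ _ => rfl⟩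

theorem Isomorphic.symm {X : QuiverRep K V} {Y : QuiverRep K W} (h : Isomorphic X Y) :
    Isomorphic Y X := by
  obtain ⟨e, he⟩ := h
  refine ⟨fun i => (e i).symm, fun i j a w => ?_⟩
  rw [LinearEquiv.symm_apply_eq, he, LinearEquiv.apply_symm_apply]

theorem Isomorphic.trans {X : QuiverRep K V} {Y : QuiverRep K W} {Z : QuiverRep K U}
    (h : Isomorphic X Y) (h' : Isomorphic Y Z) : Isomorphic X Z := by
  obtain ⟨e, he⟩ := h
  obtain ⟨f, hf⟩ := h'
  refine ⟨fun i => (e i).trans (f i), fun i j a v => ?_⟩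
  simp only [LinearEquiv.trans_apply, he, hf]

/-- A subrepresentation: a subspace at each vertex, stable under the maps along the arrows. -/
structure Sub (X : QuiverRep K V) where
  /-- the subspace at the vertex `i` -/
  space : ∀ i, Submodule K (V i)
  map_mem : ∀ (i j : I) (a : i ⟶ j), ∀ v ∈ space i, X i j a v ∈ space j

/-- A subrepresentation, as a representation in its own right. -/
def Sub.toRep {X : QuiverRep K V} (N : Sub X) : QuiverRep K (fun i => N.space i) :=
  fun i j a => (X i j a).restrict (N.map_mem i j a)

/-- The dimension vector of a subrepresentation. -/
def Sub.dim {X : QuiverRep K V} (N : Sub X) : I → ℕ :=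
  fun i => Module.finrank K (N.space i)

/-- A representation is indecomposable if it is nonzero and, in each of its decompositions as a
direct sum of two subrepresentations, one of the two is zero. -/
def Indecomposable (X : QuiverRep K V) : Prop :=
  (∃ i, Nontrivial (V i)) ∧
    ∀ N N' : Sub X, (∀ i, IsCompl (N.space i) (N'.space i)) →
      (∀ i, N.space i = ⊥) ∨ (∀ i, N'.space i = ⊥)

/-- The subrepresentations `N 0, …, N (h - 1)` are indecomposable and the representation is their
(internal) direct sum. -/
def IsDecomposition (X : QuiverRep K V) {h : ℕ} (N : Fin h → Sub X) : Prop :=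
  (∀ i, DirectSum.IsInternal (fun k => (N k).space i)) ∧ ∀ k, Indecomposable (N k).toRep

/-- The dimension vectors of the indecomposable components of a representation. (All its
decompositions into indecomposables give the same dimension vectors, by Krull-Schmidt.) -/
def componentDims (X : QuiverRep K V) : Set (I → ℕ) :=
  {β | ∃ (h : ℕ) (N : Fin h → Sub X), IsDecomposition X N ∧ ∃ k, β = (N k).dim}

/-- Extension of scalars from `K` to its algebraic closure. -/
def geometric (X : QuiverRep K V) :
    QuiverRep (AlgebraicClosure K) (fun i => AlgebraicClosure K ⊗[K] V i) :=
  fun i j a => (X i j a).baseChange (AlgebraicClosure K)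

/-- A representation is absolutely indecomposable if it is indecomposable over the algebraic
closure. -/
def AbsolutelyIndecomposable (X : QuiverRep K V) : Prop :=
  Indecomposable (geometric X)

/-- A representation is of level at most `L` if the dimension vectors of the indecomposable
components of its extension to the algebraic closure belong to `L`. -/
def LevelAtMost (L : Set (I → ℕ)) (X : QuiverRep K V) : Prop :=
  componentDims (geometric X) ⊆ L

end general

section counting

variable (K : Type*) [Field K] {I : Type*} [Quiver I] (α : I → ℕ)

/-- The space of representations of dimension vector `α`, in coordinates: the space at the vertex
`i` is `K ^ (α i)`. -/
abbrev OfDim : Type _ := QuiverRep K (fun i => Fin (α i) → K)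

/-- Isomorphism, as an equivalence relation on the representations of dimension vector `α`. -/
def isoSetoid : Setoid (OfDim K α) where
  r X Y := Isomorphic X Y
  iseqv := ⟨Isomorphic.refl, Isomorphic.symm, Isomorphic.trans⟩

variable {K α} in
/-- Each representation of dimension vector `α` is isomorphic to one in coordinates, so that the
isomorphism classes of representations of dimension vector `α` are those of `OfDim K α`. -/
theorem exists_isomorphic_ofDim {V : I → Type*} [∀ i, AddCommGroup (V i)] [∀ i, Module K (V i)]
    [∀ i, FiniteDimensional K (V i)] (X : QuiverRep K V)
    (hX : ∀ i, Module.finrank K (V i) = α i) : ∃ Y : OfDim K α, Isomorphic X Y := by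
  have e : ∀ i, V i ≃ₗ[K] (Fin (α i) → K) := fun i =>
    LinearEquiv.ofFinrankEq _ _ (by rw [hX i, Module.finrank_fin_fun])
  refine ⟨fun i j a => (e j).toLinearMap ∘ₗ X i j a ∘ₗ (e i).symm.toLinearMap, e, ?_⟩
  intro i j a v
  simp

/-- The number of isomorphism classes of representations of dimension vector `α` over `K` that
have the property `P`. (Over a finite field the set of all isomorphism classes is finite.) -/
def numIso (P : OfDim K α → Prop) : ℕ :=
  Nat.card {c : Quotient (isoSetoid K α) // ∃ X : OfDim K α, Quotient.mk _ X = c ∧ P X}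

end counting

/-- `p` is the Kac polynomial of the quiver at `β`: for every finite field `K`, with `q` elements,
`p(q)` is the number of isomorphism classes of absolutely indecomposable representations of
dimension vector `β` over `K`. -/
def IsKacPolynomial {I : Type u} [Quiver.{v} I] (β : I → ℕ) (p : ℤ[X]) : Prop :=
  ∀ (K : Type w) [Field K] [Finite K],
    p.eval (Nat.card K : ℤ) = (numIso K β AbsolutelyIndecomposable : ℤ)

/-- `p` counts representations of dimension vector `α` and level at most `L`: for every finite
field `K`, with `q` elements, `p(q)` is the number of their isomorphism classes over `K`. -/
def CountsLevelAtMost {I : Type u} [Quiver.{v} I] (L : Set (I → ℕ)) (α : I → ℕ)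
    (p : ℤ[X]) : Prop :=
  ∀ (K : Type w) [Field K] [Finite K],
    p.eval (Nat.card K : ℤ) = (numIso K α (LevelAtMost L) : ℤ)

end QuiverRep

/-! ### The plethystic exponential on `ℚ(t)[[y_i]]` -/

namespace Plethysm

/-- The substitution `t ↦ t ^ d` in `ℚ(t)`, for `d ≠ 0`. -/
def substT (d : ℕ) (hd : d ≠ 0) : RatFunc ℚ →+* RatFunc ℚ :=
  RatFunc.mapRingHom (Polynomial.expand ℚ d)
    (nonZeroDivisors_le_comap_nonZeroDivisors_of_injective _
      (Polynomial.expand_injective (Nat.pos_of_ne_zero hd)))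

variable {I : Type*}

/-- The Adams operation `ψ_d : f(t, y) ↦ f(t ^ d, y ^ d)`, for `d ≠ 0`. -/
def adams (d : ℕ) (hd : d ≠ 0) :
    MvPowerSeries I (RatFunc ℚ) →+* MvPowerSeries I (RatFunc ℚ) :=
  (MvPowerSeries.expand d hd).toRingHom.comp (MvPowerSeries.map (substT d hd))

/-- The series `∑_{n ≥ 1} ψ_n(f) / n`, for `f` without constant term. The coefficient at `y ^ γ`
of `ψ_n(f)` vanishes for `n > |γ|`, so that the sum over `n` may stop at `|γ|`. -/
def adamsSum (f : MvPowerSeries I (RatFunc ℚ)) : MvPowerSeries I (RatFunc ℚ) :=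
  fun γ => ∑ n ∈ Finset.range γ.degree,
    MvPowerSeries.coeff γ (adams (n + 1) n.succ_ne_zero f) / ((n + 1 : ℕ) : RatFunc ℚ)

/-- The plethystic exponential `exp (∑_{n ≥ 1} ψ_n(f) / n)`, for `f` without constant term. -/
def plexp (f : MvPowerSeries I (RatFunc ℚ)) : MvPowerSeries I (RatFunc ℚ) :=
  (PowerSeries.exp (RatFunc ℚ)).subst (adamsSum f)

/-- The generating function `∑_γ c_γ(t) y ^ γ` of a family of integral polynomials. -/
def genFun [Finite I] (c : (I → ℕ) → ℤ[X]) : MvPowerSeries I (RatFunc ℚ) :=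
  fun γ => algebraMap ℚ[X] (RatFunc ℚ) ((c ⇑γ).map (Int.castRingHom ℚ))

end Plethysm

end

/-! Fix a field `K` with `q` elements and an algebraic closure `Ω`. Frobenius permutes the
isomorphism classes of indecomposable representations over `Ω`, with finite orbits. By Krull–Schmidt
over `Ω`, Noether–Deuring (`nonempty_iso_of_ext_iso`) and Galois descent (`exists_ext_iso`), a
representation over `K` is the same thing, up to isomorphism, as a finite multiset of Frobenius
orbits (`orbMult_eq_iff`, `exists_orbMult_eq`). An orbit of size `d` whose members have dimension
vector `b` contributes `d • b` to the dimension vector. Level at most `V` means that only orbits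
with `b ∈ V` occur (`levelAtMost_iff`). Hence the generating series of the representations of level
at most `V` is the product over these orbits of `1 / (1 - y ^ (d b))`.

Absolutely indecomposable representations over the extension of degree `n` are the fixed points of
the `n`-th power of Frobenius, so their number is the sum of `d` over the orbits with `d ∣ n`
(`numIso_absolutelyIndecomposable_eq_sum`). This number is the Kac polynomial at `q ^ n`. The
logarithmic Euler derivative of the product is therefore that of the plethystic exponential of `∑
a_β y ^ β` evaluated at `q` (`euler_sum_prod`, `euler_levelSeries`). A series with constant term 1
is determined by its logarithmic Euler derivative (`eq_of_euler_eq`). The coefficients of the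
plethystic exponential are integral polynomials because `t ^ k y ^ β` has the plethystic exponential
`1 / (1 - t ^ k y ^ β)` and sums go to products (`exists_isPlexp_polyFun`); these are the
polynomials `M`. Since a polynomial is determined by its values, the identity passes from functions
of `q` to `ℚ(t)` (`plexp_map_toRatFunc`).

The existence of the Kac polynomials is also proved, by counting pairs of a representation and a
nilpotent endomorphism, weighted by the order of the group of base changes. Sorting the pairs by the
ranks of the powers of the nilpotent part shows that the count is a rational function of `q` with
monic denominator (`exists_card_nilPair`). Sorting them by the representation, Fitting's lemma
evaluates the count as a product over Frobenius orbits (`nilCard_div_autCard`, `card_nilPair_div`),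
which is the plethystic exponential of `∑ a_β y ^ β / (t - 1)`. By induction on the degree of `β`
the value `a_β(q)` is then a rational function of `q` with monic denominator. It takes integral
values at infinitely many `q`, so it is an integral polynomial (`exists_polyFun_eq`). -/

noncomputable section

namespace Plethysm

open MvPowerSeries Finset

/-! ### The Euler operator and the exponential -/

section euler

variable {I : Type*} {A : Type*} [CommRing A]

/-- The Euler operator: it multiplies the coefficient at `y ^ γ` by the degree of `γ`. -/
def euler : Derivation A (MvPowerSeries I A) (MvPowerSeries I A) :=
  Derivation.mk'
    { toFun := fun f γ => (γ.degree : A) * coeff γ f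
      map_add' := fun f g => by
        ext γ
        change (γ.degree : A) * coeff γ (f + g) = γ.degree * coeff γ f + γ.degree * coeff γ g
        rw [map_add, mul_add]
      map_smul' := fun r f => by
        ext γ
        change (γ.degree : A) * coeff γ (r • f) = r * (γ.degree * coeff γ f)
        rw [coeff_smul]; ring }
    (fun f g => by
      classical
      ext γ
      change (γ.degree : A) * coeff γ (f * g) = coeff γ (f * _ + g * _)
      rw [mul_comm g, map_add, coeff_mul, coeff_mul, coeff_mul, mul_sum, ← sum_add_distrib]
      refine sum_congr rfl fun p hp => ?_
      change _ = coeff p.1 f * ((p.2.degree : A) * coeff p.2 g) +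
        ((p.1.degree : A) * coeff p.1 f) * coeff p.2 g
      rw [HasAntidiagonal.mem_antidiagonal] at hp
      rw [← hp, map_add]
      push_cast
      ring)

theorem coeff_euler (f : MvPowerSeries I A) (γ : I →₀ ℕ) :
    coeff γ (euler f) = (γ.degree : A) * coeff γ f := rfl

/-- Since `L` has no constant term, `euler f = L * f` expresses `γ.degree` times the coefficient at
`γ` through coefficients of smaller degree, and `γ.degree` is invertible for `γ ≠ 0`. Only the
coefficients of `L` below `α` enter; this local form allows infinite sums to be truncated. -/
theorem coeff_eq_of_euler_eq [Algebra ℚ A] {f g L L' : MvPowerSeries I A} {α : I →₀ ℕ}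
    (hL : constantCoeff L = 0) (hLL : ∀ γ ≤ α, coeff γ L = coeff γ L') (hf : euler f = L * f)
    (hg : euler g = L' * g) (h0 : constantCoeff f = constantCoeff g) {γ : I →₀ ℕ} (hγα : γ ≤ α) :
    coeff γ f = coeff γ g := by
  classical
  induction h : γ.degree using Nat.strong_induction_on generalizing γ with
  | _ n ih =>
    by_cases hγ : γ = 0
    · subst hγ; simpa using h0
    have hn : (n : ℚ) ≠ 0 := by
      rw [← h]; exact_mod_cast fun h => hγ (Finsupp.degree_eq_zero_iff γ |>.1 h)
    have key : (γ.degree : A) * coeff γ f = γ.degree * coeff γ g := by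
      rw [← coeff_euler, ← coeff_euler, hf, hg, coeff_mul, coeff_mul]
      refine sum_congr rfl fun p hp => ?_
      rw [HasAntidiagonal.mem_antidiagonal] at hp
      have hp1 : p.1 ≤ α := le_trans (hp ▸ le_self_add) hγα
      have hp2 : p.2 ≤ α := le_trans (hp ▸ le_add_self) hγα
      rw [← hLL _ hp1]
      by_cases hp1 : p.1 = 0
      · rw [hp1, coeff_zero_eq_constantCoeff_apply, hL, zero_mul, zero_mul]
      · rw [ih p.2.degree _ hp2 rfl]
        rw [← h, ← hp, map_add]
        have : p.1.degree ≠ 0 := fun h => hp1 (Finsupp.degree_eq_zero_iff _ |>.1 h)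
        omega
    have hu : IsUnit (γ.degree : A) := by
      rw [h]
      have := (isUnit_iff_ne_zero.2 hn).map (algebraMap ℚ A)
      simpa using this
    exact hu.mul_left_cancel key

theorem eq_of_euler_eq [Algebra ℚ A] {f g L : MvPowerSeries I A} (hL : constantCoeff L = 0)
    (hf : euler f = L * f) (hg : euler g = L * g) (h0 : constantCoeff f = constantCoeff g) :
    f = g := by
  ext γ
  exact coeff_eq_of_euler_eq (α := γ) hL (fun _ _ => rfl) hf hg h0 le_rfl

theorem coeff_pow_of_degree_lt {L : MvPowerSeries I A} (hL : constantCoeff L = 0) {γ : I →₀ ℕ}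
    {d : ℕ} (h : γ.degree < d) : coeff γ (L ^ d) = 0 := by
  classical
  induction d generalizing γ with
  | zero => omega
  | succ d ih =>
    rw [pow_succ', coeff_mul]
    refine sum_eq_zero fun p hp => ?_
    rw [HasAntidiagonal.mem_antidiagonal] at hp
    by_cases hp1 : p.1 = 0
    · rw [hp1, coeff_zero_eq_constantCoeff_apply, hL, zero_mul]
    · rw [ih, mul_zero]
      rw [← hp, map_add] at h
      have : p.1.degree ≠ 0 := fun h => hp1 (Finsupp.degree_eq_zero_iff _ |>.1 h)
      omega

theorem coeff_subst_exp [Algebra ℚ A] {L : MvPowerSeries I A} (hL : constantCoeff L = 0)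
    {γ : I →₀ ℕ} {N : ℕ} (h : γ.degree < N) :
    coeff γ ((PowerSeries.exp A).subst L) =
      ∑ d ∈ range N, algebraMap ℚ A (1 / (d.factorial : ℚ)) * coeff γ (L ^ d) := by
  rw [PowerSeries.coeff_subst (PowerSeries.HasSubst.of_constantCoeff_zero hL)]
  rw [finsum_eq_sum_of_support_subset]
  · simp only [PowerSeries.coeff_exp, smul_eq_mul]
    rfl
  · intro d hd
    simp only [coe_range, Set.mem_Iio]
    by_contra hlt
    exact hd (by simp only; rw [coeff_pow_of_degree_lt hL (by omega), smul_zero])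

theorem constantCoeff_subst_exp [Algebra ℚ A] {L : MvPowerSeries I A}
    (hL : constantCoeff L = 0) : constantCoeff ((PowerSeries.exp A).subst L) = 1 := by
  rw [← coeff_zero_eq_constantCoeff_apply, coeff_subst_exp hL (N := 1) (by simp)]
  simp

/-- The chain rule for `exp`, term by term: the derivative of `L ^ (d + 1) / (d + 1)!` is `euler L *
L ^ d / d!`. Each coefficient involves only finitely many `d`. -/
theorem euler_subst_exp [Algebra ℚ A] {L : MvPowerSeries I A} (hL : constantCoeff L = 0) :
    euler ((PowerSeries.exp A).subst L) = euler L * (PowerSeries.exp A).subst L := by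
  classical
  ext γ
  have h1 : coeff γ (euler L * (PowerSeries.exp A).subst L) =
      ∑ d ∈ range (γ.degree + 1), algebraMap ℚ A (1 / (d.factorial : ℚ)) *
        coeff γ (euler L * L ^ d) := by
    simp only [coeff_mul γ (euler L), mul_sum]
    rw [sum_comm]
    refine sum_congr rfl fun p hp => ?_
    rw [HasAntidiagonal.mem_antidiagonal] at hp
    rw [coeff_subst_exp hL (N := γ.degree + 1), mul_sum]
    · exact sum_congr rfl fun d _ => by ring
    · rw [← hp, map_add]; omega
  have h2 : ∀ d : ℕ, algebraMap ℚ A (1 / (d.factorial : ℚ)) * coeff γ (euler L * L ^ d) =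
      algebraMap ℚ A (1 / ((d + 1).factorial : ℚ)) * coeff γ (euler (L ^ (d + 1))) := by
    intro d
    rw [Derivation.leibniz_pow, Nat.add_sub_cancel, smul_eq_mul, mul_comm (L ^ d), map_nsmul,
      nsmul_eq_mul, ← mul_assoc]
    congr 1
    rw [← map_natCast (algebraMap ℚ A), ← map_mul]
    congr 1
    have : (d.factorial : ℚ) ≠ 0 := by exact_mod_cast d.factorial_ne_zero
    rw [Nat.factorial_succ]
    push_cast
    field_simp
  -- The bound `γ.degree + 2` is one more than on the other side: the term `d = 0`, killed by
  -- `euler`, is split off.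
  rw [h1, sum_congr rfl fun d _ => h2 d, coeff_euler, coeff_subst_exp hL (N := γ.degree + 2)
    (by omega), sum_range_succ', pow_zero]
  simp only [coeff_euler]
  rw [mul_add, mul_sum]
  have : (γ.degree : A) * (algebraMap ℚ A (1 / (Nat.factorial 0 : ℚ)) *
      coeff γ (1 : MvPowerSeries I A)) = 0 := by
    rw [coeff_one]
    split_ifs with h
    · subst h; simp
    · simp
  rw [this, add_zero]
  exact sum_congr rfl fun d _ => by ring

end euler

/-! ### Logarithmic derivatives of plethystic exponentials -/

section dlog

variable {I : Type*} {A : Type*} [CommRing A]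

open scoped Classical in
/-- The Euler derivative of `∑ ψ_n(f) / n`. -/
def dlog (ψ : ℕ → A →+ A) (f : MvPowerSeries I A) : MvPowerSeries I A :=
  fun γ => ∑ n ∈ Icc 1 γ.degree, ∑ δ ∈ Iic γ,
    if n • δ = γ then (δ.degree : A) * ψ n (coeff δ f) else 0

open scoped Classical in
theorem coeff_dlog (ψ : ℕ → A →+ A) (f : MvPowerSeries I A) (γ : I →₀ ℕ) :
    coeff γ (dlog ψ f) = ∑ n ∈ Icc 1 γ.degree, ∑ δ ∈ Iic γ,
      if n • δ = γ then (δ.degree : A) * ψ n (coeff δ f) else 0 := rfl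

theorem constantCoeff_dlog (ψ : ℕ → A →+ A) (f : MvPowerSeries I A) :
    constantCoeff (dlog ψ f) = 0 := by
  rw [← coeff_zero_eq_constantCoeff_apply, coeff_dlog]
  simp

theorem dlog_add (ψ : ℕ → A →+ A) (f g : MvPowerSeries I A) :
    dlog ψ (f + g) = dlog ψ f + dlog ψ g := by
  ext γ
  rw [map_add]
  simp only [coeff_dlog, map_add]
  simp only [← sum_add_distrib]
  refine sum_congr rfl fun n _ => sum_congr rfl fun δ _ => ?_
  split_ifs <;> ring

theorem dlog_neg (ψ : ℕ → A →+ A) (f : MvPowerSeries I A) : dlog ψ (-f) = - dlog ψ f := by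
  rw [eq_neg_iff_add_eq_zero, ← dlog_add]
  ext γ
  simp [coeff_dlog]

theorem dlog_zero (ψ : ℕ → A →+ A) : dlog ψ (0 : MvPowerSeries I A) = 0 := by
  ext γ
  simp [coeff_dlog]

/-- `P` is the plethystic exponential of `f` with respect to the Adams operations `ψ` of the
coefficients, and `P` has coefficients in the subring `S`. -/
structure IsPlexp (ψ : ℕ → A →+ A) (S : Subring A) (f P : MvPowerSeries I A) : Prop where
  constantCoeff_eq : constantCoeff P = 1
  euler_eq : euler P = dlog ψ f * P
  coeff_mem : ∀ γ, coeff γ P ∈ S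

theorem coeff_mul_mem {S : Subring A} {P Q : MvPowerSeries I A} (hP : ∀ γ, coeff γ P ∈ S)
    (hQ : ∀ γ, coeff γ Q ∈ S) (γ : I →₀ ℕ) : coeff γ (P * Q) ∈ S := by
  classical
  rw [coeff_mul]
  exact S.sum_mem fun p _ => S.mul_mem (hP _) (hQ _)

theorem IsPlexp.add {ψ : ℕ → A →+ A} {S : Subring A} {f g P Q : MvPowerSeries I A}
    (h : IsPlexp ψ S f P) (h' : IsPlexp ψ S g Q) : IsPlexp ψ S (f + g) (P * Q) where
  constantCoeff_eq := by rw [map_mul, h.constantCoeff_eq, h'.constantCoeff_eq, one_mul]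
  euler_eq := by
    rw [Derivation.leibniz, h.euler_eq, h'.euler_eq, dlog_add, smul_eq_mul, smul_eq_mul]; ring
  coeff_mem := coeff_mul_mem h.coeff_mem h'.coeff_mem

theorem IsPlexp.zero (ψ : ℕ → A →+ A) (S : Subring A) :
    IsPlexp ψ S (0 : MvPowerSeries I A) 1 where
  constantCoeff_eq := map_one _
  euler_eq := by rw [dlog_zero, zero_mul, Derivation.map_one_eq_zero]
  coeff_mem γ := by
    classical
    rw [coeff_one]; split_ifs
    exacts [S.one_mem, S.zero_mem]

/-- The inverse series `P⁻¹` works: a series over `S` with constant term 1 is invertible over `S`,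
its inverse being computed by a recursion without divisions. -/
theorem IsPlexp.neg {ψ : ℕ → A →+ A} {S : Subring A} {f P : MvPowerSeries I A}
    (h : IsPlexp ψ S f P) : ∃ Q, IsPlexp ψ S (-f) Q := by
  classical
  let Q := MvPowerSeries.invOfUnit P 1
  have hPQ : P * Q = 1 := MvPowerSeries.mul_invOfUnit P 1 (by simp [h.constantCoeff_eq])
  refine ⟨Q, ?_, ?_, ?_⟩
  · have := congrArg constantCoeff hPQ
    rwa [map_mul, h.constantCoeff_eq, one_mul, map_one] at this
  · have h1 : euler (P * Q) = 0 := by rw [hPQ, Derivation.map_one_eq_zero]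
    rw [Derivation.leibniz, h.euler_eq, smul_eq_mul, smul_eq_mul] at h1
    rw [dlog_neg]
    -- The bracket is the derivative of `P * Q = 1`, hence zero; the last summand corrects for
    -- replacing `P * Q` by 1.
    calc euler Q = Q * (P * euler Q + Q * (dlog ψ f * P)) - dlog ψ f * Q * (P * Q)
          + (1 - P * Q) * euler Q := by ring
      _ = -dlog ψ f * Q := by rw [h1, hPQ]; ring
  · intro γ
    induction hn : γ.degree using Nat.strong_induction_on generalizing γ with
    | _ n ih =>
      by_cases hγ : γ = 0
      · subst hγ
        simp [Q, S.one_mem]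
      have h1 : coeff γ (P * Q) = 0 := by rw [hPQ, coeff_one, if_neg hγ]
      rw [coeff_mul, ← add_sum_erase _ _ (a := (0, γ)) (by simp),
        coeff_zero_eq_constantCoeff_apply, h.constantCoeff_eq, one_mul] at h1
      rw [eq_neg_of_add_eq_zero_left h1]
      refine S.neg_mem (S.sum_mem fun p hp => S.mul_mem (h.coeff_mem _) (ih _ ?_ _ rfl))
      rw [mem_erase, HasAntidiagonal.mem_antidiagonal] at hp
      have : p.1.degree ≠ 0 := by
        intro h0
        have h0' := (Finsupp.degree_eq_zero_iff _).1 h0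
        refine hp.1 (Prod.ext h0' ?_)
        rw [← hp.2, h0', zero_add]
      rw [← hn, ← hp.2, map_add]
      omega

/-- The hypothesis `he` is Newton's identity between complete symmetric functions `e n` and power
sums `ψ k g`. It says that `∑ e n y ^ (n β)` is the plethystic exponential of `g y ^ β`. All series
involved are supported on the multiples of `β`, so that everything is the image of an identity in
one variable. -/
theorem IsPlexp.monomial {ψ : ℕ → A →+ A} {S : Subring A} {β : I →₀ ℕ} (hβ : β ≠ 0) {g : A}
    {e : ℕ → A} (h0 : e 0 = 1) (he : ∀ n : ℕ, (n : A) * e n = ∑ k ∈ Icc 1 n, ψ k g * e (n - k))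
    (hS : ∀ n, e n ∈ S) : ∃ P, IsPlexp ψ S (MvPowerSeries.monomial β g) P := by
  classical
  have hs : PowerSeries.HasSubst (MvPowerSeries.monomial β (1 : A)) :=
    PowerSeries.HasSubst.monomial hβ 1
  have hpow : ∀ d : ℕ, MvPowerSeries.monomial β (1 : A) ^ d = MvPowerSeries.monomial (d • β) 1 :=
    fun d => by rw [MvPowerSeries.monomial_pow, one_pow]
  have hdeg : β.degree ≠ 0 := fun h => hβ ((Finsupp.degree_eq_zero_iff _).1 h)
  have hinj : ∀ d d' : ℕ, d • β = d' • β → d = d' := fun d d' h => by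
    have := congrArg Finsupp.degree h
    rw [map_nsmul, map_nsmul, smul_eq_mul, smul_eq_mul] at this
    exact Nat.eq_of_mul_eq_mul_right (Nat.pos_of_ne_zero hdeg) this
  have hc : ∀ (f : PowerSeries A) (d : ℕ),
      coeff (d • β) (f.subst (MvPowerSeries.monomial β (1 : A))) = PowerSeries.coeff d f := by
    intro f d
    rw [PowerSeries.coeff_subst hs, finsum_eq_single _ d]
    · rw [hpow, MvPowerSeries.coeff_monomial, if_pos rfl, smul_eq_mul, mul_one]
    · intro d' hd'
      rw [hpow, MvPowerSeries.coeff_monomial, if_neg (fun h => hd' (hinj _ _ h).symm), smul_zero]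
  have hc' : ∀ (f : PowerSeries A) (γ : I →₀ ℕ), (∀ d : ℕ, d • β ≠ γ) →
      coeff γ (f.subst (MvPowerSeries.monomial β (1 : A))) = 0 := by
    intro f γ hγ
    rw [PowerSeries.coeff_subst hs]
    refine finsum_eq_zero_of_forall_eq_zero fun d => ?_
    rw [hpow, MvPowerSeries.coeff_monomial, if_neg (fun h => hγ d h.symm), smul_zero]
  -- The factor `β.degree` appears because the Euler operator multiplies `y ^ (n β)` by `n *
  -- β.degree`, whereas Newton's identity has `n`.
  let L : PowerSeries A := PowerSeries.mk fun n => if n = 0 then 0 else (β.degree : A) * ψ n g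
  have hL : dlog ψ (MvPowerSeries.monomial β g) =
      L.subst (MvPowerSeries.monomial β (1 : A)) := by
    ext γ
    rw [coeff_dlog]
    by_cases hγ : ∃ d : ℕ, d • β = γ
    · obtain ⟨d, rfl⟩ := hγ
      rw [hc, PowerSeries.coeff_mk]
      split_ifs with hd
      · subst hd; simp
      rw [sum_eq_single d, sum_eq_single β]
      · rw [if_pos rfl, MvPowerSeries.coeff_monomial, if_pos rfl]
      · intro δ _ hδ
        rw [MvPowerSeries.coeff_monomial, if_neg hδ, map_zero, mul_zero, ite_self]
      · intro h
        refine absurd (mem_Iic.2 ?_) h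
        intro i
        simpa using Nat.le_mul_of_pos_left (β i) (Nat.pos_of_ne_zero hd)
      · intro n _ hn
        refine sum_eq_zero fun δ _ => ?_
        by_cases hδ : δ = β
        · subst hδ
          rw [if_neg fun h => hn (hinj _ _ h)]
        · rw [MvPowerSeries.coeff_monomial, if_neg hδ, map_zero, mul_zero, ite_self]
      · intro h
        refine absurd (mem_Icc.2 ⟨Nat.pos_of_ne_zero hd, ?_⟩) h
        rw [map_nsmul, smul_eq_mul]
        exact Nat.le_mul_of_pos_right d (Nat.pos_of_ne_zero hdeg)
    · rw [hc' _ _ fun d h => hγ ⟨d, h⟩]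
      refine sum_eq_zero fun n _ => sum_eq_zero fun δ _ => ?_
      by_cases hδ : δ = β
      · subst hδ
        rw [if_neg fun h => hγ ⟨n, h⟩]
      · rw [MvPowerSeries.coeff_monomial, if_neg hδ, map_zero, mul_zero, ite_self]
  refine ⟨(PowerSeries.mk e).subst (MvPowerSeries.monomial β (1 : A)), ?_, ?_, ?_⟩
  · rw [← coeff_zero_eq_constantCoeff_apply, ← zero_nsmul β, hc, PowerSeries.coeff_mk, h0]
  · have hE : (PowerSeries.mk fun n => (β.degree : A) * (n * e n)) = L * PowerSeries.mk e := by
      ext n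
      have hI : Icc 1 n = Ico (0 + 1) (n + 1) := by ext; simp
      rw [PowerSeries.coeff_mk, he, PowerSeries.coeff_mul,
        Finset.Nat.sum_antidiagonal_eq_sum_range_succ_mk, mul_sum, sum_range_succ', hI,
        ← sum_Ico_add' (fun k => (β.degree : A) * (ψ k g * e (n - k))) 0 n 1,
        ← Finset.range_eq_Ico]
      simp [L, mul_assoc]
    rw [hL, ← PowerSeries.subst_mul hs, ← hE]
    ext γ
    rw [coeff_euler]
    by_cases hγ : ∃ d : ℕ, d • β = γ
    · obtain ⟨d, rfl⟩ := hγ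
      rw [hc, hc, PowerSeries.coeff_mk, PowerSeries.coeff_mk, map_nsmul, smul_eq_mul]
      push_cast; ring
    · rw [hc' _ _ fun d h => hγ ⟨d, h⟩, hc' _ _ fun d h => hγ ⟨d, h⟩, mul_zero]
  · intro γ
    by_cases hγ : ∃ d : ℕ, d • β = γ
    · obtain ⟨d, rfl⟩ := hγ
      rw [hc, PowerSeries.coeff_mk]
      exact hS d
    · rw [hc' _ _ fun d h => hγ ⟨d, h⟩]
      exact S.zero_mem

end dlog

end Plethysm

noncomputable section

namespace Plethysm

open MvPowerSeries Finset

/-! ### Existence and integrality of plethystic exponentials -/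

section existence

variable {I : Type*} {A : Type*} [CommRing A]

theorem coeff_dlog_congr (ψ : ℕ → A →+ A) {f g : MvPowerSeries I A} {γ : I →₀ ℕ}
    (h : ∀ δ ≤ γ, δ ≠ 0 → coeff δ f = coeff δ g) : coeff γ (dlog ψ f) = coeff γ (dlog ψ g) := by
  classical
  simp only [coeff_dlog]
  refine sum_congr rfl fun n _ => sum_congr rfl fun δ hδ => ?_
  by_cases h0 : δ = 0
  · subst h0; simp
  · rw [h δ (mem_Iic.1 hδ) h0]

/-- Dividing the coefficients of `L` by their degrees inverts the Euler operator; the exponential of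
the result is the solution. -/
theorem exists_euler_eq [Algebra ℚ A] {L : MvPowerSeries I A} (hL : constantCoeff L = 0) :
    ∃ P : MvPowerSeries I A, constantCoeff P = 1 ∧ euler P = L * P := by
  let M : MvPowerSeries I A := fun γ => algebraMap ℚ A (1 / (γ.degree : ℚ)) * coeff γ L
  have hM : constantCoeff M = 0 := by
    change algebraMap ℚ A (1 / ((0 : I →₀ ℕ).degree : ℚ)) * coeff 0 L = 0
    rw [coeff_zero_eq_constantCoeff_apply, hL, mul_zero]
  have hML : euler M = L := by
    ext γ
    change (γ.degree : A) * (algebraMap ℚ A (1 / (γ.degree : ℚ)) * coeff γ L) = _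
    by_cases h : γ = 0
    · subst h; rw [coeff_zero_eq_constantCoeff_apply, hL, mul_zero, mul_zero]
    · have hn : (γ.degree : ℚ) ≠ 0 := by
        exact_mod_cast fun h' => h (Finsupp.degree_eq_zero_iff γ |>.1 h')
      rw [← mul_assoc, ← map_natCast (algebraMap ℚ A), ← map_mul, mul_one_div_cancel hn, map_one,
        one_mul]
  exact ⟨_, constantCoeff_subst_exp hM, by rw [euler_subst_exp hM, hML]⟩

theorem exists_isPlexp_sum {ψ : ℕ → A →+ A} {S : Subring A} {ι : Type*} (s : Finset ι)
    (f : ι → MvPowerSeries I A) (h : ∀ i ∈ s, ∃ P, IsPlexp ψ S (f i) P) :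
    ∃ P, IsPlexp ψ S (∑ i ∈ s, f i) P := by
  classical
  induction s using Finset.induction_on with
  | empty => exact ⟨1, by simpa using IsPlexp.zero ψ S⟩
  | insert a s ha ih =>
    obtain ⟨P, hP⟩ := h a (mem_insert_self _ _)
    obtain ⟨Q, hQ⟩ := ih fun i hi => h i (mem_insert_of_mem hi)
    rw [sum_insert ha]
    exact ⟨_, hP.add hQ⟩

/-- Integrality needs to be checked only on additive generators of the coefficients: sums and
negatives become products and inverses, and the coefficient of the exponential at `α` sees only the
finitely many monomials `y ^ β` with `β ≤ α`. -/
theorem exists_isPlexp_of_mem_closure [Algebra ℚ A] {ψ : ℕ → A →+ A} {S : Subring A} {G : Set A}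
    (hG : ∀ g ∈ G, ∃ e : ℕ → A, e 0 = 1 ∧
      (∀ n : ℕ, (n : A) * e n = ∑ k ∈ Icc 1 n, ψ k g * e (n - k)) ∧ ∀ n, e n ∈ S)
    (f : MvPowerSeries I A) (hf : ∀ β, coeff β f ∈ AddSubgroup.closure G) :
    ∃ P, IsPlexp ψ S f P := by
  classical
  have hmono : ∀ β : I →₀ ℕ, β ≠ 0 → ∀ a ∈ AddSubgroup.closure G,
      ∃ P, IsPlexp ψ S (MvPowerSeries.monomial β a) P := by
    intro β hβ a ha
    induction ha using AddSubgroup.closure_induction with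
    | mem g hg =>
      obtain ⟨e, h0, he, hS⟩ := hG g hg
      exact IsPlexp.monomial hβ h0 he hS
    | zero => exact ⟨1, by simpa using IsPlexp.zero ψ S⟩
    | add a b _ _ ha hb =>
      obtain ⟨P, hP⟩ := ha
      obtain ⟨Q, hQ⟩ := hb
      exact ⟨_, by simpa using hP.add hQ⟩
    | neg a _ ha =>
      obtain ⟨P, hP⟩ := ha
      simpa using hP.neg
  obtain ⟨P, hP0, hP⟩ := exists_euler_eq (constantCoeff_dlog ψ f)
  refine ⟨P, hP0, hP, fun α => ?_⟩
  -- The constant term of `f` is dropped: it has no influence on `dlog`, and the monomial case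
  -- requires `β ≠ 0`.
  let s := (Iic α).erase 0
  obtain ⟨Q, hQ⟩ := exists_isPlexp_sum s (fun β => MvPowerSeries.monomial β (coeff β f))
    fun β hβ => hmono β (ne_of_mem_erase hβ) _ (hf β)
  rw [coeff_eq_of_euler_eq (α := α) (constantCoeff_dlog ψ f) (fun γ hγ => ?_) hP hQ.euler_eq
    (hP0.trans hQ.constantCoeff_eq.symm) le_rfl]
  · exact hQ.coeff_mem α
  · refine coeff_dlog_congr ψ fun δ hδ h0 => ?_
    rw [map_sum, sum_eq_single δ]
    · rw [MvPowerSeries.coeff_monomial, if_pos rfl]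
    · intro β _ hβ
      rw [MvPowerSeries.coeff_monomial, if_neg hβ.symm]
    · exact fun h => absurd (mem_erase.2 ⟨h0, mem_Iic.2 (hδ.trans hγ)⟩) h

end existence

/-! ### The characterisation of `plexp` over `ℚ(t)` -/

section ratFunc

variable {I : Type*}

open scoped Classical in
theorem coeff_adams {n : ℕ} (hn : n ≠ 0) (f : MvPowerSeries I (RatFunc ℚ)) (γ : I →₀ ℕ) :
    coeff γ (adams n hn f) = ∑ δ ∈ Iic γ, if n • δ = γ then substT n hn (coeff δ f) else 0 := by
  change coeff γ (MvPowerSeries.expand n hn (MvPowerSeries.map (substT n hn) f)) = _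
  by_cases h : ∃ δ, n • δ = γ
  · obtain ⟨δ, rfl⟩ := h
    rw [coeff_expand_smul, MvPowerSeries.coeff_map, sum_eq_single δ, if_pos rfl]
    · intro δ' _ hδ'
      rw [if_neg fun h => hδ' (nsmul_right_injective hn h)]
    · intro h
      refine absurd (mem_Iic.2 ?_) h
      intro i
      simpa using Nat.le_mul_of_pos_left (δ i) (Nat.pos_of_ne_zero hn)
  · have : ∃ i, ¬ n ∣ γ i := by
      by_contra! hd
      refine h ⟨γ.mapRange (· / n) (Nat.zero_div n), ?_⟩
      ext i
      simpa using Nat.mul_div_cancel' (hd i)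
    obtain ⟨i, hi⟩ := this
    rw [coeff_expand_of_not_dvd _ _ _ hi]
    exact (sum_eq_zero fun δ _ => if_neg fun h' => h ⟨δ, h'⟩).symm

/-- The Adams operations on `ℚ(t)`, with value `0` at `n = 0`. -/
def adamsT (n : ℕ) : RatFunc ℚ →+ RatFunc ℚ :=
  if hn : n ≠ 0 then (substT n hn).toAddMonoidHom else 0

/-- In `ψ_n(f) / n` the term at `γ = n • δ` gets the factor `γ.degree / n = δ.degree`, so the
denominators cancel. -/
theorem euler_adamsSum (f : MvPowerSeries I (RatFunc ℚ)) :
    euler (adamsSum f) = dlog adamsT f := by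
  ext γ
  rw [coeff_euler, coeff_dlog]
  change _ * (∑ n ∈ Finset.range γ.degree,
    MvPowerSeries.coeff γ (adams (n + 1) n.succ_ne_zero f) / ((n + 1 : ℕ) : RatFunc ℚ)) = _
  have hI : Icc 1 γ.degree = Ico (0 + 1) (γ.degree + 1) := by ext; simp
  rw [hI, ← sum_Ico_add' _ 0 γ.degree 1, ← Finset.range_eq_Ico, mul_sum]
  refine sum_congr rfl fun n _ => ?_
  rw [coeff_adams, sum_div, mul_sum]
  refine sum_congr rfl fun δ _ => ?_
  split_ifs with h
  · have h' := congrArg Finsupp.degree h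
    rw [map_nsmul, smul_eq_mul] at h'
    have hn : ((n + 1 : ℕ) : RatFunc ℚ) ≠ 0 := by exact_mod_cast n.succ_ne_zero
    rw [← h', adamsT, dif_pos n.succ_ne_zero]
    push_cast at hn ⊢
    field_simp
    rfl
  · simp

theorem constantCoeff_adamsSum (f : MvPowerSeries I (RatFunc ℚ)) :
    constantCoeff (adamsSum f) = 0 := by
  rw [← coeff_zero_eq_constantCoeff_apply]
  exact (by simp [adamsSum] : adamsSum f 0 = 0)

theorem plexp_eq_of_euler {f P : MvPowerSeries I (RatFunc ℚ)} (h0 : constantCoeff P = 1)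
    (h : euler P = dlog adamsT f * P) : plexp f = P :=
  eq_of_euler_eq (constantCoeff_dlog adamsT f)
    (by rw [plexp, euler_subst_exp (constantCoeff_adamsSum f), euler_adamsSum]) h
    (by rw [h0]; exact constantCoeff_subst_exp (constantCoeff_adamsSum f))

end ratFunc

end Plethysm

/-! ### Polynomials and rational functions as functions of `q` -/

noncomputable section

namespace Plethysm

open Finset

/-- The integers `q ≥ 2`. -/
abbrev QBase : Type := {q : ℕ // 2 ≤ q}

/-- The power `q ^ n`, for `n ≠ 0`. -/
def QBase.pow (q : QBase) (n : ℕ) : QBase := if h : 2 ≤ q.1 ^ n then ⟨q.1 ^ n, h⟩ else q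

theorem QBase.coe_pow (q : QBase) {n : ℕ} (hn : n ≠ 0) : (q.pow n).1 = q.1 ^ n := by
  rw [QBase.pow, dif_pos (q.2.trans (Nat.le_self_pow hn _))]

/-- The Adams operations on the functions of `q`. -/
def adamsQ (n : ℕ) : (QBase → ℚ) →+ (QBase → ℚ) where
  toFun f q := f (q.pow n)
  map_zero' := rfl
  map_add' _ _ := rfl

/-- An integral polynomial as a function of `q`. -/
def polyFun : ℤ[X] →+* (QBase → ℚ) :=
  RingHom.pi fun q => Polynomial.eval₂RingHom (Int.castRingHom ℚ) (q.1 : ℚ)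

theorem polyFun_apply (p : ℤ[X]) (q : QBase) : polyFun p q = ((p.eval (q.1 : ℤ) : ℤ) : ℚ) := by
  change Polynomial.eval₂ (Int.castRingHom ℚ) (q.1 : ℚ) p = _
  rw [← Int.cast_natCast, Polynomial.eval₂_at_intCast]
  simp

/-- The functions `p(q) / d(q)` with `p` and `d` integral polynomials, `d` monic and without zeros. -/
def monicFun : Subring (QBase → ℚ) where
  carrier := {f | ∃ p d : ℤ[X], d.Monic ∧ (∀ q, polyFun d q ≠ 0) ∧ f * polyFun d = polyFun p}
  zero_mem' := ⟨0, 1, Polynomial.monic_one, by simp, by simp⟩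
  one_mem' := ⟨1, 1, Polynomial.monic_one, by simp, by simp⟩
  add_mem' := by
    rintro f g ⟨p, d, hd, hd0, h⟩ ⟨p', d', hd', hd0', h'⟩
    refine ⟨p * d' + p' * d, d * d', hd.mul hd', fun q => ?_, ?_⟩
    · rw [map_mul]; exact mul_ne_zero (hd0 q) (hd0' q)
    · rw [map_add, map_mul, map_mul, map_mul, ← h, ← h']; ring
  mul_mem' := by
    rintro f g ⟨p, d, hd, hd0, h⟩ ⟨p', d', hd', hd0', h'⟩
    refine ⟨p * p', d * d', hd.mul hd', fun q => ?_, ?_⟩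
    · rw [map_mul]; exact mul_ne_zero (hd0 q) (hd0' q)
    · rw [map_mul, map_mul, ← h, ← h']; ring
  neg_mem' := by
    rintro f ⟨p, d, hd, hd0, h⟩
    exact ⟨-p, d, hd, hd0, by rw [map_neg, ← h]; ring⟩

theorem polyFun_mem_monicFun (p : ℤ[X]) : polyFun p ∈ monicFun :=
  ⟨p, 1, Polynomial.monic_one, by simp, by simp⟩

theorem inv_polyFun_mem_monicFun {d : ℤ[X]} (hd : d.Monic) (h : ∀ q, polyFun d q ≠ 0) :
    (polyFun d)⁻¹ ∈ monicFun :=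
  ⟨1, d, hd, h, by ext q; simp [h q]⟩

/-- As `d` is monic, `p / d` is an integral polynomial plus a fraction `r / d` with `r` of smaller
degree. This fraction tends to 0, and it is an integer at arbitrarily large `q`, so it vanishes
there. A nonzero `r` has only finitely many zeros. -/
theorem exists_polyFun_eq {f : QBase → ℚ} (hf : f ∈ monicFun)
    (h : ∀ N : ℕ, ∃ q : QBase, N ≤ q.1 ∧ ∃ z : ℤ, f q = z) : ∃ p, f = polyFun p := by
  obtain ⟨p, d, hd, hd0, hfd⟩ := hf
  refine ⟨p /ₘ d, ?_⟩
  have hdiv : p %ₘ d + d * (p /ₘ d) = p := Polynomial.modByMonic_add_div p d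
  suffices hr : p %ₘ d = 0 by
    rw [hr, zero_add] at hdiv
    ext q
    have := congrFun hfd q
    rw [← hdiv, map_mul, Pi.mul_apply, Pi.mul_apply, mul_comm (polyFun d q)] at this
    exact mul_right_cancel₀ (hd0 q) this
  by_contra hr
  set r := p %ₘ d with hrdef
  have hdeg : r.degree < d.degree := Polynomial.degree_modByMonic_lt p hd
  let ρ : ℚ[X] := r.map (Int.castRingHom ℚ)
  let δ : ℚ[X] := d.map (Int.castRingHom ℚ)
  have hinj : Function.Injective (Int.castRingHom ℚ) := Int.cast_injective
  have hdeg' : ρ.degree < δ.degree := by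
    rw [Polynomial.degree_map_eq_of_injective hinj, Polynomial.degree_map_eq_of_injective hinj]
    exact hdeg
  have hlim := Polynomial.div_tendsto_atTop_zero_of_degree_lt ρ δ hdeg'
  have hlim' := (hlim.comp tendsto_natCast_atTop_atTop).eventually
    (Metric.ball_mem_nhds (0 : ℚ) one_pos)
  have hρ0 : ρ ≠ 0 := by rwa [Ne, Polynomial.map_eq_zero_iff hinj]
  have hroots : ∀ᶠ n : ℕ in Filter.atTop, ρ.eval (n : ℚ) ≠ 0 := by
    have hfin : (ρ.rootSet ℚ).Finite := Polynomial.rootSet_finite ρ ℚ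
    have hfin' := (hfin.preimage (f := fun n : ℕ => (n : ℚ))
      (Nat.cast_injective.injOn)).eventually_cofinite_notMem
    rw [Nat.cofinite_eq_atTop] at hfin'
    filter_upwards [hfin'] with n hn h0
    refine hn ?_
    rw [Set.mem_preimage, Polynomial.mem_rootSet]
    exact ⟨hρ0, by simpa using h0⟩
  -- Beyond `N` the fraction has absolute value less than 1 and its numerator is nonzero; a larger
  -- `q` at which `f` is integral gives the contradiction.
  obtain ⟨N, hN⟩ := Filter.eventually_atTop.1 (hlim'.and hroots)
  obtain ⟨q, hq, z, hz⟩ := h N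
  obtain ⟨h1, h2⟩ := hN q.1 hq
  have hρq : ρ.eval (q.1 : ℚ) = polyFun r q := by
    rw [Polynomial.eval_map]; rfl
  have hδq : δ.eval (q.1 : ℚ) = polyFun d q := by
    rw [Polynomial.eval_map]; rfl
  have h3 := congrFun hfd q
  rw [← hdiv, map_add, map_mul, Pi.mul_apply, Pi.add_apply, Pi.mul_apply, hz,
    polyFun_apply (p /ₘ d)] at h3
  simp only [Function.comp_apply, dist_zero_right, hρq, hδq] at h1
  rw [hρq] at h2
  have h4 : polyFun r q / polyFun d q = ((z - (p /ₘ d).eval (q.1 : ℤ) : ℤ) : ℚ) := by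
    rw [div_eq_iff (hd0 q)]
    push_cast
    linear_combination -h3
  rw [h4] at h1
  have h5 : z - (p /ₘ d).eval (q.1 : ℤ) = 0 := by
    rw [Int.norm_cast_rat, Int.norm_eq_abs] at h1
    have : |z - (p /ₘ d).eval (q.1 : ℤ)| < 1 := by exact_mod_cast h1
    exact Int.abs_lt_one_iff.1 this
  rw [h5, Int.cast_zero, div_eq_zero_iff] at h4
  exact h4.elim h2 (hd0 q)

theorem polyFun_injective : Function.Injective polyFun := by
  intro p p' h
  refine Polynomial.eq_of_infinite_eval_eq p p' (Set.Infinite.mono ?_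
    ((Set.Ici_infinite (2 : ℕ)).image (f := fun n : ℕ => (n : ℤ)) Nat.cast_injective.injOn))
  rintro _ ⟨q, hq, rfl⟩
  have := congrFun h ⟨q, hq⟩
  rw [polyFun_apply, polyFun_apply] at this
  exact_mod_cast this

/-- The value at `q` of `|Nil M_m| / |GL_m|` over a field with `q` elements. -/
def nilFrac (q : ℚ) (m : ℕ) : ℚ := q ^ m.choose 2 / ∏ j ∈ Icc 1 m, (q ^ j - 1)

theorem nilFrac_zero (q : ℚ) : nilFrac q 0 = 1 := by simp [nilFrac]

theorem nilFrac_succ {q : ℚ} (hq : 1 < q) (m : ℕ) :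
    nilFrac q (m + 1) * (q ^ (m + 1) - 1) = q ^ m * nilFrac q m := by
  have h : ∀ j, j ≠ 0 → q ^ j - 1 ≠ 0 := fun j hj =>
    (sub_pos.2 (one_lt_pow₀ hq hj)).ne'
  rw [nilFrac, nilFrac, Finset.prod_Icc_succ_top (by omega), Nat.choose_succ_succ' m 1,
    Nat.choose_one_right, pow_add]
  have h1 : ∏ j ∈ Icc 1 m, (q ^ j - 1) ≠ 0 :=
    prod_ne_zero_iff.2 fun j hj => h j (by rw [mem_Icc] at hj; omega)
  have h2 := h (m + 1) m.succ_ne_zero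
  field_simp

-- This is Newton's identity for the power sums `1 / (q ^ k - 1)`: the numbers `nilFrac q n` are the
-- coefficients of the plethystic exponential of `x / (q - 1)`. Their generating series `e`
-- satisfies the `q`-difference equation `e(q x) (1 - x) = e(x)`, which characterises it up to the
-- constant term.
open PowerSeries in
theorem mul_nilFrac {q : ℚ} (hq : 1 < q) (n : ℕ) :
    (n : ℚ) * nilFrac q n = ∑ k ∈ Icc 1 n, 1 / (q ^ k - 1) * nilFrac q (n - k) := by
  have hne : ∀ j, j ≠ 0 → q ^ j - 1 ≠ 0 := fun j hj =>
    (sub_pos.2 (one_lt_pow₀ hq hj)).ne'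
  let e : PowerSeries ℚ := PowerSeries.mk (nilFrac q)
  -- At `k = 0` the division by zero gives 0, so that `l` has no constant term, as needed.
  let l : PowerSeries ℚ := PowerSeries.mk fun k => 1 / (q ^ k - 1)
  let g : PowerSeries ℚ := PowerSeries.mk 1
  let G : PowerSeries ℚ := PowerSeries.mk fun n => (n : ℚ) * nilFrac q n
  have hg : (1 - X) * g = 1 := by rw [mul_comm]; exact PowerSeries.mk_one_mul_one_sub_eq_one ℚ
  have h1 : rescale q e * (1 - X) = e := by
    ext n
    cases n with
    | zero =>
      rw [mul_sub, mul_one, map_sub, coeff_rescale, coeff_zero_mul_X]; simp [e]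
    | succ n =>
      rw [mul_sub, mul_one, map_sub, coeff_succ_mul_X, coeff_rescale, coeff_rescale]
      simp only [e, coeff_mk]
      linear_combination nilFrac_succ hq n
  have h1' : rescale q e = e * g := by
    linear_combination g * h1 - rescale q e * hg
  have h2 : rescale q l = l + X * g := by
    ext n
    cases n with
    | zero => simp [l]
    | succ n =>
      rw [map_add, coeff_succ_X_mul, coeff_rescale]
      simp only [l, g, coeff_mk, Pi.one_apply]
      have := hne (n + 1) n.succ_ne_zero
      field_simp
      ring
  have h3 : rescale q G * (1 - X) = G + X * (e * g) := by
    ext n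
    cases n with
    | zero =>
      rw [mul_sub, mul_one, map_sub, coeff_rescale, coeff_zero_mul_X, map_add, coeff_zero_X_mul]
      simp [G]
    | succ n =>
      rw [mul_sub, mul_one, map_sub, coeff_succ_mul_X, coeff_rescale, coeff_rescale, map_add,
        coeff_succ_X_mul, ← h1', coeff_rescale]
      simp only [e, G, coeff_mk]
      push_cast
      linear_combination ((n : ℚ) + 1) * nilFrac_succ hq n
  have h4 : rescale q (e * l) * (1 - X) = e * l + X * (e * g) := by
    rw [map_mul, h1', h2]
    linear_combination (e * l + e * X * g) * hg
  -- Both sides satisfy the same inhomogeneous `q`-difference equation. Their difference `Z`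
  -- satisfies `Z(q x) (1 - x) = Z(x)` and has no constant term, so it vanishes because `q ^ n ≠ 1`
  -- for `n ≠ 0`.
  have h5 : e * l = G := by
    have h6 : rescale q (e * l - G) * (1 - X) = e * l - G := by
      rw [map_sub, sub_mul, h3, h4]; ring
    have h7 : PowerSeries.coeff 0 (e * l - G) = 0 := by simp [l, G]
    rw [← sub_eq_zero]
    generalize e * l - G = Z at h6 h7
    ext n
    induction n with
    | zero => rw [h7, map_zero]
    | succ n ih =>
      have h7 := congrArg (PowerSeries.coeff (n + 1)) h6
      rw [mul_sub, mul_one, map_sub, coeff_succ_mul_X, coeff_rescale, coeff_rescale, ih, map_zero,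
        mul_zero, sub_zero] at h7
      rw [map_zero]
      exact (mul_eq_zero.1 (show (q ^ (n + 1) - 1) * coeff (n + 1) Z = 0 by
        linear_combination h7)).resolve_left (hne _ n.succ_ne_zero)
  have h8 := congrArg (PowerSeries.coeff n) h5
  have hI : Icc 1 n = Ico (0 + 1) (n + 1) := by ext; simp
  rw [mul_comm e, PowerSeries.coeff_mul, Finset.Nat.sum_antidiagonal_eq_sum_range_succ_mk,
    sum_range_succ'] at h8
  simp only [G, e, l, coeff_mk] at h8
  rw [← h8, hI, ← sum_Ico_add' (fun k => 1 / (q ^ k - 1) * nilFrac q (n - k)) 0 n 1,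
        ← Finset.range_eq_Ico]
  simp

/-- The inverse of `t - 1`. -/
def invSubOne : QBase → ℚ := fun q => ((q.1 : ℚ) - 1)⁻¹

theorem QBase.one_lt (q : QBase) : (1 : ℚ) < q.1 := by exact_mod_cast q.2

theorem nilFrac_mem_monicFun (m : ℕ) : (fun q : QBase => nilFrac q.1 m) ∈ monicFun := by
  let d : ℤ[X] := ∏ j ∈ Icc 1 m, (Polynomial.X ^ j - 1)
  have hd : d.Monic := Polynomial.monic_prod_of_monic _ _ fun j hj =>
    Polynomial.monic_X_pow_sub_C 1 (by rw [mem_Icc] at hj; omega)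
  have hv : ∀ q : QBase, polyFun d q = ∏ j ∈ Icc 1 m, ((q.1 : ℚ) ^ j - 1) := by
    intro q
    simp [d, polyFun_apply, Polynomial.eval_prod]
  have h0 : ∀ q, polyFun d q ≠ 0 := by
    intro q
    rw [hv]
    exact prod_ne_zero_iff.2 fun j hj => (sub_pos.2 (one_lt_pow₀ q.one_lt
      (by rw [mem_Icc] at hj; omega))).ne'
  convert monicFun.mul_mem (polyFun_mem_monicFun (Polynomial.X ^ m.choose 2))
    (inv_polyFun_mem_monicFun hd h0) using 1
  ext q
  rw [Pi.mul_apply, Pi.inv_apply, hv, nilFrac, polyFun_apply]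
  simp [div_eq_mul_inv]

variable {I : Type*}

theorem polyFun_mul_mem_closure (a : QBase → ℚ) (p : ℤ[X]) :
    polyFun p * a ∈ AddSubgroup.closure
      (Set.range fun k : ℕ => polyFun (Polynomial.X ^ k) * a) := by
  induction p using Polynomial.induction_on' with
  | add p p' hp hp' => rw [map_add, add_mul]; exact add_mem hp hp'
  | monomial k c =>
    have : polyFun (Polynomial.monomial k c) * a = c • (polyFun (Polynomial.X ^ k) * a) := by
      rw [← Polynomial.smul_X_eq_monomial, map_zsmul, smul_mul_assoc]
    rw [this]
    exact zsmul_mem (AddSubgroup.subset_closure (Set.mem_range_self k)) _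

/-- For the generator `t ^ k` the exponential of `t ^ k y ^ β` is the geometric series with
coefficients `t ^ (k n)`, so all coefficients stay in `ℤ[t]`. -/
theorem exists_isPlexp_polyFun (f : (I →₀ ℕ) → ℤ[X]) :
    ∃ P, IsPlexp adamsQ polyFun.range (fun β => polyFun (f β) : MvPowerSeries I (QBase → ℚ)) P := by
  refine exists_isPlexp_of_mem_closure
    (G := Set.range fun k : ℕ => polyFun (Polynomial.X ^ k) * 1) ?_ _ fun β => ?_
  · rintro _ ⟨k, rfl⟩
    refine ⟨fun n => polyFun (Polynomial.X ^ (k * n)), by simp, fun n => ?_, fun n => RingHom.mem_range_self polyFun _⟩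
    rw [sum_congr rfl (g := fun _ => polyFun (Polynomial.X ^ (k * n)))]
    · simp
    · intro j hj
      rw [mem_Icc] at hj
      ext q
      change polyFun (Polynomial.X ^ k) (q.pow j) * 1 * polyFun (Polynomial.X ^ (k * (n - j))) q = _
      rw [polyFun_apply, polyFun_apply, polyFun_apply, q.coe_pow (by omega)]
      simp only [Polynomial.eval_pow, Polynomial.eval_X]
      push_cast
      rw [mul_one, ← pow_mul, ← pow_add]
      congr 1
      obtain ⟨i, rfl⟩ := Nat.exists_eq_add_of_le hj.2
      rw [Nat.add_sub_cancel_left]; ring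
  · change polyFun (f β) ∈ _
    simpa only [mul_one] using polyFun_mul_mem_closure 1 (f β)

/-- For the generator `t ^ k / (t - 1)` the coefficients are `t ^ (k n)` times `nilFrac`, by
`mul_nilFrac`; their denominators are products of the monic polynomials `t ^ j - 1`. -/
theorem exists_isPlexp_invSubOne (f : (I →₀ ℕ) → ℤ[X]) :
    ∃ P, IsPlexp adamsQ monicFun
      (fun β => polyFun (f β) * invSubOne : MvPowerSeries I (QBase → ℚ)) P := by
  refine exists_isPlexp_of_mem_closure
    (G := Set.range fun k : ℕ => polyFun (Polynomial.X ^ k) * invSubOne) ?_ _ fun β => ?_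
  · rintro _ ⟨k, rfl⟩
    refine ⟨fun n => polyFun (Polynomial.X ^ (k * n)) * fun q => nilFrac q.1 n, ?_, fun n => ?_,
      fun n => monicFun.mul_mem (polyFun_mem_monicFun _) (nilFrac_mem_monicFun n)⟩
    · ext q; simp [nilFrac_zero]
    · ext q
      have h := mul_nilFrac q.one_lt n
      have hX : ∀ m, polyFun (Polynomial.X ^ m) q = (q.1 : ℚ) ^ m := fun m => by
        rw [polyFun_apply]; simp
      rw [Finset.sum_apply]
      calc _ = (q.1 : ℚ) ^ (k * n) * (n * nilFrac q.1 n) := by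
            change (n : ℚ) * (polyFun (Polynomial.X ^ (k * n)) q * nilFrac q.1 n) = _
            rw [hX]; ring
        _ = _ := by
            rw [h, mul_sum]
            refine sum_congr rfl fun j hj => ?_
            rw [mem_Icc] at hj
            change _ = polyFun (Polynomial.X ^ k) (q.pow j) * (((q.pow j).1 : ℚ) - 1)⁻¹ *
              (polyFun (Polynomial.X ^ (k * (n - j))) q * nilFrac q.1 (n - j))
            rw [hX, polyFun_apply, q.coe_pow (by omega)]
            obtain ⟨i, rfl⟩ := Nat.exists_eq_add_of_le hj.2
            rw [Nat.add_sub_cancel_left]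
            simp only [Polynomial.eval_pow, Polynomial.eval_X]
            push_cast
            ring
  · exact polyFun_mul_mem_closure invSubOne (f β)

end Plethysm

/-! ### Euler products over a set of orbits -/

noncomputable section

namespace Plethysm

open Finset

section orbits

variable {I O : Type*} (d : O → ℕ) (b : O → I →₀ ℕ)

/-- The weight of a multiset `s` of elements of `O`, where `o` has the weight `d o • b o`. -/
def total (s : O →₀ ℕ) : I →₀ ℕ := s.sum fun o m => (m * d o) • b o

theorem total_single (o : O) (k : ℕ) : total d b (Finsupp.single o k) = (k * d o) • b o := by
  rw [total, Finsupp.sum_single_index]; simp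

theorem total_add (s s' : O →₀ ℕ) : total d b (s + s') = total d b s + total d b s' := by
  classical
  rw [total, Finsupp.sum_add_index']
  · rfl
  · simp
  · intro o m m'; rw [add_mul, add_smul]

theorem degree_total (s : O →₀ ℕ) :
    (total d b s).degree = s.sum fun o m => m * d o * (b o).degree := by
  rw [total, Finsupp.sum, map_sum]
  exact sum_congr rfl fun o _ => by rw [map_nsmul, smul_eq_mul]

variable {d b}

/-- Newton's identity `he` is applied to the factor at `o`; the other factors are unchanged by
removing copies of `o`. -/
theorem mul_prod_eq_sum {e : ℕ → ℕ → ℚ} {c : ℕ → ℚ} (h0 : ∀ n, e n 0 = 1)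
    (he : ∀ n m : ℕ, n ≠ 0 → (m : ℚ) * e n m = ∑ k ∈ Icc 1 m, c (k * n) * e n (m - k))
    (hd : ∀ o, d o ≠ 0) (s : O →₀ ℕ) (o : O) :
    (s o : ℚ) * s.prod (fun o m => e (d o) m) =
      ∑ k ∈ Icc 1 (s o), c (k * d o) * (s - Finsupp.single o k).prod fun o m => e (d o) m := by
  classical
  have key : ∀ t : O →₀ ℕ, (∀ o', o' ≠ o → t o' = s o') →
      t.prod (fun o m => e (d o) m) = e (d o) (t o) * ∏ o' ∈ s.support.erase o, e (d o') (s o') := by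
    intro t ht
    rw [Finsupp.prod_of_support_subset t (s := insert o s.support) _ _ fun o _ => h0 _]
    · rw [← insert_erase (mem_insert_self o s.support), prod_insert (notMem_erase _ _),
        erase_insert_eq_erase]
      congr 1
      exact prod_congr rfl fun o' ho' => by rw [ht o' (ne_of_mem_erase ho')]
    · intro o' ho'
      by_cases h : o' = o
      · exact mem_insert.2 (Or.inl h)
      · refine mem_insert_of_mem ?_
        rw [Finsupp.mem_support_iff, ← ht o' h]
        exact Finsupp.mem_support_iff.1 ho'
  rw [key s fun _ _ => rfl, ← mul_assoc, he _ _ (hd o), sum_mul]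
  refine sum_congr rfl fun k _ => ?_
  rw [key _ fun o' ho' => ?_, Finsupp.tsub_apply, Finsupp.single_eq_same, mul_assoc]
  rw [Finsupp.tsub_apply, Finsupp.single_eq_of_ne ho', Nat.sub_zero]

-- `H` is the Euler product over `o` of `∑ e (d o) m y ^ (m d_o b_o)`. By Newton's identity the
-- factor at `o` has the logarithmic derivative `∑ d_o |b_o| c(k d_o) y ^ (k d_o b_o)`, the sum over
-- `k ≥ 1`; putting `n = k d_o` yields the weight `∑ d_o` over the `o` with `d_o ∣ n`. The finite
-- sets `S` and `F` express that all these sums are finite. Both kinds of generating series, of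
-- representations and of nilpotent pairs, are instances.
open MvPowerSeries in
open scoped Classical in
theorem euler_sum_prod {e : ℕ → ℕ → ℚ} {c : ℕ → ℚ} (h0 : ∀ n, e n 0 = 1)
    (he : ∀ n m : ℕ, n ≠ 0 → (m : ℚ) * e n m = ∑ k ∈ Icc 1 m, c (k * n) * e n (m - k))
    (hd : ∀ o, d o ≠ 0) (hb : ∀ o, b o ≠ 0) (S : (I →₀ ℕ) → Finset (O →₀ ℕ))
    (hS : ∀ α s, s ∈ S α ↔ total d b s = α) (F : ℕ → (I →₀ ℕ) → Finset O)
    (hF : ∀ n ≠ 0, ∀ δ o, o ∈ F n δ ↔ b o = δ ∧ d o ∣ n) (H Λ : MvPowerSeries I ℚ)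
    (hH : ∀ α, coeff α H = ∑ s ∈ S α, s.prod fun o m => e (d o) m)
    (hΛ : ∀ γ, coeff γ Λ = ∑ n ∈ Icc 1 γ.degree, ∑ δ ∈ Iic γ,
      if n • δ = γ then (δ.degree : ℚ) * (c n * (∑ o ∈ F n δ, d o : ℕ)) else 0) :
    euler H = Λ * H := by
  -- A pair `(o, k)` is regarded as the multiset of `k` copies of `o`; for `k ≠ 0` this is injective
  -- and lands in the finite set `S γ`.
  have hfinW : ∀ γ : I →₀ ℕ, {p : O × ℕ | p.2 ≠ 0 ∧ (p.2 * d p.1) • b p.1 = γ}.Finite := by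
    intro γ
    refine Set.Finite.of_finite_image (f := fun p : O × ℕ => Finsupp.single p.1 p.2)
      ((S γ).finite_toSet.subset ?_) ?_
    · rintro _ ⟨p, hp, rfl⟩
      rw [mem_coe, hS, total_single]
      exact hp.2
    · rintro ⟨o, k⟩ hp ⟨o', k'⟩ _ h
      rcases (Finsupp.single_eq_single_iff _ _ _ _).1 h with ⟨h1, h2⟩ | ⟨h1, _⟩
      · exact Prod.ext h1 h2
      · exact absurd h1 hp.1
  let W : (I →₀ ℕ) → Finset (O × ℕ) := fun γ => (hfinW γ).toFinset
  have hW : ∀ γ p, p ∈ W γ ↔ p.2 ≠ 0 ∧ (p.2 * d p.1) • b p.1 = γ := fun γ p => by simp [W]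
  let f : O × ℕ → ℚ := fun p => d p.1 * (b p.1).degree * c (p.2 * d p.1)
  -- The sum over `n`, `δ` and `o` is reindexed by pairs `(o, k)` with `n = k * d o` and `δ = b o`.
  have hΛW : ∀ γ, coeff γ Λ = ∑ p ∈ W γ, f p := by
    intro γ
    rw [hΛ, ← sum_product', ← sum_fiberwise_of_maps_to (s := W γ)
      (t := Icc 1 γ.degree ×ˢ Iic γ) (g := fun p => (p.2 * d p.1, b p.1))]
    · refine sum_congr rfl fun x hx => ?_
      obtain ⟨n, δ⟩ := x
      rw [mem_product, mem_Icc] at hx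
      have hn : n ≠ 0 := by have := hx.1.1; omega
      split_ifs with h
      · push_cast
        rw [mul_sum, mul_sum]
        refine sum_bij' (fun o _ => (o, n / d o)) (fun p _ => p.1) ?_ ?_ ?_ ?_ ?_
        · intro o ho
          obtain ⟨h1, h2⟩ := (hF n hn δ o).1 ho
          rw [mem_filter, hW]
          have h3 : n / d o * d o = n := Nat.div_mul_cancel h2
          refine ⟨⟨fun h0 => hn ?_, ?_⟩, ?_⟩
          · have h0' : n / d o = 0 := h0
            rw [← h3, h0', zero_mul]
          · change (n / d o * d o) • b o = γ
            rw [h3, h1]; exact h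
          · change (n / d o * d o, b o) = _
            rw [h3, h1]
        · intro p hp
          rw [mem_filter, Prod.mk.injEq] at hp
          exact (hF n hn δ _).2 ⟨hp.2.2, hp.2.1 ▸ dvd_mul_left _ _⟩
        · intro o _; rfl
        · intro p hp
          rw [mem_filter, Prod.mk.injEq] at hp
          refine Prod.ext rfl ?_
          change n / d p.1 = p.2
          rw [← hp.2.1, Nat.mul_div_cancel _ (Nat.pos_of_ne_zero (hd _))]
        · intro o ho
          obtain ⟨h1, h2⟩ := (hF n hn δ o).1 ho
          simp only [f]
          rw [Nat.div_mul_cancel h2, h1]; ring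
      · symm
        refine sum_eq_zero fun p hp => absurd ?_ h
        rw [mem_filter, hW, Prod.mk.injEq] at hp
        rw [← hp.2.1, ← hp.2.2]
        exact hp.1.2
    · intro p hp
      rw [hW] at hp
      have hpos : 0 < p.2 * d p.1 := Nat.pos_of_ne_zero (mul_ne_zero hp.1 (hd _))
      have hbpos : 0 < (b p.1).degree :=
        Nat.pos_of_ne_zero fun h => hb p.1 ((Finsupp.degree_eq_zero_iff _).1 h)
      rw [mem_product, mem_Icc, mem_Iic, ← hp.2, map_nsmul, smul_eq_mul]
      refine ⟨⟨hpos, Nat.le_mul_of_pos_right _ hbpos⟩, fun i => ?_⟩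
      simpa using Nat.le_mul_of_pos_left (b p.1 i) hpos
  ext α
  let h : (O →₀ ℕ) → ℚ := fun s => s.prod fun o m => e (d o) m
  have hL : coeff α (euler H) = ∑ x ∈ (S α).sigma fun s => s.support.sigma fun o => Icc 1 (s o),
      f (x.2.1, x.2.2) * h (x.1 - Finsupp.single x.2.1 x.2.2) := by
    rw [coeff_euler, hH, mul_sum, sum_sigma]
    refine sum_congr rfl fun s hs => ?_
    rw [sum_sigma, ← (hS α s).1 hs, degree_total, Finsupp.sum]
    push_cast
    rw [sum_mul]
    refine sum_congr rfl fun o _ => ?_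
    calc _ = d o * (b o).degree * (s o * s.prod fun o m => e (d o) m) := by ring
      _ = _ := by
        rw [mul_prod_eq_sum h0 he hd, mul_sum]
        exact sum_congr rfl fun k _ => by simp only [f, h]; ring
  have hR : coeff α (Λ * H) = ∑ p ∈ antidiagonal α, ∑ x ∈ W p.1 ×ˢ S p.2, f x.1 * h x.2 := by
    rw [coeff_mul]
    refine sum_congr rfl fun p _ => ?_
    rw [hΛW, hH, sum_mul_sum, sum_product]
  rw [hL, hR, sum_sigma']
  -- A multiset `s` with `k` marked copies of `o`, where `1 ≤ k ≤ s o`, corresponds to the pair `(o,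
  -- k)` together with the rest `s - k o`.
  refine sum_bij' (fun x _ => ⟨((x.2.2 * d x.2.1) • b x.2.1,
      total d b (x.1 - Finsupp.single x.2.1 x.2.2)),
      ((x.2.1, x.2.2), x.1 - Finsupp.single x.2.1 x.2.2)⟩)
    (fun y _ => ⟨y.2.2 + Finsupp.single y.2.1.1 y.2.1.2, y.2.1.1, y.2.1.2⟩) ?_ ?_ ?_ ?_ ?_
  · rintro ⟨s, o, k⟩ hx
    simp only [mem_sigma, mem_Icc, hS] at hx
    obtain ⟨hs, -, hk1, hk2⟩ := hx
    have hle : Finsupp.single o k ≤ s := by rwa [Finsupp.single_le_iff]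
    simp only [mem_sigma, mem_product, hW, hS, HasAntidiagonal.mem_antidiagonal, and_true]
    refine ⟨?_, by omega⟩
    rw [← total_single, ← total_add, add_tsub_cancel_of_le hle, hs]
  · rintro ⟨⟨γ, δ⟩, ⟨o, k⟩, s⟩ hy
    simp only [mem_sigma, mem_product, hW, hS, HasAntidiagonal.mem_antidiagonal] at hy
    obtain ⟨h1, ⟨h2, h3⟩, h4⟩ := hy
    simp only [mem_sigma, mem_Icc, hS, Finsupp.mem_support_iff, Finsupp.add_apply,
      Finsupp.single_eq_same, total_add, total_single]
    refine ⟨?_, by omega, by omega, by omega⟩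
    rw [h4, h3, add_comm, h1]
  · rintro ⟨s, o, k⟩ hx
    simp only [mem_sigma, mem_Icc, hS] at hx
    obtain ⟨hs, -, hk1, hk2⟩ := hx
    have hle : Finsupp.single o k ≤ s := by rwa [Finsupp.single_le_iff]
    simp only [tsub_add_cancel_of_le hle]
  · rintro ⟨⟨γ, δ⟩, ⟨o, k⟩, s⟩ hy
    simp only [mem_sigma, mem_product, hW, hS, HasAntidiagonal.mem_antidiagonal] at hy
    obtain ⟨h1, ⟨h2, h3⟩, h4⟩ := hy
    simp only [add_tsub_cancel_right, h3, h4]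
  · rintro ⟨s, o, k⟩ _
    rfl

end orbits

end Plethysm

/-! ### Intertwiners of nilpotent endomorphisms -/

noncomputable section

section intertwiners

open Module

variable {K V V' : Type*} [Field K] [AddCommGroup V] [Module K V] [AddCommGroup V'] [Module K V']

/-- The linear maps that intertwine two endomorphisms. -/
def intertwiners (θ : End K V) (θ' : End K V') : Submodule K (V →ₗ[K] V') where
  carrier := {f | f ∘ₗ θ = θ' ∘ₗ f}
  zero_mem' := by simp
  add_mem' := by
    intro f g hf hg
    rw [Set.mem_ofPred_eq] at *
    rw [LinearMap.add_comp, LinearMap.comp_add, hf, hg]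
  smul_mem' := by
    intro c f hf
    rw [Set.mem_ofPred_eq] at *
    rw [LinearMap.smul_comp, LinearMap.comp_smul, hf]

theorem mem_intertwiners {θ : End K V} {θ' : End K V'} {f : V →ₗ[K] V'} :
    f ∈ intertwiners θ θ' ↔ ∀ v, f (θ v) = θ' (f v) := LinearMap.ext_iff

/-- The ranks of the powers of an endomorphism. -/
def rankSeq (θ : End K V) (k : ℕ) : ℕ := finrank K (LinearMap.range (θ ^ k))

theorem rankSeq_zero (θ : End K V) : rankSeq θ 0 = finrank K V := by
  rw [rankSeq, pow_zero, Module.End.one_eq_id, LinearMap.range_id, finrank_top]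

theorem rankSeq_one (θ : End K V) : rankSeq θ 1 = finrank K (LinearMap.range θ) := by
  rw [rankSeq, pow_one]

/-- The restriction of an endomorphism to its range. -/
def restrictRange (θ : End K V) : End K (LinearMap.range θ) :=
  θ.restrict fun v _ => LinearMap.mem_range_self θ v

theorem restrictRange_pow_apply (θ : End K V) (k : ℕ) (x : LinearMap.range θ) :
    ((restrictRange θ ^ k) x : V) = (θ ^ k) x := by
  induction k generalizing x with
  | zero => rfl
  | succ k ih => rw [pow_succ, pow_succ, Module.End.mul_apply, ih]; rfl

theorem rankSeq_restrictRange (θ : End K V) (k : ℕ) :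
    rankSeq (restrictRange θ) k = rankSeq θ (k + 1) := by
  have h : (LinearMap.range (restrictRange θ ^ k)).map (LinearMap.range θ).subtype =
      LinearMap.range (θ ^ (k + 1)) := by
    ext x
    simp only [Submodule.mem_map, LinearMap.mem_range, Submodule.subtype_apply]
    constructor
    · rintro ⟨_, ⟨⟨_, v, rfl⟩, rfl⟩, rfl⟩
      exact ⟨v, by rw [restrictRange_pow_apply, pow_succ]; rfl⟩
    · rintro ⟨v, rfl⟩
      exact ⟨_, ⟨⟨θ v, v, rfl⟩, rfl⟩, by rw [restrictRange_pow_apply, pow_succ]; rfl⟩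
  rw [rankSeq, rankSeq, ← h, Submodule.finrank_map_subtype_eq]

theorem map_mem_range_of_mem_intertwiners {θ : End K V} {θ' : End K V'} {f : V →ₗ[K] V'}
    (hf : f ∈ intertwiners θ θ') : ∀ x ∈ LinearMap.range θ, f x ∈ LinearMap.range θ' := by
  rintro _ ⟨v, rfl⟩
  rw [mem_intertwiners.1 hf]
  exact LinearMap.mem_range_self _ _

/-- The restriction of intertwiners to the ranges. -/
def intertwinersRestrict (θ : End K V) (θ' : End K V') :
    intertwiners θ θ' →ₗ[K] intertwiners (restrictRange θ) (restrictRange θ') where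
  toFun f := ⟨f.1.restrict (map_mem_range_of_mem_intertwiners f.2), by
    rw [mem_intertwiners]
    exact fun v => Subtype.ext (mem_intertwiners.1 f.2 v)⟩
  map_add' _ _ := rfl
  map_smul' _ _ := rfl

/-- On a complement of the range of `θ` the only condition on an extension `f` of `g` is `θ' (f c) =
g (θ c)`, and a linear section of `θ'` over its range solves it. -/
theorem intertwinersRestrict_surjective (θ : End K V) (θ' : End K V') :
    Function.Surjective (intertwinersRestrict θ θ') := by
  rintro ⟨g, hg⟩
  rw [mem_intertwiners] at hg
  obtain ⟨C, hC⟩ := Submodule.exists_isCompl (LinearMap.range θ)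
  obtain ⟨s, hs⟩ := LinearMap.exists_rightInverse_of_surjective θ'.rangeRestrict
    (LinearMap.range_rangeRestrict θ')
  have hs' : ∀ x : LinearMap.range θ', θ' (s x) = x := fun x =>
    congrArg Subtype.val (LinearMap.congr_fun hs x)
  let f : V →ₗ[K] V' := LinearMap.ofIsCompl hC ((LinearMap.range θ').subtype ∘ₗ g)
    (s ∘ₗ g ∘ₗ θ.rangeRestrict ∘ₗ C.subtype)
  have hfW : ∀ x : LinearMap.range θ, f x = g x := fun x => LinearMap.ofIsCompl_apply_left hC x
  have hfC : ∀ x : C, f x = s (g (θ.rangeRestrict x)) := fun x =>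
    LinearMap.ofIsCompl_apply_right hC x
  have hf : f ∈ intertwiners θ θ' := by
    rw [mem_intertwiners]
    intro v
    have h1 : f (θ v) = g (θ.rangeRestrict v) := hfW (θ.rangeRestrict v)
    rw [h1]
    obtain ⟨a, b, rfl⟩ : ∃ (a : LinearMap.range θ) (b : C), v = a + b := by
      have : v ∈ LinearMap.range θ ⊔ C := by rw [hC.sup_eq_top]; trivial
      obtain ⟨a, ha, b, hb, h⟩ := Submodule.mem_sup.1 this
      exact ⟨⟨a, ha⟩, ⟨b, hb⟩, h.symm⟩
    rw [map_add, map_add, map_add, map_add, hfW, hfC, hs', Submodule.coe_add]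
    congr 1
    exact congrArg Subtype.val (hg a)
  refine ⟨⟨f, hf⟩, Subtype.ext (LinearMap.ext fun x => Subtype.ext (hfW x))⟩

variable [FiniteDimensional K V] [FiniteDimensional K V']

/-- An intertwiner that vanishes on the range of `θ` takes values in the kernel of `θ'`, so the
kernel in question is the space of all linear maps from the cokernel of `θ` to the kernel of `θ'`.
-/
theorem finrank_ker_intertwinersRestrict (θ : End K V) (θ' : End K V') :
    finrank K (LinearMap.ker (intertwinersRestrict θ θ')) =
      (rankSeq θ 0 - rankSeq θ 1) * (rankSeq θ' 0 - rankSeq θ' 1) := by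
  let W := LinearMap.range θ
  let N := LinearMap.ker θ'
  let j : (V ⧸ W →ₗ[K] N) → LinearMap.ker (intertwinersRestrict θ θ') := fun g =>
    ⟨⟨N.subtype ∘ₗ g ∘ₗ W.mkQ, mem_intertwiners.2 fun v => by
        have h1 : W.mkQ (θ v) = 0 :=
          (Submodule.Quotient.mk_eq_zero W).2 (LinearMap.mem_range_self θ v)
        have h2 : θ' (N.subtype (g (W.mkQ v))) = 0 := (g (W.mkQ v)).2
        simp only [LinearMap.comp_apply]
        rw [h1, h2, map_zero, map_zero]⟩, by
        rw [LinearMap.mem_ker]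
        refine Subtype.ext (LinearMap.ext fun x => Subtype.ext ?_)
        change N.subtype (g (W.mkQ x)) = 0
        have h1 : W.mkQ (x : V) = 0 := (Submodule.Quotient.mk_eq_zero W).2 x.2
        rw [h1, map_zero, map_zero]⟩
  let e : (V ⧸ W →ₗ[K] N) →ₗ[K] LinearMap.ker (intertwinersRestrict θ θ') :=
    { toFun := j, map_add' := fun _ _ => rfl, map_smul' := fun _ _ => rfl }
  have he : Function.Bijective e := by
    constructor
    · intro g g' h
      refine LinearMap.ext fun x => ?_
      obtain ⟨v, rfl⟩ := W.mkQ_surjective x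
      exact Subtype.ext (LinearMap.congr_fun (congrArg (fun z => z.1.1) h) v)
    · rintro ⟨⟨f, hf⟩, h0⟩
      have h0' : ∀ v, f (θ v) = 0 := fun v => by
        have := congrArg Subtype.val h0
        exact congrArg Subtype.val (LinearMap.congr_fun this ⟨θ v, v, rfl⟩)
      have h1 : W ≤ LinearMap.ker f := by
        rintro _ ⟨v, rfl⟩; exact h0' v
      have h2 : ∀ x, W.liftQ f h1 x ∈ N := by
        intro x
        obtain ⟨v, rfl⟩ := W.mkQ_surjective x
        change θ' (f v) = 0
        rw [← mem_intertwiners.1 hf, h0']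
      exact ⟨LinearMap.codRestrict N (W.liftQ f h1) h2, rfl⟩
  rw [← (LinearEquiv.ofBijective e he).finrank_eq, Module.finrank_linearMap, rankSeq_zero,
    rankSeq_zero, rankSeq_one, rankSeq_one, ← Submodule.finrank_quotient_add_finrank W,
    ← LinearMap.finrank_range_add_finrank_ker θ']
  simp [W, N]

/-- Restriction to the ranges shifts both rank sequences by one, and its kernel accounts for one
term of the sum. The point is that the dimension depends on the rank sequences only. -/
theorem finrank_intertwiners (N : ℕ) : ∀ {V V' : Type*} [AddCommGroup V] [Module K V]
    [AddCommGroup V'] [Module K V'] [FiniteDimensional K V] [FiniteDimensional K V']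
    (θ : End K V) (θ' : End K V'), rankSeq θ N = 0 →
    finrank K (intertwiners θ θ') = ∑ k ∈ Finset.range N,
      (rankSeq θ k - rankSeq θ (k + 1)) * (rankSeq θ' k - rankSeq θ' (k + 1)) := by
  induction N with
  | zero =>
    intro V V' _ _ _ _ _ _ θ θ' h
    rw [rankSeq_zero] at h
    have : Subsingleton V := finrank_zero_iff.1 h
    rw [Finset.sum_range_zero]
    exact finrank_zero_of_subsingleton
  | succ N ih =>
    intro V V' _ _ _ _ _ _ θ θ' h
    have hrk := LinearMap.finrank_range_add_finrank_ker (V := intertwiners θ θ')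
      (V₂ := intertwiners (restrictRange θ) (restrictRange θ')) (intertwinersRestrict θ θ')
    rw [← hrk,
      finrank_ker_intertwinersRestrict,
      LinearMap.range_eq_top.2 (intertwinersRestrict_surjective θ θ'), finrank_top,
      ih (restrictRange θ) (restrictRange θ') (by rw [rankSeq_restrictRange, h]),
      Finset.sum_range_succ']
    simp only [rankSeq_restrictRange]

theorem isNilpotent_of_rankSeq_eq_zero {θ : End K V} {k : ℕ} (h : rankSeq θ k = 0) :
    IsNilpotent θ :=
  ⟨k, LinearMap.range_eq_bot.1 (Submodule.finrank_eq_zero.1 h)⟩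

theorem rankSeq_eq_zero_of_isNilpotent {θ : End K V} (h : IsNilpotent θ) {k : ℕ}
    (hk : finrank K V ≤ k) : rankSeq θ k = 0 := by
  have h0 : θ ^ finrank K V = 0 := by
    have h1 := LinearMap.aeval_self_charpoly θ
    rwa [h.charpoly_eq_X_pow_finrank, map_pow, Polynomial.aeval_X] at h1
  have hk0 : θ ^ k = 0 := by
    obtain ⟨m, rfl⟩ := Nat.exists_eq_add_of_le hk
    rw [pow_add, h0, zero_mul]
  rw [rankSeq, hk0, LinearMap.range_zero, finrank_bot]

end intertwiners

/-! ### Counting endomorphisms by the ranks of their powers -/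

noncomputable section

section counting

open Module

theorem card_preimage_of_surjective {G H : Type*} [AddGroup G] [AddGroup H] (φ : G →+ H)
    (hφ : Function.Surjective φ) (T : H → Prop) :
    Nat.card {g // T (φ g)} = Nat.card {h // T h} * Nat.card φ.ker := by
  rw [← Nat.card_prod]
  let s := Function.surjInv hφ
  have hs : ∀ h, φ (s h) = h := Function.surjInv_eq hφ
  refine Nat.card_congr
    { toFun := fun g => (⟨φ g, g.2⟩, ⟨-s (φ g) + g, by
        rw [AddMonoidHom.mem_ker, map_add, map_neg, hs, neg_add_cancel]⟩)
      invFun := fun x => ⟨s x.1 + x.2, by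
        rw [map_add, hs, AddMonoidHom.mem_ker.1 x.2.2, add_zero]; exact x.1.2⟩
      left_inv := fun g => Subtype.ext (add_neg_cancel_left _ _)
      right_inv := fun x => ?_ }
  have h : φ (s x.1 + x.2) = x.1 := by
    rw [map_add, hs, AddMonoidHom.mem_ker.1 x.2.2, add_zero]
  refine Prod.ext (Subtype.ext h) (Subtype.ext ?_)
  simp only [h, neg_add_cancel_left]

variable {K : Type*} [Field K] {V : Type*} [AddCommGroup V] [Module K V]
  {X : Type*} [AddCommGroup X] [Module K X]

theorem pow_comp_eq (ι : V →ₗ[K] X) (p : X →ₗ[K] V) (k : ℕ) :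
    (ι ∘ₗ p : End K X) ^ (k + 1) = ι ∘ₗ ((p ∘ₗ ι : End K V) ^ k) ∘ₗ p := by
  induction k with
  | zero => rfl
  | succ k ih =>
    rw [pow_succ', ih, pow_succ' _ k]
    rfl

/-- `(ι p) ^ (k + 1) = ι (p ι) ^ k p`: passing from an endomorphism of `X` to the one induced on its
range shifts the rank sequence. -/
theorem rankSeq_comp {ι : V →ₗ[K] X} (hι : Function.Injective ι) {p : X →ₗ[K] V}
    (hp : Function.Surjective p) (k : ℕ) :
    rankSeq (ι ∘ₗ p : End K X) (k + 1) = rankSeq (p ∘ₗ ι : End K V) k := by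
  rw [rankSeq, pow_comp_eq, LinearMap.range_comp,
    LinearMap.range_comp_of_range_eq_top _ (LinearMap.range_eq_top.2 hp),
    ← (Submodule.equivMapOfInjective ι hι _).finrank_eq]
  rfl

variable [FiniteDimensional K V]

section

variable [Finite K]

theorem card_linearIndependent_int (m : ℕ) :
    (Nat.card {s : Fin m → V // LinearIndependent K s} : ℤ) =
      ∏ i : Fin m, ((Nat.card K : ℤ) ^ finrank K V - (Nat.card K : ℤ) ^ (i : ℕ)) := by
  have : Finite V := Module.finite_of_finite K
  cases nonempty_fintype K
  by_cases hm : m ≤ finrank K V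
  · rw [card_linearIndependent hm, Nat.cast_prod]
    refine Finset.prod_congr rfl fun i _ => ?_
    rw [Nat.cast_sub (Nat.pow_le_pow_right Fintype.card_pos (by omega)), Nat.card_eq_fintype_card]
    push_cast; rfl
  -- For `m` larger than the dimension the product over the integers contains a zero factor, so the
  -- formula needs no bound on `m`.
  · rw [Finset.prod_eq_zero (Finset.mem_univ ⟨finrank K V, not_le.1 hm⟩) (sub_self _)]
    rw [Nat.cast_eq_zero, Nat.card_eq_zero]
    exact Or.inl ⟨fun s => hm (by simpa using s.2.fintype_card_le_finrank)⟩

theorem card_injective (m : ℕ) :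
    (Nat.card {f : (Fin m → K) →ₗ[K] V // Function.Injective f} : ℤ) =
      ∏ i : Fin m, ((Nat.card K : ℤ) ^ finrank K V - (Nat.card K : ℤ) ^ (i : ℕ)) := by
  rw [← card_linearIndependent_int]
  congr 1
  refine Nat.card_congr (Equiv.subtypeEquiv
    (LinearEquiv.piRing K V (Fin m) K).toEquiv fun f => ?_)
  rw [Fintype.linearIndependent_iff, injective_iff_map_eq_zero]
  refine forall_congr' fun g => ?_
  have : f g = ∑ i, g i • LinearEquiv.piRing K V (Fin m) K f i := by
    conv_lhs => rw [pi_eq_sum_univ' g, map_sum]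
    refine Finset.sum_congr rfl fun i _ => ?_
    rw [map_smul, LinearEquiv.piRing_apply]
  rw [this, funext_iff]
  rfl

/-- By duality: a map to `K ^ m` is surjective exactly when its `m` coordinate functionals are
linearly independent. -/
theorem card_surjective_fin (m : ℕ) :
    (Nat.card {f : V →ₗ[K] (Fin m → K) // Function.Surjective f} : ℤ) =
      ∏ i : Fin m, ((Nat.card K : ℤ) ^ finrank K V - (Nat.card K : ℤ) ^ (i : ℕ)) := by
  rw [← Subspace.dual_finrank_eq (K := K) (V := V), ← card_linearIndependent_int]
  congr 1
  let e : (V →ₗ[K] (Fin m → K)) ≃ (Fin m → Dual K V) :=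
    { toFun := fun f i => LinearMap.proj i ∘ₗ f
      invFun := LinearMap.pi
      left_inv := fun f => rfl
      right_inv := fun g => rfl }
  refine Nat.card_congr (Equiv.subtypeEquiv e fun f => ?_)
  let r := (LinearEquiv.piRing K K (Fin m) K).symm
  rw [Fintype.linearIndependent_iff, ← LinearMap.dualMap_injective_iff,
    injective_iff_map_eq_zero, ← r.toEquiv.forall_congr_right]
  refine forall_congr' fun g => ?_
  have h1 : f.dualMap (r g) = ∑ i, g i • e f i := by
    ext v
    simp [r, LinearEquiv.piRing_symm_apply, LinearMap.sum_apply, mul_comm]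
    rfl
  change (f.dualMap (r g) = 0 → r g = 0) ↔ _
  rw [h1, r.map_eq_zero_iff, funext_iff]
  rfl

theorem card_surjective {W : Type*} [AddCommGroup W] [Module K W] [FiniteDimensional K W] :
    (Nat.card {f : V →ₗ[K] W // Function.Surjective f} : ℤ) =
      ∏ i : Fin (finrank K W), ((Nat.card K : ℤ) ^ finrank K V - (Nat.card K : ℤ) ^ (i : ℕ)) := by
  rw [← card_surjective_fin]
  let e : W ≃ₗ[K] (Fin (finrank K W) → K) := (finBasis K W).equivFun
  congr 1
  refine Nat.card_congr (Equiv.subtypeEquiv ((LinearEquiv.refl K V).arrowCongr e).toEquiv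
    fun f => ?_)
  change _ ↔ Function.Surjective (e ∘ f ∘ id)
  rw [Function.comp_id]
  exact (e.toEquiv.comp_surjective f).symm

end

variable [FiniteDimensional K X]

/-- The condition depends only on the composite with the quotient map by `R`, and each composite
arises from a coset of the space of maps from `X` to `R`. -/
theorem card_sup_range_eq_top (R : Submodule K V) :
    Nat.card {s : X →ₗ[K] V // R ⊔ LinearMap.range s = ⊤} =
      Nat.card {s : X →ₗ[K] (V ⧸ R) // Function.Surjective s} *
        Nat.card K ^ (finrank K X * finrank K R) := by
  let φ : (X →ₗ[K] V) →ₗ[K] (X →ₗ[K] (V ⧸ R)) := LinearMap.compRight K R.mkQ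
  have hφ : Function.Surjective φ := by
    intro g
    obtain ⟨s, hs⟩ := LinearMap.exists_rightInverse_of_surjective R.mkQ R.range_mkQ
    refine ⟨s ∘ₗ g, ?_⟩
    change R.mkQ ∘ₗ (s ∘ₗ g) = g
    rw [← LinearMap.comp_assoc, hs, LinearMap.id_comp]
  have h1 := card_preimage_of_surjective φ.toAddMonoidHom hφ fun s => Function.Surjective s
  have hk : Nat.card φ.toAddMonoidHom.ker = Nat.card K ^ (finrank K X * finrank K R) := by
    rw [← Module.finrank_linearMap K K X R, ← Module.natCard_eq_pow_finrank]
    symm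
    refine Nat.card_congr (Equiv.ofBijective (fun g => ⟨R.subtype ∘ₗ g, ?_⟩) ⟨?_, ?_⟩)
    · refine LinearMap.ext fun x => ?_
      exact (Submodule.Quotient.mk_eq_zero R).2 (g x).2
    · intro g g' h
      refine LinearMap.ext fun x => Subtype.ext ?_
      exact LinearMap.congr_fun (congrArg Subtype.val h) x
    · rintro ⟨f, hf⟩
      refine ⟨f.codRestrict R fun x => ?_, rfl⟩
      exact (Submodule.Quotient.mk_eq_zero R).1 (LinearMap.congr_fun hf x)
  rw [← hk, ← h1]
  refine Nat.card_congr (Equiv.subtypeEquivRight fun s => ?_)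
  change _ ↔ Function.Surjective (R.mkQ ∘ₗ s)
  rw [← LinearMap.range_eq_top, LinearMap.range_comp, Submodule.map_mkQ_eq_top]

/-- With `p` prescribed on the range of `ι`, it remains to choose `p` on a complement, and `p` is
surjective when this choice spans `V` together with the range of `σ`. -/
theorem card_surjective_comp_eq {ι : V →ₗ[K] X} (hι : Function.Injective ι) (σ : End K V) :
    Nat.card {p : X →ₗ[K] V // Function.Surjective p ∧ p ∘ₗ ι = σ} =
      Nat.card {s : (X ⧸ LinearMap.range ι) →ₗ[K] (V ⧸ LinearMap.range σ) // Function.Surjective s} *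
        Nat.card K ^ ((finrank K X - finrank K V) * finrank K (LinearMap.range σ)) := by
  obtain ⟨C, hC⟩ := Submodule.exists_isCompl (LinearMap.range ι)
  let e : (X ⧸ LinearMap.range ι) ≃ₗ[K] C := Submodule.quotientEquivOfIsCompl _ _ hC
  let i : V ≃ₗ[K] LinearMap.range ι := LinearEquiv.ofInjective ι hι
  have hdim : finrank K X - finrank K V = finrank K (X ⧸ LinearMap.range ι) := by
    rw [Submodule.finrank_quotient, LinearMap.finrank_range_of_inj hι]
  rw [hdim, ← card_sup_range_eq_top]
  have hmap : ∀ p : X →ₗ[K] V, p ∘ₗ ι = σ →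
      LinearMap.range p = LinearMap.range σ ⊔ LinearMap.range (p ∘ₗ C.subtype) := by
    rintro p rfl
    rw [LinearMap.range_comp, LinearMap.range_comp, Submodule.range_subtype, ← Submodule.map_sup,
      hC.sup_eq_top, Submodule.map_top]
  refine Nat.card_congr (Equiv.ofBijective
    (fun p => ⟨p.1 ∘ₗ C.subtype ∘ₗ e.toLinearMap, ?_⟩) ⟨?_, ?_⟩)
  · rw [← LinearMap.comp_assoc, LinearMap.range_comp_of_range_eq_top _ e.range, ← hmap _ p.2.2,
      LinearMap.range_eq_top.2 p.2.1]
  · intro p p' h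
    have h2 : ∀ c : C, p.1 c = p'.1 c := fun c => by
      simpa using LinearMap.congr_fun (congrArg Subtype.val h) (e.symm c)
    have h3 : ∀ v, p.1 (ι v) = p'.1 (ι v) := fun v =>
      LinearMap.congr_fun (p.2.2.trans p'.2.2.symm) v
    refine Subtype.ext (LinearMap.ext fun x => ?_)
    have : x ∈ LinearMap.range ι ⊔ C := by rw [hC.sup_eq_top]; trivial
    obtain ⟨_, ⟨a, rfl⟩, b, hb, rfl⟩ := Submodule.mem_sup.1 this
    rw [map_add, map_add, h3, h2 ⟨b, hb⟩]
  · rintro ⟨s, hs⟩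
    let p : X →ₗ[K] V := LinearMap.ofIsCompl hC (σ ∘ₗ i.symm.toLinearMap) (s ∘ₗ e.symm.toLinearMap)
    have hp1 : p ∘ₗ ι = σ := by
      refine LinearMap.ext fun v => ?_
      have : p (i v) = σ (i.symm (i v)) := LinearMap.ofIsCompl_apply_left hC (i v)
      rw [LinearEquiv.symm_apply_apply] at this
      exact this
    have hp2 : (p ∘ₗ C.subtype) ∘ₗ e.toLinearMap = s := by
      refine LinearMap.ext fun x => ?_
      have : p (e x) = s (e.symm (e x)) := LinearMap.ofIsCompl_apply_right hC (e x)
      rw [LinearEquiv.symm_apply_apply] at this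
      exact this
    refine ⟨⟨p, ?_, hp1⟩, Subtype.ext hp2⟩
    rw [← LinearMap.range_eq_top, hmap p hp1, ← hs, ← hp2,
      LinearMap.range_comp_of_range_eq_top _ e.range]

/-- The endomorphisms whose powers have given ranks. -/
abbrev RankSeqEnd (K : Type*) [Field K] (V : Type*) [AddCommGroup V] [Module K V] (ρ : ℕ → ℕ) :
    Type _ := {θ : End K V // ∀ k, rankSeq θ k = ρ k}

variable [Finite K]

variable (K V X) in
theorem finite_linearMap : Finite (V →ₗ[K] X) := Module.finite_of_finite K

theorem card_sigma_const {A : Type*} {F : A → Type*} [∀ a, Finite (F a)] (c : ℕ)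
    (h : ∀ a, Nat.card (F a) = c) : Nat.card (Sigma F) = Nat.card A * c := by
  have e : Sigma F ≃ A × Fin c := (Equiv.sigmaCongrRight fun a =>
    Finite.equivFinOfCardEq (h a)).trans (Equiv.sigmaEquivProd A (Fin c))
  rw [Nat.card_congr e, Nat.card_prod, Nat.card_fin]

/-- Factorisations `θ = ι p` through `V`, with `ι` injective and `p` surjective, are counted twice:
by `θ` and an identification of `V` with its range, and by `ι`, the endomorphism `σ = p ι` of `V`,
and `p`. -/
theorem card_rankSeqEnd_mul {ρ : ℕ → ℕ} (h0 : ρ 0 = finrank K X) (h1 : ρ 1 = finrank K V) {c : ℕ}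
    (hc : ∀ (ι : V →ₗ[K] X), Function.Injective ι → ∀ σ : RankSeqEnd K V fun k => ρ (k + 1),
      Nat.card {p : X →ₗ[K] V // Function.Surjective p ∧ p ∘ₗ ι = σ.1} = c) :
    Nat.card (RankSeqEnd K X ρ) * Nat.card {f : V →ₗ[K] V // Function.Injective f} =
      Nat.card {f : V →ₗ[K] X // Function.Injective f} *
        Nat.card (RankSeqEnd K V fun k => ρ (k + 1)) * c := by
  have hfin1 := finite_linearMap K V X
  have hfin2 := finite_linearMap K X V
  have hfin3 := finite_linearMap K V V
  let T := {x : (V →ₗ[K] X) × (X →ₗ[K] V) // Function.Injective x.1 ∧ Function.Surjective x.2 ∧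
    ∀ k, rankSeq (x.2 ∘ₗ x.1 : End K V) k = ρ (k + 1)}
  have hrange : ∀ (ι : V →ₗ[K] X) (p : X →ₗ[K] V), Function.Surjective p →
      LinearMap.range (ι ∘ₗ p) = LinearMap.range ι := fun ι p hp =>
    LinearMap.range_comp_of_range_eq_top _ (LinearMap.range_eq_top.2 hp)
  let g : (Σ θ : RankSeqEnd K X ρ, V ≃ₗ[K] LinearMap.range θ.1) → T := fun x =>
    ⟨((LinearMap.range x.1.1).subtype ∘ₗ x.2.toLinearMap,
      x.2.symm.toLinearMap ∘ₗ x.1.1.rangeRestrict), by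
        have hi : Function.Injective ((LinearMap.range x.1.1).subtype ∘ₗ x.2.toLinearMap) :=
          (Submodule.injective_subtype _).comp x.2.injective
        have hs : Function.Surjective (x.2.symm.toLinearMap ∘ₗ x.1.1.rangeRestrict) :=
          x.2.symm.surjective.comp x.1.1.surjective_rangeRestrict
        refine ⟨hi, hs, fun k => ?_⟩
        rw [← rankSeq_comp hi hs, ← x.1.2]
        congr 1
        refine LinearMap.ext fun v => ?_
        simp⟩
  have hg : Function.Bijective g := by
    constructor
    · rintro ⟨⟨θ, hθ⟩, e⟩ ⟨⟨θ', hθ'⟩, e'⟩ h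
      have h1 := congrArg (fun z => z.1.1) h
      have h2 := congrArg (fun z => z.1.2) h
      have h3 : θ = θ' := by
        refine LinearMap.ext fun v => ?_
        have h4 := LinearMap.congr_fun h2 v
        have h5 := LinearMap.congr_fun h1 (e.symm (θ.rangeRestrict v))
        simp only [g, LinearMap.comp_apply] at h4 h5
        change e.symm _ = e'.symm _ at h4
        change ((e _ : LinearMap.range θ) : X) = ((e' _ : LinearMap.range θ') : X) at h5
        rw [LinearEquiv.apply_symm_apply, h4, LinearEquiv.apply_symm_apply] at h5
        exact h5
      subst h3
      have h6 : e = e' := by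
        refine LinearEquiv.ext fun v => Subtype.ext ?_
        exact LinearMap.congr_fun h1 v
      rw [h6]
    · rintro ⟨⟨ι, p⟩, hι, hp, hk⟩
      have hθ : ∀ k, rankSeq (ι ∘ₗ p : End K X) k = ρ k := by
        intro k
        cases k with
        | zero => rw [rankSeq_zero, h0]
        | succ k => rw [rankSeq_comp hι hp]; exact hk k
      let e : V ≃ₗ[K] LinearMap.range (ι ∘ₗ p) :=
        (LinearEquiv.ofInjective ι hι).trans (LinearEquiv.ofEq _ _ (hrange ι p hp).symm)
      have he : ∀ v, (e v : X) = ι v := fun v => rfl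
      refine ⟨⟨⟨ι ∘ₗ p, hθ⟩, e⟩, Subtype.ext (Prod.ext (LinearMap.ext fun v => he v)
        (LinearMap.ext fun x => ?_))⟩
      change e.symm ((ι ∘ₗ p).rangeRestrict x) = p x
      rw [LinearEquiv.symm_apply_eq]
      exact Subtype.ext (he _).symm
  have hT1 : Nat.card T = Nat.card (RankSeqEnd K X ρ) *
      Nat.card {f : V →ₗ[K] V // Function.Injective f} := by
    rw [← Nat.card_congr (Equiv.ofBijective g hg)]
    have : ∀ θ : RankSeqEnd K X ρ, Finite (V ≃ₗ[K] LinearMap.range θ.1) := fun θ =>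
      have := finite_linearMap K V (LinearMap.range θ.1)
      Finite.of_injective (fun e => e.toLinearMap) LinearEquiv.toLinearMap_injective
    refine card_sigma_const _ fun θ => ?_
    have hr : finrank K V = finrank K (LinearMap.range θ.1) := by
      rw [← rankSeq_one, θ.2, h1]
    let e₀ : V ≃ₗ[K] LinearMap.range θ.1 := LinearEquiv.ofFinrankEq _ _ hr
    refine Nat.card_congr (Equiv.ofBijective
      (fun e => ⟨(e.trans e₀.symm).toLinearMap, (e.trans e₀.symm).injective⟩) ⟨?_, ?_⟩)
    · intro e e' h
      refine LinearEquiv.ext fun v => e₀.symm.injective ?_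
      exact LinearMap.congr_fun (congrArg Subtype.val h) v
    · rintro ⟨f, hf⟩
      refine ⟨(LinearEquiv.ofInjectiveEndo f hf).trans e₀, Subtype.ext (LinearMap.ext fun v => ?_)⟩
      simp
  have hT2 : Nat.card T = Nat.card ((ι : {f : V →ₗ[K] X // Function.Injective f}) ×
      (σ : RankSeqEnd K V fun k => ρ (k + 1)) ×
        {p : X →ₗ[K] V // Function.Surjective p ∧ p ∘ₗ ι.1 = σ.1}) :=
    Nat.card_congr
      { toFun := fun x => ⟨⟨x.1.1, x.2.1⟩, ⟨x.1.2 ∘ₗ x.1.1, x.2.2.2⟩, ⟨x.1.2, x.2.2.1, rfl⟩⟩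
        invFun := fun y => ⟨(y.1.1, y.2.2.1), y.1.2, y.2.2.2.1, by
          have := y.2.2.2.2
          simp only
          rw [this]; exact y.2.1.2⟩
        left_inv := fun x => rfl
        right_inv := by
          rintro ⟨⟨ι, hι⟩, ⟨σ, hσ⟩, p, hp, hpσ⟩
          obtain rfl : p ∘ₗ ι = σ := hpσ
          rfl }
  rw [← hT1, hT2, card_sigma_const (Nat.card (RankSeqEnd K V fun k => ρ (k + 1)) * c), mul_assoc]
  intro ι
  exact card_sigma_const c fun σ => hc ι.1 ι.2 σ

end counting

/-! ### Rationality of the count of nilpotent pairs -/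

noncomputable section

section counting

open Module Plethysm

/-- The number of elements of a finite field. -/
def qBase (K : Type*) [Field K] [Finite K] : QBase := ⟨Nat.card K, Finite.one_lt_card⟩

/-- The number of injective linear maps from dimension `m` to dimension `n`. -/
def injPoly (m n : ℕ) : ℤ[X] := ∏ i : Fin m, (Polynomial.X ^ n - Polynomial.X ^ (i : ℕ))

theorem polyFun_X_pow (q : QBase) (n : ℕ) : polyFun (Polynomial.X ^ n) q = (q.1 : ℚ) ^ n := by
  rw [polyFun_apply]; simp

theorem polyFun_injPoly (m n : ℕ) (q : QBase) :
    polyFun (injPoly m n) q = ∏ i : Fin m, ((q.1 : ℚ) ^ n - (q.1 : ℚ) ^ (i : ℕ)) := by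
  rw [polyFun_apply, injPoly, Polynomial.eval_prod]
  simp

theorem injPoly_monic {m n : ℕ} (h : m ≤ n) : (injPoly m n).Monic :=
  Polynomial.monic_prod_of_monic _ _ fun i _ =>
    Polynomial.monic_X_pow_sub (by rw [Polynomial.degree_X_pow]; exact_mod_cast i.2.trans_le h)

theorem polyFun_injPoly_ne_zero {m n : ℕ} (h : m ≤ n) (q : QBase) :
    polyFun (injPoly m n) q ≠ 0 := by
  rw [polyFun_injPoly]
  exact Finset.prod_ne_zero_iff.2 fun i _ =>
    (sub_pos.2 (pow_lt_pow_right₀ q.one_lt (i.2.trans_le h))).ne'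

theorem card_injective_eq_polyFun (K : Type*) [Field K] [Finite K] (m n : ℕ) :
    (Nat.card {f : (Fin m → K) →ₗ[K] (Fin n → K) // Function.Injective f} : ℚ) =
      polyFun (injPoly m n) (qBase K) := by
  rw [polyFun_injPoly]
  have := card_injective (K := K) (V := Fin n → K) m
  rw [finrank_fin_fun] at this
  exact_mod_cast congrArg (Int.cast : ℤ → ℚ) this

/-- Restriction to the range replaces `n` by `ρ 1` and shifts `ρ`. A nilpotent endomorphism of a
nonzero space is not surjective, so `ρ 1 < n` and the recursion ends. Each step divides by the order
of the general linear group of rank `ρ 1`, a monic polynomial in `q`. -/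
theorem exists_card_rankSeqEnd (n : ℕ) : ∀ ρ : ℕ → ℕ, (∃ N, ∀ k, N ≤ k → ρ k = 0) →
    ∃ r ∈ monicFun, ∀ (K : Type w) [Field K] [Finite K],
      (Nat.card (RankSeqEnd K (Fin n → K) ρ) : ℚ) = r (qBase K) := by
  induction n using Nat.strong_induction_on with
  | _ n ih =>
    rintro ρ ⟨N, hN⟩
    by_cases h0 : ρ 0 ≠ n
    · refine ⟨0, monicFun.zero_mem, fun K _ _ => ?_⟩
      have : IsEmpty (RankSeqEnd K (Fin n → K) ρ) :=
        ⟨fun θ => h0 (by rw [← θ.2 0, rankSeq_zero, finrank_fin_fun])⟩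
      simp
    rw [not_not] at h0
    by_cases hn : n = 0
    · subst hn
      by_cases hρ : ∀ k, ρ k = 0
      · refine ⟨1, monicFun.one_mem, fun K _ _ => ?_⟩
        have h : ∀ (θ : End K (Fin 0 → K)) k, rankSeq θ k = ρ k := fun θ k => by
          rw [hρ]; exact finrank_zero_of_subsingleton
        have : Unique (RankSeqEnd K (Fin 0 → K) ρ) :=
          { default := ⟨0, h 0⟩, uniq := fun θ => Subtype.ext (Subsingleton.elim _ _) }
        simp
      · refine ⟨0, monicFun.zero_mem, fun K _ _ => ?_⟩
        have : IsEmpty (RankSeqEnd K (Fin 0 → K) ρ) :=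
          ⟨fun θ => hρ fun k => (θ.2 k).symm.trans finrank_zero_of_subsingleton⟩
        simp
    by_cases h1 : n ≤ ρ 1
    · refine ⟨0, monicFun.zero_mem, fun K _ _ => ?_⟩
      have : IsEmpty (RankSeqEnd K (Fin n → K) ρ) := by
        refine ⟨fun θ => hn ?_⟩
        have hs : Function.Surjective θ.1 := by
          rw [← LinearMap.range_eq_top]
          refine Submodule.eq_top_of_finrank_eq (le_antisymm (Submodule.finrank_le _) ?_)
          rw [← rankSeq_one, θ.2 1, finrank_fin_fun]
          exact h1
        have h2 := hN N le_rfl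
        rw [← θ.2, rankSeq, LinearMap.range_eq_top.2 ?_, finrank_top, finrank_fin_fun] at h2
        · exact h2
        · rw [Module.End.coe_pow]; exact hs.iterate N
      simp
    rw [not_le] at h1
    obtain ⟨r, hr, hrK⟩ := ih (ρ 1) h1 (fun k => ρ (k + 1))
      ⟨N, fun k hk => hN (k + 1) (by omega)⟩
    -- The factors are the numbers of choices of `ι`, of `σ`, and of `p` for given `ι` and `σ`.
    -- Surjections between two quotients are as many as injections in the opposite direction, hence
    -- the second `injPoly`.
    refine ⟨polyFun (injPoly (ρ 1) n) * r * (polyFun (injPoly (ρ 1 - ρ 2) (n - ρ 1)) *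
      polyFun (Polynomial.X ^ ((n - ρ 1) * ρ 2))) * (polyFun (injPoly (ρ 1) (ρ 1)))⁻¹,
      monicFun.mul_mem (monicFun.mul_mem (monicFun.mul_mem (polyFun_mem_monicFun _) hr)
        (monicFun.mul_mem (polyFun_mem_monicFun _) (polyFun_mem_monicFun _)))
        (inv_polyFun_mem_monicFun (injPoly_monic le_rfl)
          fun q => polyFun_injPoly_ne_zero le_rfl q), fun K _ _ => ?_⟩
    have hc : ∀ (ι : (Fin (ρ 1) → K) →ₗ[K] (Fin n → K)), Function.Injective ι →
        ∀ σ : RankSeqEnd K (Fin (ρ 1) → K) fun k => ρ (k + 1),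
        Nat.card {p : (Fin n → K) →ₗ[K] (Fin (ρ 1) → K) //
          Function.Surjective p ∧ p ∘ₗ ι = σ.1} =
        Nat.card {f : (Fin (ρ 1 - ρ 2) → K) →ₗ[K] (Fin (n - ρ 1) → K) // Function.Injective f} *
          Nat.card K ^ ((n - ρ 1) * ρ 2) := by
      intro ι hι σ
      have hσ : finrank K (LinearMap.range σ.1) = ρ 2 := by rw [← rankSeq_one, σ.2 1]
      rw [card_surjective_comp_eq hι, hσ, finrank_fin_fun, finrank_fin_fun]
      congr 1
      have e1 := card_surjective (K := K) (V := (Fin n → K) ⧸ LinearMap.range ι)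
        (W := (Fin (ρ 1) → K) ⧸ LinearMap.range σ.1)
      have e2 := card_injective (K := K) (V := Fin (n - ρ 1) → K) (ρ 1 - ρ 2)
      rw [Submodule.finrank_quotient, Submodule.finrank_quotient, hσ, finrank_fin_fun,
        finrank_fin_fun, LinearMap.finrank_range_of_inj hι, finrank_fin_fun] at e1
      rw [finrank_fin_fun] at e2
      exact_mod_cast e1.trans e2.symm
    have h2 := card_rankSeqEnd_mul (K := K) (V := Fin (ρ 1) → K) (X := Fin n → K) (ρ := ρ)
      (by rw [finrank_fin_fun, h0]) (by rw [finrank_fin_fun]) hc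
    have h3 := congrArg (Nat.cast : ℕ → ℚ) h2
    push_cast at h3
    rw [card_injective_eq_polyFun, card_injective_eq_polyFun, card_injective_eq_polyFun, hrK K]
      at h3
    simp only [Pi.mul_apply, Pi.inv_apply]
    rw [← div_eq_mul_inv, eq_div_iff (polyFun_injPoly_ne_zero le_rfl _), h3, polyFun_X_pow]
    rfl

variable {I : Type u} [Quiver.{v} I]

/-- The pairs of a representation in coordinates and a nilpotent endomorphism. -/
abbrev NilPair (K : Type*) [Field K] (α : I → ℕ) : Type _ :=
  {x : QuiverRep.OfDim K α × (∀ i, End K (Fin (α i) → K)) //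
    (∀ i, IsNilpotent (x.2 i)) ∧ ∀ i j a, x.1 i j a ∘ₗ x.2 i = x.2 j ∘ₗ x.1 i j a}

/-- Extension by zero. -/
def extendZero {n m : ℕ} (τ : Fin n → Fin m) (k : ℕ) : ℕ := if h : k < n then τ ⟨k, h⟩ else 0

/-- For fixed nilpotent endomorphisms at the vertices, the compatible representations form a vector
space whose dimension `E τ` depends only on the rank sequences `τ`. The pairs are sorted by these.
-/
theorem exists_card_nilPair [Finite I] [∀ i j : I, Finite (i ⟶ j)] (α : I → ℕ) :
    ∃ r ∈ monicFun, ∀ (K : Type w) [Field K] [Finite K],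
      (Nat.card (NilPair K α) : ℚ) / ∏ᶠ i, (Nat.card
        {f : (Fin (α i) → K) →ₗ[K] (Fin (α i) → K) // Function.Injective f} : ℚ) =
        r (qBase K) := by
  classical
  cases nonempty_fintype I
  have := fun i j : I => Fintype.ofFinite (i ⟶ j)
  -- A nilpotent endomorphism of `K ^ n` has vanishing `n`-th power, so its rank sequence is given
  -- by `n` numbers between 0 and `n`, padded by zeros; there are finitely many types, independently
  -- of `K`.
  let Ty := ∀ i : I, Fin (α i) → Fin (α i + 1)
  have hN : ∀ (τ : Ty) (i : I), ∃ r ∈ monicFun, ∀ (K : Type w) [Field K] [Finite K],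
      (Nat.card (RankSeqEnd K (Fin (α i) → K) (extendZero (τ i))) : ℚ) = r (qBase K) :=
    fun τ i => exists_card_rankSeqEnd (α i) _
      ⟨α i, fun k hk => by rw [extendZero, dif_neg (by omega)]⟩
  choose r hr hrK using hN
  let E : Ty → ℕ := fun τ => ∑ i, ∑ j, ∑ _a : i ⟶ j, ∑ k ∈ Finset.range (α i),
    (extendZero (τ i) k - extendZero (τ i) (k + 1)) *
      (extendZero (τ j) k - extendZero (τ j) (k + 1))
  refine ⟨(∑ τ : Ty, (∏ i, r τ i) * polyFun (Polynomial.X ^ E τ)) *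
    (polyFun (∏ i, injPoly (α i) (α i)))⁻¹,
    monicFun.mul_mem (monicFun.sum_mem fun τ _ => monicFun.mul_mem
      (monicFun.prod_mem fun i _ => hr τ i) (polyFun_mem_monicFun _))
      (inv_polyFun_mem_monicFun (Polynomial.monic_prod_of_monic _ _ fun i _ =>
        injPoly_monic le_rfl) fun q => ?_), fun K _ _ => ?_⟩
  · rw [map_prod, Finset.prod_apply]
    exact Finset.prod_ne_zero_iff.2 fun i _ => polyFun_injPoly_ne_zero le_rfl q
  have hfin := fun i j => finite_linearMap K (Fin (α i) → K) (Fin (α j) → K)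
  let F : (τ : Ty) → (∀ i, RankSeqEnd K (Fin (α i) → K) (extendZero (τ i))) → Type _ :=
    fun τ θ => ∀ i j, (i ⟶ j) → intertwiners (θ i).1 (θ j).1
  have hcard : Nat.card (NilPair K α) =
      Nat.card (Σ τ : Ty, Σ θ : (∀ i, RankSeqEnd K (Fin (α i) → K) (extendZero (τ i))), F τ θ) := by
    symm
    refine Nat.card_congr (Equiv.ofBijective (fun x =>
      ⟨(fun i j a => (x.2.2 i j a).1, fun i => (x.2.1 i).1), fun i => ?_,
        fun i j a => (x.2.2 i j a).2⟩) ⟨?_, ?_⟩)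
    · refine isNilpotent_of_rankSeq_eq_zero (k := α i) ?_
      rw [(x.2.1 i).2, extendZero, dif_neg (lt_irrefl _)]
    · rintro ⟨τ, θ, f⟩ ⟨τ', θ', f'⟩ h
      have h1 : ∀ i, (θ i).1 = (θ' i).1 := congrFun (congrArg (fun z => z.1.2) h)
      have h2 : τ = τ' := by
        ext i k
        have h3 := (θ i).2 k
        rw [h1 i, (θ' i).2 k, extendZero, extendZero, dif_pos k.2, dif_pos k.2] at h3
        exact h3.symm
      subst h2
      have h3 : θ = θ' := funext fun i => Subtype.ext (h1 i)
      subst h3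
      have h4 : f = f' := by
        funext i j a
        exact Subtype.ext (congrFun (congrFun (congrFun (congrArg (fun z => z.1.1) h) i) j) a)
      rw [h4]
    · rintro ⟨⟨X, θ⟩, hθ, hX⟩
      have hle : ∀ i k, rankSeq (θ i) k < α i + 1 := fun i k => by
        rw [Nat.lt_succ_iff, rankSeq]
        simpa using Submodule.finrank_le (LinearMap.range (θ i ^ k))
      refine ⟨⟨fun i k => ⟨rankSeq (θ i) k, hle i k⟩, fun i => ⟨θ i, fun k => ?_⟩,
        fun i j a => ⟨X i j a, hX i j a⟩⟩, rfl⟩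
      rw [extendZero]
      split_ifs with h
      · rfl
      · exact rankSeq_eq_zero_of_isNilpotent (hθ i) (by rw [finrank_fin_fun]; omega)
  have hF : ∀ τ θ, Nat.card (F τ θ) = Nat.card K ^ E τ := by
    intro τ θ
    simp only [F, Nat.card_pi, E, ← Finset.prod_pow_eq_pow_sum]
    refine Finset.prod_congr rfl fun i _ => Finset.prod_congr rfl fun j _ =>
      Finset.prod_congr rfl fun a _ => ?_
    rw [Module.natCard_eq_pow_finrank (K := K), finrank_intertwiners (α i),
      ← Finset.prod_pow_eq_pow_sum]
    · simp only [(θ i).2, (θ j).2]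
    · rw [(θ i).2, extendZero, dif_neg (lt_irrefl _)]
  have hfinF : ∀ τ θ, Finite (F τ θ) := fun τ θ => by simp only [F]; infer_instance
  rw [hcard, Nat.card_sigma, finprod_eq_prod_of_fintype, Pi.mul_apply, Pi.inv_apply,
    ← div_eq_mul_inv, map_prod, Finset.prod_apply]
  simp only [card_injective_eq_polyFun]
  congr 1
  push_cast
  rw [Finset.sum_apply]
  refine Finset.sum_congr rfl fun τ _ => ?_
  rw [card_sigma_const _ (hF τ), Nat.card_pi, Pi.mul_apply, Finset.prod_apply, polyFun_X_pow]
  push_cast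
  congr 1
  exact Finset.prod_congr rfl fun i _ => hrK τ i K

end counting

/-! ### The linear category of representations and extension of scalars -/

noncomputable section

open CategoryTheory Module

/-- A representation of a quiver in coordinates, with its dimension vector. -/
structure QRep (k : Type w) [Field k] (I : Type u) [Quiver.{v} I] where
  /-- the dimension vector -/
  dim : I → ℕ
  /-- the representation -/
  rep : QuiverRep.OfDim k dim

namespace QRep

variable {k : Type w} [Field k] {I : Type u} [Quiver.{v} I]

/-- The space of homomorphisms. -/
def homSpace (X Y : QRep k I) :
    Submodule k (∀ i, (Fin (X.dim i) → k) →ₗ[k] (Fin (Y.dim i) → k)) where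
  carrier := {f | ∀ i j a, f j ∘ₗ X.rep i j a = Y.rep i j a ∘ₗ f i}
  zero_mem' := fun i j a => by simp
  add_mem' := by
    intro f g hf hg i j a
    rw [Pi.add_apply, Pi.add_apply, LinearMap.add_comp, LinearMap.comp_add, hf, hg]
  smul_mem' := by
    intro c f hf i j a
    rw [Pi.smul_apply, Pi.smul_apply, LinearMap.smul_comp, LinearMap.comp_smul, hf]

instance : Category (QRep k I) where
  Hom X Y := homSpace X Y
  id X := ⟨fun _ => LinearMap.id, fun _ _ _ => rfl⟩
  comp f g := ⟨fun i => g.1 i ∘ₗ f.1 i, fun i j a => by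
    rw [LinearMap.comp_assoc, f.2, ← LinearMap.comp_assoc, g.2, LinearMap.comp_assoc]⟩

instance (X Y : QRep k I) : AddCommGroup (X ⟶ Y) := inferInstanceAs (AddCommGroup (homSpace X Y))

instance (X Y : QRep k I) : Module k (X ⟶ Y) := inferInstanceAs (Module k (homSpace X Y))

instance : Preadditive (QRep k I) where
  homGroup := inferInstance
  add_comp _ _ _ f f' g := Subtype.ext (funext fun i => LinearMap.comp_add (f.1 i) (f'.1 i) (g.1 i))
  comp_add _ _ _ f g g' := Subtype.ext (funext fun i => LinearMap.add_comp (f.1 i) (g'.1 i) (g.1 i))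

instance : Linear k (QRep k I) where
  homModule := inferInstance
  smul_comp _ _ _ c f g := Subtype.ext (funext fun i => LinearMap.comp_smul (g.1 i) c (f.1 i))
  comp_smul _ _ _ f c g := Subtype.ext (funext fun i => LinearMap.smul_comp c (g.1 i) (f.1 i))

instance [Finite I] (X Y : QRep k I) : FiniteDimensional k (X ⟶ Y) :=
  inferInstanceAs (FiniteDimensional k (homSpace X Y))

variable {X Y Z : QRep k I}

/-- The linear map of a homomorphism at a vertex. -/
def app (f : X ⟶ Y) (i : I) : (Fin (X.dim i) → k) →ₗ[k] (Fin (Y.dim i) → k) := f.1 i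

theorem app_rep (f : X ⟶ Y) {i j : I} (a : i ⟶ j) (v : Fin (X.dim i) → k) :
    app f j (X.rep i j a v) = Y.rep i j a (app f i v) := LinearMap.congr_fun (f.2 i j a) v

theorem hom_ext {f g : X ⟶ Y} (h : ∀ i v, app f i v = app g i v) : f = g :=
  Subtype.ext (funext fun i => LinearMap.ext (h i))

/-- The homomorphism with given linear maps at the vertices. -/
def homMk (f : ∀ i, (Fin (X.dim i) → k) →ₗ[k] (Fin (Y.dim i) → k))
    (h : ∀ i j (a : i ⟶ j) v, f j (X.rep i j a v) = Y.rep i j a (f i v)) : X ⟶ Y :=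
  ⟨f, fun i j a => LinearMap.ext (h i j a)⟩

@[simp] theorem app_homMk (f : ∀ i, (Fin (X.dim i) → k) →ₗ[k] (Fin (Y.dim i) → k))
    (h : ∀ i j (a : i ⟶ j) v, f j (X.rep i j a v) = Y.rep i j a (f i v)) (i : I) :
    app (homMk f h) i = f i := rfl

@[simp] theorem app_comp (f : X ⟶ Y) (g : Y ⟶ Z) (i : I) (v : Fin (X.dim i) → k) :
    app (f ≫ g) i v = app g i (app f i v) := rfl

@[simp] theorem app_id (i : I) (v : Fin (X.dim i) → k) : app (𝟙 X) i v = v := rfl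

@[simp] theorem app_zero (i : I) (v : Fin (X.dim i) → k) : app (0 : X ⟶ Y) i v = 0 := rfl

@[simp] theorem app_add (f g : X ⟶ Y) (i : I) (v : Fin (X.dim i) → k) :
    app (f + g) i v = app f i v + app g i v := rfl

theorem app_sum {ι : Type*} (s : Finset ι) (f : ι → (X ⟶ Y)) (i : I) (v : Fin (X.dim i) → k) :
    app (∑ n ∈ s, f n) i v = ∑ n ∈ s, app (f n) i v := by
  classical
  induction s using Finset.induction_on with
  | empty => rfl
  | insert a s ha ih => rw [Finset.sum_insert ha, Finset.sum_insert ha, app_add, ih]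

/-- Bijective homomorphisms are isomorphisms. -/
def isoOfBijective (f : X ⟶ Y) (h : ∀ i, Function.Bijective (app f i)) : X ≅ Y where
  hom := f
  inv := homMk (fun i => (LinearEquiv.ofBijective (app f i) (h i)).symm.toLinearMap) (by
    intro i j a v
    apply (h j).1
    change app f j ((LinearEquiv.ofBijective (app f j) (h j)).symm _) =
      app f j (X.rep i j a ((LinearEquiv.ofBijective (app f i) (h i)).symm v))
    rw [app_rep]
    have e := fun (l : I) w => (LinearEquiv.ofBijective (app f l) (h l)).apply_symm_apply w
    simp only [LinearEquiv.ofBijective_apply] at e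
    rw [e, e])
  hom_inv_id := hom_ext fun i v => (LinearEquiv.ofBijective (app f i) (h i)).symm_apply_apply v
  inv_hom_id := hom_ext fun i v => (LinearEquiv.ofBijective (app f i) (h i)).apply_symm_apply v

theorem bijective_app (e : X ≅ Y) (i : I) : Function.Bijective (app e.hom i) := by
  refine Function.bijective_iff_has_inverse.2 ⟨app e.inv i, fun v => ?_, fun v => ?_⟩
  · rw [← app_comp, e.hom_inv_id, app_id]
  · rw [← app_comp, e.inv_hom_id, app_id]

theorem nonempty_iso_iff : Nonempty (X ≅ Y) ↔ QuiverRep.Isomorphic X.rep Y.rep := by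
  constructor
  · rintro ⟨e⟩
    exact ⟨fun i => LinearEquiv.ofBijective _ (bijective_app e i), fun i j a v => app_rep e.hom a v⟩
  · rintro ⟨e, he⟩
    exact ⟨isoOfBijective (homMk (fun i => (e i).toLinearMap) he) fun i => (e i).bijective⟩

theorem dim_eq_of_iso (e : X ≅ Y) : X.dim = Y.dim := by
  funext i
  simpa using (LinearEquiv.ofBijective _ (bijective_app e i)).finrank_eq

/-- Homomorphisms from an abstract representation correspond to those from coordinates. -/
theorem exists_iso_abstract {V : I → Type*} [∀ i, AddCommGroup (V i)] [∀ i, Module k (V i)]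
    [∀ i, FiniteDimensional k (V i)] (R : QuiverRep k V) :
    ∃ X : QRep k I, (∀ i, X.dim i = finrank k (V i)) ∧ QuiverRep.Isomorphic R X.rep := by
  obtain ⟨Y, hY⟩ := QuiverRep.exists_isomorphic_ofDim (α := fun i => finrank k (V i)) R fun i => rfl
  exact ⟨⟨_, Y⟩, fun i => rfl, hY⟩

/-- The splitting object is the image of `e`, a subrepresentation, transported to coordinates. -/
theorem exists_split {e : X ⟶ X} (he : e ≫ e = e) :
    ∃ (Y : QRep k I) (i : Y ⟶ X) (p : X ⟶ Y), i ≫ p = 𝟙 Y ∧ p ≫ i = e := by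
  let N : QuiverRep.Sub X.rep :=
    { space := fun i => LinearMap.range (app e i)
      map_mem := by
        rintro i j a _ ⟨v, rfl⟩
        exact ⟨X.rep i j a v, app_rep e a v⟩ }
  obtain ⟨Y, -, f, hf⟩ := exists_iso_abstract N.toRep
  have hf' : ∀ (i j : I) (a : i ⟶ j) w, (f j).symm (Y.rep i j a w) = N.toRep i j a ((f i).symm w) :=
    fun i j a w => by rw [LinearEquiv.symm_apply_eq, hf, LinearEquiv.apply_symm_apply]
  have hee : ∀ i v, app e i (app e i v) = app e i v := fun i v => by rw [← app_comp, he]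
  refine ⟨Y, homMk (fun i => (N.space i).subtype ∘ₗ (f i).symm.toLinearMap) fun i j a w => ?_,
    homMk (fun i => (f i).toLinearMap ∘ₗ (app e i).rangeRestrict) fun i j a v => ?_,
    hom_ext fun i w => ?_, hom_ext fun i v => ?_⟩
  · exact congrArg Subtype.val (hf' i j a w)
  · simp only [LinearMap.comp_apply, LinearEquiv.coe_coe]
    rw [← hf]
    congr 1
    exact Subtype.ext (app_rep e a v)
  · simp only [app_comp, app_homMk, LinearMap.comp_apply, LinearEquiv.coe_coe, app_id]
    rw [← LinearEquiv.eq_symm_apply]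
    refine Subtype.ext ?_
    obtain ⟨v, hv⟩ := ((f i).symm w).2
    change app e i ((f i).symm w).1 = ((f i).symm w).1
    rw [← hv, hee]
  · change ((f i).symm (f i ((app e i).rangeRestrict v))).1 = _
    rw [LinearEquiv.symm_apply_apply]
    rfl

/-- The functor of extension of scalars along a homomorphism of fields, on linear maps. -/
def mapLin {k k' : Type*} [Field k] [Field k'] (σ : k →+* k') {m n : ℕ} :
    ((Fin m → k) →ₗ[k] (Fin n → k)) →+ ((Fin m → k') →ₗ[k'] (Fin n → k')) where
  toFun f := Matrix.toLin' ((LinearMap.toMatrix' f).map σ)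
  map_zero' := by simp
  map_add' f g := by rw [map_add, Matrix.map_add _ (map_add σ), map_add]

section mapLin

variable {k k' k'' : Type*} [Field k] [Field k'] [Field k''] (σ : k →+* k') {m n l : ℕ}

theorem toMatrix_mapLin (f : (Fin m → k) →ₗ[k] (Fin n → k)) :
    LinearMap.toMatrix' (mapLin σ f) = (LinearMap.toMatrix' f).map σ :=
  LinearMap.toMatrix'_toLin' _

theorem mapLin_id : mapLin σ (LinearMap.id : (Fin m → k) →ₗ[k] _) = LinearMap.id := by
  change Matrix.toLin' _ = _
  rw [LinearMap.toMatrix'_id, Matrix.map_one σ (map_zero σ) (map_one σ), Matrix.toLin'_one]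

theorem mapLin_comp (g : (Fin n → k) →ₗ[k] (Fin l → k)) (f : (Fin m → k) →ₗ[k] (Fin n → k)) :
    mapLin σ (g ∘ₗ f) = mapLin σ g ∘ₗ mapLin σ f := by
  change Matrix.toLin' _ = _
  rw [LinearMap.toMatrix'_comp, Matrix.map_mul, Matrix.toLin'_mul]
  rfl

theorem mapLin_smul (c : k) (f : (Fin m → k) →ₗ[k] (Fin n → k)) :
    mapLin σ (c • f) = σ c • mapLin σ f := by
  apply LinearMap.toMatrix'.injective
  rw [LinearEquiv.map_smul, toMatrix_mapLin, toMatrix_mapLin, LinearEquiv.map_smul]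
  ext i j
  simp

theorem mapLin_injective :
    Function.Injective (mapLin σ : ((Fin m → k) →ₗ[k] (Fin n → k)) →+ _) := by
  intro f g h
  apply LinearMap.toMatrix'.injective
  have h1 := congrArg LinearMap.toMatrix' h
  rw [toMatrix_mapLin, toMatrix_mapLin] at h1
  exact Matrix.map_injective σ.injective h1

theorem mapLin_mapLin (τ : k' →+* k'') (f : (Fin m → k) →ₗ[k] (Fin n → k)) :
    mapLin τ (mapLin σ f) = mapLin (τ.comp σ) f := by
  apply LinearMap.toMatrix'.injective
  rw [toMatrix_mapLin, toMatrix_mapLin, toMatrix_mapLin, Matrix.map_map]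
  rfl

theorem mapLin_ringHom_id (f : (Fin m → k) →ₗ[k] (Fin n → k)) : mapLin (RingHom.id k) f = f := by
  apply LinearMap.toMatrix'.injective
  rw [toMatrix_mapLin]
  ext; rfl

theorem mapLin_apply (f : (Fin m → k) →ₗ[k] (Fin n → k)) (v : Fin m → k) :
    mapLin σ f (fun i => σ (v i)) = fun j => σ (f v j) := by
  change Matrix.toLin' _ _ = _
  conv_rhs => rw [← LinearMap.toMatrix'_mulVec f v]
  rw [Matrix.toLin'_apply]
  funext j
  simp [Matrix.mulVec, dotProduct, map_sum]

end mapLin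

section scalars

variable {k' : Type*} [Field k'] (σ : k →+* k')

/-- Extension of scalars along a homomorphism of fields. -/
abbrev ext (X : QRep k I) : QRep k' I := ⟨X.dim, fun i j a => mapLin σ (X.rep i j a)⟩

/-- Extension of scalars for homomorphisms. -/
def extHom (f : X ⟶ Y) : ext σ X ⟶ ext σ Y :=
  ⟨fun i => mapLin σ (f.1 i), fun i j a => by
    exact (mapLin_comp σ _ _).symm.trans
      ((congrArg (mapLin σ) (f.2 i j a)).trans (mapLin_comp σ _ _))⟩

theorem extHom_id (X : QRep k I) : extHom σ (𝟙 X) = 𝟙 (ext σ X) :=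
  Subtype.ext (funext fun _ => mapLin_id σ)

theorem extHom_comp (f : X ⟶ Y) (g : Y ⟶ Z) : extHom σ (f ≫ g) = extHom σ f ≫ extHom σ g :=
  Subtype.ext (funext fun _ => mapLin_comp σ _ _)

theorem extHom_add (f g : X ⟶ Y) : extHom σ (f + g) = extHom σ f + extHom σ g :=
  Subtype.ext (funext fun _ => map_add (mapLin σ) _ _)

theorem extHom_zero : extHom σ (0 : X ⟶ Y) = 0 :=
  Subtype.ext (funext fun _ => map_zero (mapLin σ))

theorem extHom_smul (c : k) (f : X ⟶ Y) : extHom σ (c • f) = σ c • extHom σ f :=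
  Subtype.ext (funext fun _ => mapLin_smul σ _ _)

theorem extHom_sum {ι : Type*} (s : Finset ι) (f : ι → (X ⟶ Y)) :
    extHom σ (∑ n ∈ s, f n) = ∑ n ∈ s, extHom σ (f n) := by
  classical
  induction s using Finset.induction_on with
  | empty => exact extHom_zero σ
  | insert a s ha ih => rw [Finset.sum_insert ha, Finset.sum_insert ha, extHom_add, ih]

theorem extHom_injective : Function.Injective (extHom σ : (X ⟶ Y) → _) := by
  intro f g h
  refine Subtype.ext (funext fun i => mapLin_injective σ ?_)
  exact congrFun (congrArg Subtype.val h) i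

/-- Extension of scalars for isomorphisms. -/
def extIso (e : X ≅ Y) : ext σ X ≅ ext σ Y where
  hom := extHom σ e.hom
  inv := extHom σ e.inv
  hom_inv_id := by rw [← extHom_comp, e.hom_inv_id, extHom_id]
  inv_hom_id := by rw [← extHom_comp, e.inv_hom_id, extHom_id]

theorem ext_ext {k'' : Type*} [Field k''] (τ : k' →+* k'') (X : QRep k I) :
    ext τ (ext σ X) = ext (τ.comp σ) X := by
  rw [ext, ext, ext]
  congr 1
  funext i j a
  exact mapLin_mapLin σ τ _

theorem ext_id (X : QRep k I) : ext (RingHom.id k) X = X := by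
  obtain ⟨d, r⟩ := X
  rw [ext]
  congr 1
  funext i j a
  exact mapLin_ringHom_id _

end scalars

end QRep

/-! ### Fitting's lemma, the radical and direct sums -/

noncomputable section

open CategoryTheory Module

/-- In a finite-dimensional algebra, an element is invertible in a corner and nilpotent in the
complementary corner. -/
theorem exists_idempotent_of_finite (k : Type*) [Field k] {R : Type*} [Ring R] [Algebra k R]
    [FiniteDimensional k R] (r : R) :
    ∃ (y : R) (n : ℕ), Commute r y ∧ r * y * (r * y) = r * y ∧ r ^ n * (1 - r * y) = 0 := by
  have hr : IsIntegral k r := IsIntegral.of_finite k r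
  obtain ⟨g, hg, hX⟩ :=
    Polynomial.exists_eq_pow_rootMultiplicity_mul_and_not_dvd _ (minpoly.ne_zero hr) 0
  generalize (minpoly k r).rootMultiplicity 0 = a at hg hX
  rw [Polynomial.C_0, sub_zero] at hg hX
  have hp : Polynomial.aeval r (Polynomial.X ^ a * g) = 0 := by rw [← hg, minpoly.aeval]
  -- The minimal polynomial is `X ^ a * g` with `g` prime to `X`. In the Bézout relation `p X ^ (a +
  -- 1) + s g = 1` the two summands, evaluated at `r`, are complementary idempotents. The exponent
  -- is `a + 1` so that the first one is also divisible by `r` when `a = 0`.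
  obtain ⟨p, s, hps⟩ : IsCoprime (Polynomial.X ^ (a + 1)) g :=
    ((Polynomial.irreducible_X (R := k)).coprime_iff_not_dvd.2 hX).pow_left
  set y := Polynomial.aeval r (p * Polynomial.X ^ a) with hy
  have hXr : ∀ t : k[X], r * Polynomial.aeval r t = Polynomial.aeval r (Polynomial.X * t) :=
    fun t => by rw [map_mul, Polynomial.aeval_X]
  have hry : r * y = Polynomial.aeval r (p * Polynomial.X ^ (a + 1)) := by
    rw [hy, hXr, mul_left_comm, ← pow_succ']
  have hry' : 1 - r * y = Polynomial.aeval r (s * g) := by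
    rw [hry, sub_eq_iff_eq_add, ← map_add, add_comm, hps, map_one]
  refine ⟨y, a, ?_, ?_, ?_⟩
  · rw [hy, Commute, SemiconjBy, hXr, mul_comm, map_mul, Polynomial.aeval_X]
  · have : r * y * (1 - r * y) = 0 := by
      rw [hry', hry, ← map_mul, show p * Polynomial.X ^ (a + 1) * (s * g) =
        p * Polynomial.X * s * (Polynomial.X ^ a * g) by ring, map_mul, hp, mul_zero]
    rw [mul_sub, mul_one, sub_eq_zero] at this
    exact this.symm
  · rw [hry', show r ^ a = Polynomial.aeval r ((Polynomial.X : k[X]) ^ a) by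
        rw [map_pow, Polynomial.aeval_X],
      ← map_mul, show Polynomial.X ^ a * (s * g) = s * (Polynomial.X ^ a * g) by ring, map_mul, hp, mul_zero]

set_option linter.unusedSectionVars false

namespace QRep

variable {k : Type w} [Field k] {I : Type u} [Quiver.{v} I] {X Y Z : QRep k I}

instance [Finite I] : FiniteDimensional k (End X) := inferInstanceAs (FiniteDimensional k (X ⟶ X))

/-- Indecomposable representations, through idempotent endomorphisms. -/
structure Indec (Z : QRep k I) : Prop where
  one_ne : 𝟙 Z ≠ 0
  idem : ∀ e : Z ⟶ Z, e ≫ e = e → e = 0 ∨ e = 𝟙 Z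

/-- Nilpotent endomorphisms. -/
def Nil (f : X ⟶ X) : Prop := IsNilpotent (End.of f)

/-- A power of `g ≫ f` contains a power of `f ≫ g` with exponent one less. -/
theorem Nil.comm {f : X ⟶ Y} {g : Y ⟶ X} (h : Nil (f ≫ g)) : Nil (g ≫ f) := by
  obtain ⟨n, hn⟩ := h
  have key : ∀ n : ℕ, g ≫ (End.of (f ≫ g) ^ n) ≫ f = End.of (g ≫ f) ^ (n + 1) := by
    intro n
    induction n with
    | zero =>
      rw [pow_zero, End.one_def, Category.id_comp, zero_add, pow_one]
    | succ n ih =>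
      rw [pow_succ, End.mul_def, pow_succ _ (n + 1), ← ih, End.mul_def]
      change g ≫ ((f ≫ g) ≫ _) ≫ f = (g ≫ f) ≫ g ≫ _ ≫ f
      simp only [Category.assoc]
  refine ⟨n + 1, ?_⟩
  rw [← key, hn]
  exact (congrArg _ Limits.zero_comp).trans Limits.comp_zero

theorem not_isIso_of_nil (h0 : 𝟙 X ≠ 0) {f : X ⟶ X} (hf : Nil f) : ¬ IsIso f := by
  intro h
  obtain ⟨n, hn⟩ := hf
  have : IsUnit (End.of f) := (isUnit_iff_isIso f).2 h
  have := this.pow n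
  rw [hn] at this
  exact h0 (isUnit_zero_iff.1 this).symm

variable [Finite I]

theorem exists_idem (f : X ⟶ X) : ∃ g : X ⟶ X, f ≫ g = g ≫ f ∧
    (f ≫ g) ≫ (f ≫ g) = f ≫ g ∧ (f ≫ g = 0 → Nil f) ∧ (f ≫ g = 𝟙 X → IsIso f) := by
  obtain ⟨y, n, h1, h2, h3⟩ := exists_idempotent_of_finite k (End.of f)
  have h1' : f ≫ y = y ≫ f := h1.symm
  have h4 : End.of f * y = End.of (f ≫ y) := h1'.symm
  rw [h4] at h2 h3
  refine ⟨y, h1', h2, fun h => ⟨n, ?_⟩, fun h => ⟨y, h, ?_⟩⟩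
  · rw [h] at h3
    exact (mul_one _).symm.trans ((congrArg (End.of f ^ n * ·) (sub_zero 1).symm).trans h3)
  · rw [← h1', h]

/-- The idempotent of the Fitting decomposition of `f` must be trivial. -/
theorem Indec.isIso_or_nil (hZ : Indec Z) (f : Z ⟶ Z) : IsIso f ∨ Nil f := by
  obtain ⟨g, -, h1, h2, h3⟩ := exists_idem f
  exact (hZ.idem _ h1).elim (fun h => Or.inr (h2 h)) fun h => Or.inl (h3 h)

/-- The composite `g ≫ inv (f ≫ g) ≫ f` is an idempotent of the indecomposable `X`. It is not zero,
since `f` factors through it and `𝟙 Z ≠ 0`; so it is the identity. -/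
theorem Indec.isIso_left (hX : Indec X) (h0 : 𝟙 Z ≠ 0) {f : Z ⟶ X} {g : X ⟶ Z} (h : IsIso (f ≫ g)) :
    IsIso f := by
  have h1 : f ≫ g ≫ inv (f ≫ g) = 𝟙 Z := by rw [← Category.assoc, IsIso.hom_inv_id]
  have h1' : (g ≫ inv (f ≫ g) ≫ f) ≫ (g ≫ inv (f ≫ g) ≫ f) = g ≫ inv (f ≫ g) ≫ f := by
    have : g ≫ inv (f ≫ g) ≫ f ≫ g ≫ inv (f ≫ g) ≫ f = g ≫ inv (f ≫ g) ≫ f := by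
      rw [← Category.assoc f, ← Category.assoc (f ≫ g), IsIso.hom_inv_id, Category.id_comp]
    simpa only [Category.assoc] using this
  obtain h2 | h2 := hX.idem _ h1'
  · refine absurd ?_ h0
    have h3 : f ≫ g ≫ inv (f ≫ g) ≫ f = f := by
      rw [← Category.assoc g, ← Category.assoc f, h1, Category.id_comp]
    rw [h2, Limits.comp_zero] at h3
    rw [← h1]
    generalize g ≫ inv (f ≫ g) = t
    rw [← h3, Limits.zero_comp]
  · exact ⟨g ≫ inv (f ≫ g), h1, by rw [Category.assoc, h2]⟩

theorem Indec.isIso_right (hX : Indec X) (h0 : 𝟙 Z ≠ 0) {f : Z ⟶ X} {g : X ⟶ Z}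
    (h : IsIso (f ≫ g)) : IsIso g := by
  have := hX.isIso_left h0 h
  exact IsIso.of_isIso_comp_left f g

/-- Locality of the endomorphism ring: after normalising the sum to 1, if one summand is nilpotent,
then the other is 1 minus a nilpotent. -/
theorem Indec.isIso_of_add (hZ : Indec Z) {f g : Z ⟶ Z} (h : IsIso (f + g)) : IsIso f ∨ IsIso g := by
  obtain h1 | h1 := hZ.isIso_or_nil (f ≫ inv (f + g))
  · exact Or.inl (hZ.isIso_left hZ.one_ne h1)
  · right
    have h2 : 𝟙 Z - f ≫ inv (f + g) = g ≫ inv (f + g) := by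
      rw [sub_eq_iff_eq_add, ← Preadditive.add_comp, add_comm g f, IsIso.hom_inv_id]
    have h3 : IsUnit (1 - End.of (f ≫ inv (f + g))) := IsNilpotent.isUnit_one_sub h1
    have h4 : IsIso (g ≫ inv (f + g)) := by
      rw [← h2]
      exact (isUnit_iff_isIso _).1 h3
    exact hZ.isIso_left hZ.one_ne h4

theorem Indec.not_isIso_zero (hZ : Indec Z) : ¬ IsIso (0 : Z ⟶ Z) :=
  not_isIso_of_nil hZ.one_ne IsNilpotent.zero

theorem Indec.exists_isIso_of_sum (hZ : Indec Z) {ι : Type*} (s : Finset ι) (f : ι → (Z ⟶ Z))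
    (h : IsIso (∑ n ∈ s, f n)) : ∃ n ∈ s, IsIso (f n) := by
  classical
  induction s using Finset.induction_on with
  | empty => exact absurd h hZ.not_isIso_zero
  | insert a s ha ih =>
    rw [Finset.sum_insert ha] at h
    obtain h | h := hZ.isIso_of_add h
    · exact ⟨a, Finset.mem_insert_self _ _, h⟩
    · obtain ⟨n, hn, h⟩ := ih h
      exact ⟨n, Finset.mem_insert_of_mem hn, h⟩

/-- The homomorphisms from an indecomposable representation that are not split monomorphisms. -/
def rad (hZ : Indec Z) (X : QRep k I) : Submodule k (Z ⟶ X) where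
  carrier := {f | ∀ g : X ⟶ Z, ¬ IsIso (f ≫ g)}
  zero_mem' := fun g => by
    rw [Limits.zero_comp]
    exact hZ.not_isIso_zero
  add_mem' := by
    intro f f' hf hf' g h
    rw [Preadditive.add_comp] at h
    exact (hZ.isIso_of_add h).elim (hf g) (hf' g)
  smul_mem' := by
    intro c f hf g h
    rw [Linear.smul_comp, ← Linear.comp_smul] at h
    exact hf _ h

theorem mem_rad (hZ : Indec Z) {f : Z ⟶ X} : f ∈ rad hZ X ↔ ∀ g : X ⟶ Z, ¬ IsIso (f ≫ g) := Iff.rfl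

theorem comp_mem_rad (hZ : Indec Z) {f : Z ⟶ X} (hf : f ∈ rad hZ X) (g : X ⟶ Y) :
    f ≫ g ∈ rad hZ Y := fun h => by
  rw [Category.assoc]
  exact hf _

theorem mem_rad_self (hZ : Indec Z) {f : Z ⟶ Z} : f ∈ rad hZ Z ↔ Nil f := by
  constructor
  · intro h
    refine (hZ.isIso_or_nil f).resolve_left ?_
    simpa using h (𝟙 Z)
  · intro h g hg
    exact not_isIso_of_nil hZ.one_ne h (hZ.isIso_left hZ.one_ne hg)

/-- `X` is the direct sum of a finite family. -/
structure DirSum {ι : Type*} [Fintype ι] (Y : ι → QRep k I) (X : QRep k I) where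
  inc : ∀ n, Y n ⟶ X
  prj : ∀ n, X ⟶ Y n
  inc_prj : ∀ n, inc n ≫ prj n = 𝟙 (Y n)
  inc_prj_ne : ∀ m n, m ≠ n → inc m ≫ prj n = 0
  sum : ∑ n, prj n ≫ inc n = 𝟙 X

namespace DirSum

variable {ι ι' : Type*} [Fintype ι] [Fintype ι'] {T : ι → QRep k I} {T' : ι' → QRep k I}

theorem comp_prj_inc (D : DirSum T X) (f : Z ⟶ X) : ∑ n, (f ≫ D.prj n) ≫ D.inc n = f := by
  simp_rw [Category.assoc]
  rw [← Preadditive.comp_sum, D.sum, Category.comp_id]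

theorem prj_inc_comp (D : DirSum T X) (f : X ⟶ Z) : ∑ n, D.prj n ≫ D.inc n ≫ f = f := by
  simp_rw [← Category.assoc]
  rw [← Preadditive.sum_comp, D.sum, Category.id_comp]

theorem sum_inc_prj (D : DirSum T X) (f : ∀ n, Z ⟶ T n) (m : ι) :
    (∑ n, f n ≫ D.inc n) ≫ D.prj m = f m := by
  rw [Preadditive.sum_comp, Finset.sum_eq_single m]
  · rw [Category.assoc, D.inc_prj, Category.comp_id]
  · intro n _ hn
    rw [Category.assoc, D.inc_prj_ne _ _ hn, Limits.comp_zero]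
  · intro h
    exact absurd (Finset.mem_univ m) h

theorem inc_sum_prj (D : DirSum T X) (f : ∀ n, T n ⟶ Z) (m : ι) :
    D.inc m ≫ ∑ n, D.prj n ≫ f n = f m := by
  rw [Preadditive.comp_sum, Finset.sum_eq_single m]
  · rw [← Category.assoc, D.inc_prj, Category.id_comp]
  · intro n _ hn
    rw [← Category.assoc, D.inc_prj_ne _ _ hn.symm, Limits.zero_comp]
  · intro h
    exact absurd (Finset.mem_univ m) h

theorem hom_ext_left (D : DirSum T X) {f g : X ⟶ Z} (h : ∀ n, D.inc n ≫ f = D.inc n ≫ g) : f = g := by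
  rw [← D.prj_inc_comp f, ← D.prj_inc_comp g]
  simp_rw [h]

/-- Homomorphisms to a direct sum. -/
def homEquiv (D : DirSum T X) (Z : QRep k I) : (Z ⟶ X) ≃ₗ[k] (∀ n, Z ⟶ T n) where
  toFun f n := f ≫ D.prj n
  invFun f := ∑ n, f n ≫ D.inc n
  map_add' f g := funext fun _ => Preadditive.add_comp _ _ _ f g _
  map_smul' c f := funext fun _ => Linear.smul_comp _ _ _ c f _
  left_inv f := D.comp_prj_inc f
  right_inv f := funext fun n => D.sum_inc_prj f n

/-- Homomorphisms from a direct sum. -/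
def homEquiv' (D : DirSum T X) (Z : QRep k I) : (X ⟶ Z) ≃ₗ[k] (∀ n, T n ⟶ Z) where
  toFun f n := D.inc n ≫ f
  invFun f := ∑ n, D.prj n ≫ f n
  map_add' f g := funext fun _ => Preadditive.comp_add _ _ _ _ f g
  map_smul' c f := funext fun _ => Linear.comp_smul _ _ _ _ c f
  left_inv f := D.prj_inc_comp f
  right_inv f := funext fun n => D.inc_sum_prj f n

/-- Two direct sums of the same family are isomorphic. -/
def iso (D : DirSum T X) (D' : DirSum T Y) : X ≅ Y where
  hom := ∑ n, D.prj n ≫ D'.inc n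
  inv := ∑ n, D'.prj n ≫ D.inc n
  hom_inv_id := D.hom_ext_left fun n => by
    rw [← Category.assoc, D.inc_sum_prj, D'.inc_sum_prj, Category.comp_id]
  inv_hom_id := D'.hom_ext_left fun n => by
    rw [← Category.assoc, D'.inc_sum_prj, D.inc_sum_prj, Category.comp_id]

/-- Change of the family along isomorphisms. -/
def congr (D : DirSum T X) (σ : ι' ≃ ι) (e : ∀ n, T' n ≅ T (σ n)) : DirSum T' X where
  inc n := (e n).hom ≫ D.inc (σ n)
  prj n := D.prj (σ n) ≫ (e n).inv
  inc_prj n := by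
    rw [Category.assoc, ← Category.assoc (D.inc _), D.inc_prj, Category.id_comp, Iso.hom_inv_id]
  inc_prj_ne m n h := by
    rw [Category.assoc, ← Category.assoc (D.inc _), D.inc_prj_ne _ _ (σ.injective.ne h),
      Limits.zero_comp, Limits.comp_zero]
  sum := by
    rw [← D.sum, ← Equiv.sum_comp σ]
    refine Finset.sum_congr rfl fun n _ => ?_
    rw [Category.assoc, ← Category.assoc (e n).inv, Iso.inv_hom_id, Category.id_comp]

/-- Change of the direct sum along an isomorphism. -/
def trans (D : DirSum T X) (e : X ≅ Y) : DirSum T Y where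
  inc n := D.inc n ≫ e.hom
  prj n := e.inv ≫ D.prj n
  inc_prj n := by simp [D.inc_prj]
  inc_prj_ne m n h := by simp [D.inc_prj_ne m n h]
  sum := by
    have : e.inv ≫ (∑ n, D.prj n ≫ D.inc n) ≫ e.hom = 𝟙 Y := by rw [D.sum]; simp
    simpa only [Preadditive.sum_comp, Preadditive.comp_sum, Category.assoc] using this

/-- A representation as a direct sum of one. -/
def single (X : QRep k I) : DirSum (fun _ : Unit => X) X where
  inc _ := 𝟙 X
  prj _ := 𝟙 X
  inc_prj _ := Category.id_comp _
  inc_prj_ne _ _ h := absurd rfl h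
  sum := by simp

/-- A representation that vanishes as an empty direct sum. -/
def empty (h : 𝟙 X = 0) (T : Empty → QRep k I) : DirSum T X where
  inc n := n.elim
  prj n := n.elim
  inc_prj n := n.elim
  inc_prj_ne m := m.elim
  sum := by simp [h]

/-- Direct sums of direct sums. -/
def sumElim {W : Bool → QRep k I} (D : DirSum W X) (D₁ : DirSum T (W true))
    (D₂ : DirSum T' (W false)) : DirSum (Sum.elim T T') X where
  inc := Sum.rec (fun n => D₁.inc n ≫ D.inc true) (fun n => D₂.inc n ≫ D.inc false)
  prj := Sum.rec (fun n => D.prj true ≫ D₁.prj n) (fun n => D.prj false ≫ D₂.prj n)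
  inc_prj := by
    rintro (n | n)
    · change (D₁.inc n ≫ D.inc true) ≫ D.prj true ≫ D₁.prj n = _
      rw [Category.assoc, ← Category.assoc (D.inc _), D.inc_prj, Category.id_comp, D₁.inc_prj]
      rfl
    · change (D₂.inc n ≫ D.inc false) ≫ D.prj false ≫ D₂.prj n = _
      rw [Category.assoc, ← Category.assoc (D.inc _), D.inc_prj, Category.id_comp, D₂.inc_prj]
      rfl
  inc_prj_ne := by
    rintro (m | m) (n | n) h
    · change (D₁.inc m ≫ D.inc true) ≫ D.prj true ≫ D₁.prj n = _
      rw [Category.assoc, ← Category.assoc (D.inc _), D.inc_prj, Category.id_comp,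
        D₁.inc_prj_ne _ _ fun h' => h (congrArg _ h')]
      rfl
    · change (D₁.inc m ≫ D.inc true) ≫ D.prj false ≫ D₂.prj n = _
      rw [Category.assoc, ← Category.assoc (D.inc _), D.inc_prj_ne _ _ (by simp), Limits.zero_comp,
        Limits.comp_zero]
      rfl
    · change (D₂.inc m ≫ D.inc false) ≫ D.prj true ≫ D₁.prj n = _
      rw [Category.assoc, ← Category.assoc (D.inc _), D.inc_prj_ne _ _ (by simp), Limits.zero_comp,
        Limits.comp_zero]
      rfl
    · change (D₂.inc m ≫ D.inc false) ≫ D.prj false ≫ D₂.prj n = _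
      rw [Category.assoc, ← Category.assoc (D.inc _), D.inc_prj, Category.id_comp,
        D₂.inc_prj_ne _ _ fun h' => h (congrArg _ h')]
      rfl
  sum := by
    rw [Fintype.sum_sum_type]
    change ∑ n, (D.prj true ≫ D₁.prj n) ≫ (D₁.inc n ≫ D.inc true) +
      ∑ n, (D.prj false ≫ D₂.prj n) ≫ (D₂.inc n ≫ D.inc false) = _
    have h1 : ∀ n, (D.prj true ≫ D₁.prj n) ≫ (D₁.inc n ≫ D.inc true) =
        D.prj true ≫ (D₁.prj n ≫ D₁.inc n) ≫ D.inc true := fun n => by simp only [Category.assoc]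
    have h2 : ∀ n, (D.prj false ≫ D₂.prj n) ≫ (D₂.inc n ≫ D.inc false) =
        D.prj false ≫ (D₂.prj n ≫ D₂.inc n) ≫ D.inc false := fun n => by simp only [Category.assoc]
    simp_rw [h1, h2]
    rw [← Preadditive.comp_sum, ← Preadditive.comp_sum, ← Preadditive.sum_comp,
      ← Preadditive.sum_comp, D₁.sum, D₂.sum, Category.id_comp, Category.id_comp, ← D.sum,
      Fintype.sum_bool]

/-- Extension of scalars of a direct sum. -/
def ext {k' : Type w} [Field k'] (σ : k →+* k') (D : DirSum T X) :
    DirSum (fun n => QRep.ext σ (T n)) (QRep.ext σ X) where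
  inc n := extHom σ (D.inc n)
  prj n := extHom σ (D.prj n)
  inc_prj n := by rw [← extHom_comp, D.inc_prj, extHom_id]
  inc_prj_ne m n h := by rw [← extHom_comp, D.inc_prj_ne m n h, extHom_zero]
  sum := by
    simp_rw [← extHom_comp]
    rw [← extHom_sum, D.sum, extHom_id]

theorem dim_eq (D : DirSum T X) (i : I) : X.dim i = ∑ n, (T n).dim i := by
  have e : (Fin (X.dim i) → k) ≃ₗ[k] (∀ n, Fin ((T n).dim i) → k) :=
    { toFun := fun v n => app (D.prj n) i v
      invFun := fun v => ∑ n, app (D.inc n) i (v n)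
      map_add' := fun v w => by
        ext n; simp
      map_smul' := fun c v => by
        ext n; simp
      left_inv := fun v => by
        have := congrArg (fun f => app f i v) D.sum
        simp only [app_sum, app_comp, app_id] at this
        exact this
      right_inv := fun v => by
        funext n
        change app (D.prj n) i (∑ n, app (D.inc n) i (v n)) = v n
        rw [map_sum, Finset.sum_eq_single n]
        · rw [← app_comp, D.inc_prj, app_id]
        · intro m _ hm
          rw [← app_comp, D.inc_prj_ne _ _ hm, app_zero]
        · intro h
          exact absurd (Finset.mem_univ n) h }
  have := e.finrank_eq
  rw [finrank_fin_fun, finrank_pi_fintype] at this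
  simpa using this

theorem exists_dirSum (T : ι → QRep k I) : ∃ X, Nonempty (DirSum T X) := by
  classical
  let R : QuiverRep k (fun i => ∀ n, Fin ((T n).dim i) → k) := fun i j a =>
    LinearMap.pi fun n => (T n).rep i j a ∘ₗ LinearMap.proj n
  obtain ⟨X, -, f, hf⟩ := exists_iso_abstract R
  have hf' : ∀ (i j : I) (a : i ⟶ j) w, (f j).symm (X.rep i j a w) = R i j a ((f i).symm w) :=
    fun i j a w => by rw [LinearEquiv.symm_apply_eq, hf, LinearEquiv.apply_symm_apply]
  refine ⟨X, ⟨{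
    inc := fun n => homMk (fun i => (f i).toLinearMap ∘ₗ LinearMap.single k (fun n => Fin ((T n).dim i) → k) n) ?_
    prj := fun n => homMk (fun i => LinearMap.proj n ∘ₗ (f i).symm.toLinearMap) ?_
    inc_prj := ?_
    inc_prj_ne := ?_
    sum := ?_ }⟩⟩
  · intro i j a v
    simp only [LinearMap.comp_apply, LinearEquiv.coe_coe]
    rw [← hf]
    congr 1
    funext m
    change Pi.single (M := fun n => Fin ((T n).dim j) → k) n ((T n).rep i j a v) m =
      (T m).rep i j a (Pi.single (M := fun n => Fin ((T n).dim i) → k) n v m)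
    by_cases h : m = n
    · subst h
      simp
    · simp [h]
  · intro i j a v
    simp only [LinearMap.comp_apply, LinearEquiv.coe_coe]
    rw [hf']
    rfl
  · intro n
    refine hom_ext fun i v => ?_
    simp
  · intro m n h
    refine hom_ext fun i v => ?_
    simp [h.symm]
  · refine hom_ext fun i v => ?_
    rw [app_sum]
    simp only [app_comp, app_homMk, LinearMap.comp_apply, LinearEquiv.coe_coe, app_id]
    rw [← map_sum, ← LinearEquiv.eq_symm_apply]
    exact Finset.univ_sum_single ((f i).symm v)

end DirSum

/-- The codimension of the space of homomorphisms that are not split monomorphisms. -/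
def codim (hZ : Indec Z) (X : QRep k I) : ℕ := finrank k ((Z ⟶ X) ⧸ rad hZ X)

/-- A homomorphism to a direct sum lies in the radical exactly when all its components do. With
`codim_pos` and `codim_eq_zero`, additivity makes `codim hZ` a measure of the multiplicity of `Z`
that refers to no decomposition. -/
theorem codim_dirSum (hZ : Indec Z) {ι : Type*} [Fintype ι] {T : ι → QRep k I} (D : DirSum T X) :
    codim hZ X = ∑ n, codim hZ (T n) := by
  classical
  have key : rad hZ X = (Submodule.pi Set.univ fun n => rad hZ (T n)).comap
      (D.homEquiv Z).toLinearMap := by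
    ext f
    simp only [Submodule.mem_comap, Submodule.mem_pi, Set.mem_univ, true_implies]
    constructor
    · intro hf n
      exact comp_mem_rad hZ hf _
    · intro hf
      rw [← D.comp_prj_inc f]
      exact Submodule.sum_mem _ fun n _ => comp_mem_rad hZ (hf n) _
  have e : ((Z ⟶ X) ⧸ rad hZ X) ≃ₗ[k] (∀ n, (Z ⟶ T n) ⧸ rad hZ (T n)) :=
    (Submodule.Quotient.equiv _ _ (D.homEquiv Z) (by
      rw [key, Submodule.map_comap_eq_of_surjective (D.homEquiv Z).surjective])).trans
      (Submodule.quotientPi fun n => rad hZ (T n))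
  rw [codim, e.finrank_eq, finrank_pi_fintype]
  rfl

theorem codim_iso (hZ : Indec Z) (e : X ≅ Y) : codim hZ X = codim hZ Y := by
  rw [codim_dirSum hZ ((DirSum.single X).trans e)]
  simp

theorem codim_pos (hZ : Indec Z) : 0 < codim hZ Z := by
  rw [codim, finrank_pos_iff, Submodule.Quotient.nontrivial_iff]
  intro h
  have : 𝟙 Z ∈ rad hZ Z := h ▸ Submodule.mem_top
  exact this (𝟙 Z) (by rw [Category.comp_id]; infer_instance)

theorem codim_eq_zero (hZ : Indec Z) (hY : Indec Y) (h : ¬ Nonempty (Z ≅ Y)) : codim hZ Y = 0 := by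
  have : rad hZ Y = ⊤ := by
    rw [eq_top_iff]
    intro f _ g hg
    have := hY.isIso_left hZ.one_ne hg
    exact h ⟨asIso f⟩
  rw [codim, this]
  exact finrank_zero_of_subsingleton

theorem Indec.of_iso (hX : Indec X) (e : X ≅ Y) : Indec Y where
  one_ne h := hX.one_ne (by rw [← e.hom_inv_id, ← Category.comp_id e.hom, h]; simp)
  idem f hf := by
    have : (e.hom ≫ f ≫ e.inv) ≫ (e.hom ≫ f ≫ e.inv) = e.hom ≫ f ≫ e.inv := by
      simp only [Category.assoc, Iso.inv_hom_id_assoc]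
      rw [← Category.assoc f f, hf]
    have hf' : f = e.inv ≫ (e.hom ≫ f ≫ e.inv) ≫ e.hom := by simp
    refine (hX.idem _ this).imp (fun h => ?_) fun h => ?_
    · rw [hf', h]; simp
    · rw [hf', h]; simp

end QRep
end

/-! ### Decompositions into indecomposables and Krull–Schmidt -/

noncomputable section

open CategoryTheory Module

set_option linter.unusedSectionVars false

namespace QRep

variable {k : Type w} [Field k] {I : Type u} [Quiver.{v} I] {X Y Z : QRep k I}

theorem one_eq_zero_iff : 𝟙 X = 0 ↔ ∀ i, X.dim i = 0 := by
  constructor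
  · intro h i
    by_contra h0
    have hpos : 0 < X.dim i := Nat.pos_of_ne_zero h0
    have := congrArg (fun f => app f i (fun _ => 1) ⟨0, hpos⟩) h
    simp at this
  · intro h
    refine hom_ext fun i v => ?_
    have : IsEmpty (Fin (X.dim i)) := by rw [h i]; infer_instance
    exact Subsingleton.elim _ _

/-- The direct sum of two representations. -/
def DirSum.binary {A B : QRep k I} {i : A ⟶ X} {p : X ⟶ A} {i' : B ⟶ X} {p' : X ⟶ B}
    (h : i ≫ p = 𝟙 A) (h' : i' ≫ p' = 𝟙 B) (h₁ : i ≫ p' = 0) (h₂ : i' ≫ p = 0)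
    (hs : p ≫ i + p' ≫ i' = 𝟙 X) : DirSum (fun b : Bool => cond b A B) X where
  inc := Bool.rec i' i
  prj := Bool.rec p' p
  inc_prj := by rintro (_ | _) <;> assumption
  inc_prj_ne := by
    rintro (_ | _) (_ | _) hne
    · exact absurd rfl hne
    · exact h₂
    · exact h₁
    · exact absurd rfl hne
  sum := by
    rw [Fintype.sum_bool]
    exact hs

theorem exists_binary {e : X ⟶ X} (he : e ≫ e = e) : ∃ (A B : QRep k I) (i : A ⟶ X) (p : X ⟶ A)
    (i' : B ⟶ X) (p' : X ⟶ B), i ≫ p = 𝟙 A ∧ i' ≫ p' = 𝟙 B ∧ i ≫ p' = 0 ∧ i' ≫ p = 0 ∧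
      p ≫ i = e ∧ p' ≫ i' = 𝟙 X - e := by
  have he' : (𝟙 X - e) ≫ (𝟙 X - e) = 𝟙 X - e := by
    rw [Preadditive.sub_comp, Preadditive.comp_sub, Preadditive.comp_sub, he]
    simp
  obtain ⟨A, i, p, h1, h2⟩ := exists_split he
  obtain ⟨B, i', p', h3, h4⟩ := exists_split he'
  have e1 : (p ≫ i) ≫ (p' ≫ i') = 0 := by
    rw [h2, h4, Preadditive.comp_sub, he]
    simp
  have e2 : (p' ≫ i') ≫ (p ≫ i) = 0 := by
    rw [h2, h4, Preadditive.sub_comp, he]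
    simp
  have e3 : i ≫ p' = i ≫ ((p ≫ i) ≫ (p' ≫ i')) ≫ p' := by
    simp only [Category.assoc]
    rw [h3, Category.comp_id, ← Category.assoc, h1, Category.id_comp]
  have e4 : i' ≫ p = i' ≫ ((p' ≫ i') ≫ (p ≫ i)) ≫ p := by
    simp only [Category.assoc]
    rw [h1, Category.comp_id, ← Category.assoc, h3, Category.id_comp]
  refine ⟨A, B, i, p, i', p', h1, h3, ?_, ?_, h2, h4⟩
  · rw [e3, e1]; simp
  · rw [e4, e2]; simp

variable [Finite I]

theorem exists_decomposition (X : QRep k I) : ∃ (ι : Type) (_ : Fintype ι) (T : ι → QRep k I),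
    (∀ n, Indec (T n)) ∧ Nonempty (DirSum T X) := by
  have := Fintype.ofFinite I
  induction hN : ∑ i, X.dim i using Nat.strong_induction_on generalizing X with
  | _ N ih =>
  by_cases h0 : 𝟙 X = 0
  · exact ⟨Empty, inferInstance, fun n => n.elim, fun n => n.elim, ⟨DirSum.empty h0 _⟩⟩
  by_cases hX : Indec X
  · exact ⟨Unit, inferInstance, fun _ => X, fun _ => hX, ⟨DirSum.single X⟩⟩
  obtain ⟨e, he, he0, he1⟩ : ∃ e : X ⟶ X, e ≫ e = e ∧ e ≠ 0 ∧ e ≠ 𝟙 X := by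
    by_contra! h
    exact hX ⟨h0, fun e he => or_iff_not_imp_left.2 (h e he)⟩
  obtain ⟨A, B, i, p, i', p', h1, h2, h3, h4, h5, h6⟩ := exists_binary he
  have D := DirSum.binary h1 h2 h3 h4 (by rw [h5, h6]; simp)
  have hdim : ∑ i, X.dim i = ∑ i, A.dim i + ∑ i, B.dim i := by
    rw [← Finset.sum_add_distrib]
    refine Finset.sum_congr rfl fun i _ => ?_
    rw [D.dim_eq, Fintype.sum_bool]
    rfl
  have hpos : ∀ {C : QRep k I}, 𝟙 C ≠ 0 → 0 < ∑ i, C.dim i := by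
    intro C hC
    rw [Ne, one_eq_zero_iff] at hC
    push Not at hC
    obtain ⟨i, hi⟩ := hC
    exact (Nat.pos_of_ne_zero hi).trans_le (Finset.single_le_sum (fun i _ => Nat.zero_le _)
      (Finset.mem_univ i))
  have hA : 0 < ∑ i, A.dim i := hpos fun h => he0 (by
    rw [← h5, ← Category.comp_id p, h]; simp)
  have hB : 0 < ∑ i, B.dim i := hpos fun h => he1 (by
    rw [eq_comm, ← sub_eq_zero, ← h6, ← Category.comp_id p', h]; simp)
  obtain ⟨ι, hι, T, hT, ⟨DT⟩⟩ := ih (∑ i, A.dim i) (by omega) A rfl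
  obtain ⟨ι', hι', T', hT', ⟨DT'⟩⟩ := ih (∑ i, B.dim i) (by omega) B rfl
  exact ⟨ι ⊕ ι', inferInstance, Sum.elim T T', Sum.rec hT hT', ⟨D.sumElim DT DT'⟩⟩

end QRep

/-- The isomorphism classes of indecomposable representations. -/
def Ind (k : Type w) [Field k] (I : Type u) [Quiver.{v} I] : Type _ :=
  {c : Quotient (isIsomorphicSetoid (QRep k I)) // QRep.Indec c.out}

namespace Ind

variable {k : Type w} [Field k] {I : Type u} [Quiver.{v} I] [Finite I]

/-- A representative of a class. -/
def rep (z : Ind k I) : QRep k I := z.1.out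

theorem indec (z : Ind k I) : QRep.Indec z.rep := z.2

/-- The class of an indecomposable representation. -/
def mk {Z : QRep k I} (hZ : QRep.Indec Z) : Ind k I :=
  ⟨Quotient.mk _ Z, hZ.of_iso (Quotient.mk_out (s := isIsomorphicSetoid (QRep k I)) Z).some.symm⟩

theorem nonempty_iso_rep_mk {Z : QRep k I} (hZ : QRep.Indec Z) : Nonempty ((mk hZ).rep ≅ Z) :=
  Quotient.mk_out (s := isIsomorphicSetoid (QRep k I)) Z

theorem mk_rep (z : Ind k I) : mk z.indec = z := Subtype.ext (Quotient.out_eq z.1)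

theorem mk_eq_mk_iff {Z Z' : QRep k I} (hZ : QRep.Indec Z) (hZ' : QRep.Indec Z') :
    mk hZ = mk hZ' ↔ Nonempty (Z ≅ Z') :=
  Subtype.ext_iff.trans (Quotient.eq (r := isIsomorphicSetoid (QRep k I)))

end Ind

namespace QRep

variable {k : Type w} [Field k] {I : Type u} [Quiver.{v} I] {X Y Z : QRep k I} [Finite I]

theorem codim_dirSum_indec (z : Ind k I) {ι : Type*} [Fintype ι] {T : ι → QRep k I}
    (hT : ∀ n, Indec (T n)) (D : DirSum T X) :
    codim z.indec X =
      (∑ n, Finsupp.single (Ind.mk (hT n)) 1 : Ind k I →₀ ℕ) z * codim z.indec z.rep := by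
  classical
  rw [codim_dirSum z.indec D, Finsupp.finsetSum_apply, Finset.sum_mul]
  refine Finset.sum_congr rfl fun n _ => ?_
  rw [Finsupp.single_apply]
  split_ifs with h
  · rw [one_mul]
    subst h
    exact codim_iso _ (Ind.nonempty_iso_rep_mk (hT n)).some.symm
  · rw [zero_mul]
    refine codim_eq_zero _ (hT n) fun hne => h ?_
    rw [← Ind.mk_rep z, Ind.mk_eq_mk_iff]
    exact hne.map Iso.symm

/-- The multiplicities of the indecomposable summands. -/
def mult (X : QRep k I) : Ind k I →₀ ℕ :=
  let _ := (exists_decomposition X).choose_spec.choose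
  ∑ n, Finsupp.single (Ind.mk ((exists_decomposition X).choose_spec.choose_spec.choose_spec.1 n)) 1

/-- This makes the multiplicities independent of the decomposition chosen in `mult`: the factor
`codim z.indec z.rep` is positive and can be cancelled. -/
theorem codim_eq_mult_mul (z : Ind k I) (X : QRep k I) :
    codim z.indec X = mult X z * codim z.indec z.rep := by
  let _ := (exists_decomposition X).choose_spec.choose
  exact codim_dirSum_indec z (exists_decomposition X).choose_spec.choose_spec.choose_spec.1
    (exists_decomposition X).choose_spec.choose_spec.choose_spec.2.some

theorem mult_dirSum {ι : Type*} [Fintype ι] {T : ι → QRep k I} (D : DirSum T X) :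
    mult X = ∑ n, mult (T n) := by
  ext z
  apply Nat.eq_of_mul_eq_mul_right (codim_pos z.indec)
  rw [← codim_eq_mult_mul, codim_dirSum _ D, Finsupp.finsetSum_apply, Finset.sum_mul]
  exact Finset.sum_congr rfl fun n _ => codim_eq_mult_mul z _

theorem mult_dirSum_indec {ι : Type*} [Fintype ι] {T : ι → QRep k I}
    (hT : ∀ n, Indec (T n)) (D : DirSum T X) :
    mult X = ∑ n, Finsupp.single (Ind.mk (hT n)) 1 := by
  ext z
  apply Nat.eq_of_mul_eq_mul_right (codim_pos z.indec)
  rw [← codim_eq_mult_mul, codim_dirSum_indec z hT D]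

theorem mult_indec (hZ : Indec Z) : mult Z = Finsupp.single (Ind.mk hZ) 1 := by
  rw [mult_dirSum_indec (fun _ => hZ) (DirSum.single Z)]
  simp

theorem mult_rep (z : Ind k I) : mult z.rep = Finsupp.single z 1 := by
  rw [mult_indec z.indec, Ind.mk_rep]

theorem mult_iso (e : X ≅ Y) : mult X = mult Y := by
  rw [mult_dirSum ((DirSum.single X).trans e)]
  simp

/-- The Krull–Schmidt theorem. -/
theorem mult_eq_iff : mult X = mult Y ↔ Nonempty (X ≅ Y) := by
  classical
  refine ⟨fun h => ?_, fun ⟨e⟩ => mult_iso e⟩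
  obtain ⟨ι, _, T, hT, ⟨D⟩⟩ := exists_decomposition X
  obtain ⟨ι', _, T', hT', ⟨D'⟩⟩ := exists_decomposition Y
  rw [mult_dirSum_indec hT D, mult_dirSum_indec hT' D'] at h
  -- Equal multiplicities mean equally many summands in each class, which gives a bijection between
  -- the summands that respects the classes.
  have hcard : ∀ z, Fintype.card {n // Ind.mk (hT n) = z} = Fintype.card {n // Ind.mk (hT' n) = z} := by
    intro z
    have := DFunLike.congr_fun h z
    rw [Finsupp.finsetSum_apply, Finsupp.finsetSum_apply] at this
    simp_rw [Finsupp.single_apply] at this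
    rw [Fintype.card_subtype, Fintype.card_subtype]
    simpa using this
  let σ : ι ≃ ι' := Equiv.ofFiberEquiv fun z => Fintype.equivOfCardEq (hcard z)
  have hσ : ∀ n, Ind.mk (hT' (σ n)) = Ind.mk (hT n) := fun n =>
    Equiv.ofFiberEquiv_map (f := fun n => Ind.mk (hT n)) (g := fun n => Ind.mk (hT' n)) _ n
  exact ⟨D.iso (D'.congr σ fun n =>
    ((Ind.mk_eq_mk_iff (hT' (σ n)) (hT n)).1 (hσ n)).some.symm)⟩

theorem exists_mult_eq (s : Ind k I →₀ ℕ) : ∃ X : QRep k I, mult X = s := by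
  induction s using Finsupp.induction_linear with
  | zero =>
    obtain ⟨X, ⟨D⟩⟩ := DirSum.exists_dirSum (k := k) (I := I) (fun n : Empty => n.elim)
    exact ⟨X, by rw [mult_dirSum D]; rfl⟩
  | add s t hs ht =>
    obtain ⟨A, rfl⟩ := hs
    obtain ⟨B, rfl⟩ := ht
    obtain ⟨X, ⟨D⟩⟩ := DirSum.exists_dirSum (fun b : Bool => cond b A B)
    refine ⟨X, ?_⟩
    rw [mult_dirSum D, Fintype.sum_bool]
    rfl
  | single z n =>
    obtain ⟨X, ⟨D⟩⟩ := DirSum.exists_dirSum (fun _ : Fin n => z.rep)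
    refine ⟨X, ?_⟩
    rw [mult_dirSum D, Finset.sum_const, mult_rep]
    simp

theorem dim_eq_mult_sum (X : QRep k I) (i : I) :
    X.dim i = (mult X).sum fun z m => m * z.rep.dim i := by
  obtain ⟨ι, _, T, hT, ⟨D⟩⟩ := exists_decomposition X
  rw [mult_dirSum_indec hT D, D.dim_eq, ← Finsupp.sum_finsetSum_index (by simp)
    (by intros; ring)]
  refine Finset.sum_congr rfl fun n _ => ?_
  rw [Finsupp.sum_single_index (by simp), one_mul,
    dim_eq_of_iso (Ind.nonempty_iso_rep_mk (hT n)).some]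

theorem mult_eq_zero_iff : mult X = 0 ↔ 𝟙 X = 0 := by
  constructor
  · intro h
    rw [one_eq_zero_iff]
    intro i
    rw [dim_eq_mult_sum, h, Finsupp.sum_zero_index]
  · intro h
    rw [mult_dirSum (DirSum.empty h fun n => n.elim)]
    rfl

end QRep
end

/-! ### Frobenius and descent to the finite field -/

noncomputable section

open CategoryTheory Module

set_option linter.unusedSectionVars false

/-- Galois descent over a finite field: a semilinear map all of whose vectors are periodic has
enough fixed vectors. -/
theorem span_fixed_eq_top {Ω : Type*} [Field Ω] [IsAlgClosed Ω] {q : ℕ} (hq : 2 ≤ q)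
    (hq0 : (q : Ω) = 0) {U : Type*} [AddCommGroup U] [Module Ω U] (φ : U →+ U)
    (hφ : ∀ (c : Ω) u, φ (c • u) = c ^ q • φ u) (hper : ∀ u, u ∈ Function.periodicPts φ) :
    Submodule.span Ω {u | φ u = u} = ⊤ := by
  classical
  by_contra hne
  obtain ⟨u, hu⟩ : ∃ u, u ∉ Submodule.span Ω {u | φ u = u} := by
    by_contra! h
    exact hne (eq_top_iff.2 fun u _ => h u)
  -- A functional `l` that kills the fixed vectors but not `u` is led to a contradiction by means of
  -- the traces of the multiples `c • u`.
  obtain ⟨l, hlu, hl⟩ := Submodule.exists_le_ker_of_notMem hu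
  obtain ⟨N, hN, hNu⟩ := hper u
  have hit : ∀ (i : ℕ) (c : Ω), φ^[i] (c • u) = c ^ q ^ i • φ^[i] u := by
    intro i c
    induction i with
    | zero => simp
    | succ i ih => rw [Function.iterate_succ_apply', ih, hφ, ← pow_mul, ← pow_succ,
        Function.iterate_succ_apply']
  -- For such `c` the vector `c • u` has period `N`, so the sum over its iterates is fixed by `φ`
  -- and is killed by `l`.
  have hfix : ∀ c : Ω, c ^ q ^ N = c → ∑ i ∈ Finset.range N, c ^ q ^ i * l (φ^[i] u) = 0 := by
    intro c hc
    have h1 : φ (∑ i ∈ Finset.range N, φ^[i] (c • u)) = ∑ i ∈ Finset.range N, φ^[i] (c • u) := by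
      rw [map_sum]
      simp_rw [← Function.iterate_succ_apply' φ]
      have h2 := Finset.sum_range_succ (fun i => φ^[i] (c • u)) N
      rw [Finset.sum_range_succ', hit N, hc, hNu.eq, Function.iterate_zero_apply] at h2
      exact add_right_cancel h2
    have h2 := hl (Submodule.subset_span h1)
    rw [LinearMap.mem_ker, map_sum] at h2
    rw [← h2]
    refine Finset.sum_congr rfl fun i _ => ?_
    rw [hit, map_smul, smul_eq_mul]
  -- `P` has degree at most `q ^ (N - 1)` and vanishes at the `q ^ N` roots of `X ^ (q ^ N) - X`; so
  -- `P = 0`, although its coefficient at `X` is `l u ≠ 0`.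
  let P : Polynomial Ω := ∑ i ∈ Finset.range N, Polynomial.monomial (q ^ i) (l (φ^[i] u))
  have hP1 : P.coeff 1 = l u := by
    rw [Polynomial.finsetSum_coeff, Finset.sum_eq_single 0]
    · simp
    · intro i _ hi
      rw [Polynomial.coeff_monomial, if_neg]
      exact (Nat.one_lt_pow hi (by omega)).ne'
    · intro h
      exact absurd (Finset.mem_range.2 hN) h
  have hsep : (Polynomial.X ^ q ^ N - Polynomial.X : Polynomial Ω).Separable := by
    obtain ⟨p, hp⟩ := CharP.exists Ω
    exact galois_poly_separable p _ (((CharP.cast_eq_zero_iff Ω p q).1 hq0).trans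
      (dvd_pow_self q hN.ne'))
  have hqN : 1 < q ^ N := Nat.one_lt_pow hN.ne' (by omega)
  have hdeg : P.natDegree < q ^ N := by
    refine (Polynomial.natDegree_sum_le_of_forall_le (n := q ^ (N - 1)) _ _ fun i hi => ?_).trans_lt ?_
    · refine (Polynomial.natDegree_monomial_le _).trans (Nat.pow_le_pow_right (by omega) ?_)
      have := Finset.mem_range.1 hi
      omega
    · exact Nat.pow_lt_pow_right (by omega) (by omega)
  have hcard := Polynomial.card_rootSet_eq_natDegree (K := Ω) hsep (IsAlgClosed.splits _)
  rw [FiniteField.X_pow_card_sub_X_natDegree_eq Ω hqN] at hcard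
  have hne : (Polynomial.X ^ q ^ N - Polynomial.X : Polynomial Ω) ≠ 0 :=
    FiniteField.X_pow_card_sub_X_ne_zero Ω hqN
  have hP0 : P = 0 := by
    refine Polynomial.eq_zero_of_natDegree_lt_card_of_eval_eq_zero' P
      ((Polynomial.X ^ q ^ N - Polynomial.X : Polynomial Ω).rootSet Ω).toFinset (fun c hc => ?_) ?_
    · rw [Set.mem_toFinset, Polynomial.mem_rootSet] at hc
      have hc' : c ^ q ^ N = c := by simpa [sub_eq_zero] using hc.2
      rw [← hfix c hc', Polynomial.eval_finsetSum]
      refine Finset.sum_congr rfl fun i _ => ?_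
      rw [Polynomial.eval_monomial, mul_comm]
    · rw [Set.toFinset_card, hcard]
      exact hdeg
  rw [hP0, Polynomial.coeff_zero] at hP1
  exact hlu hP1.symm

section frobenius

variable (K Ω : Type w) [Field K] [Finite K] [Field Ω] [Algebra K Ω] [IsAlgClosed Ω]
  [Algebra.IsAlgebraic K Ω]

/-- The Frobenius automorphism of an algebraic extension of a finite field. -/
def frob : Ω ≃+* Ω :=
  let _ := Fintype.ofFinite K
  (FiniteField.frobeniusAlgEquivOfAlgebraic K Ω).toRingEquiv

theorem frob_apply (x : Ω) : frob K Ω x = x ^ Nat.card K := by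
  let _ := Fintype.ofFinite K
  rw [Nat.card_eq_fintype_card]
  exact congrFun (FiniteField.coe_frobeniusAlgEquivOfAlgebraic K Ω) x

theorem frob_pow_apply (n : ℕ) (x : Ω) : (frob K Ω ^ n : Ω ≃+* Ω) x = x ^ Nat.card K ^ n := by
  induction n with
  | zero => simp
  | succ n ih =>
    rw [pow_succ', pow_succ, pow_mul, ← ih, ← frob_apply]
    rfl

theorem two_le_card : 2 ≤ Nat.card K := Finite.one_lt_card

theorem card_cast_eq_zero : ((Nat.card K : ℕ) : Ω) = 0 := by
  let _ := Fintype.ofFinite K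
  rw [Nat.card_eq_fintype_card, ← map_natCast (algebraMap K Ω), FiniteField.cast_card_eq_zero,
    map_zero]

variable {K Ω}

/-- The elements of `K` already exhaust the roots of `X ^ q - X`, by degree. -/
theorem mem_range_algebraMap_iff {x : Ω} :
    x ∈ Set.range (algebraMap K Ω) ↔ x ^ Nat.card K = x := by
  classical
  let _ := Fintype.ofFinite K
  constructor
  · rintro ⟨c, rfl⟩
    rw [← map_pow, Nat.card_eq_fintype_card, FiniteField.pow_card]
  · intro hx
    by_contra hxr
    let P : Polynomial Ω := Polynomial.X ^ Nat.card K - Polynomial.X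
    have hP : P ≠ 0 := FiniteField.X_pow_card_sub_X_ne_zero Ω (two_le_card K)
    have hd : P.natDegree = Nat.card K := FiniteField.X_pow_card_sub_X_natDegree_eq Ω (two_le_card K)
    let S : Finset Ω := insert x (Finset.univ.image (algebraMap K Ω))
    refine hP (Polynomial.eq_zero_of_natDegree_lt_card_of_eval_eq_zero' P S (fun c hc => ?_) ?_)
    · have hc' : c ^ Nat.card K = c := by
        rw [Finset.mem_insert] at hc
        obtain rfl | hc := hc
        · exact hx
        · obtain ⟨a, -, rfl⟩ := Finset.mem_image.1 hc
          rw [← map_pow, Nat.card_eq_fintype_card, FiniteField.pow_card]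
      rw [Polynomial.eval_sub, Polynomial.eval_pow, Polynomial.eval_X, hc', sub_self]
    · rw [hd, Finset.card_insert_of_notMem, Finset.card_image_of_injective _
        (algebraMap K Ω).injective, Finset.card_univ, Nat.card_eq_fintype_card]
      · exact Nat.lt_succ_self _
      · intro h
        obtain ⟨a, -, ha⟩ := Finset.mem_image.1 h
        exact hxr ⟨a, ha⟩

theorem exists_frob_pow_eq (x : Ω) : ∃ N > 0, x ^ Nat.card K ^ N = x := by
  have hx : IsIntegral K x := Algebra.IsIntegral.isIntegral x
  let L := IntermediateField.adjoin K {x}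
  have : FiniteDimensional K L := IntermediateField.adjoin.finiteDimensional hx
  have : Finite L := Module.finite_of_finite K
  let _ := Fintype.ofFinite L
  refine ⟨finrank K L, finrank_pos, ?_⟩
  have h1 := FiniteField.pow_card (⟨x, IntermediateField.mem_adjoin_simple_self K x⟩ : L)
  rw [← Nat.card_eq_fintype_card, Module.natCard_eq_pow_finrank (K := K)] at h1
  exact congrArg Subtype.val h1

theorem pow_card_pow_mul {x : Ω} {N : ℕ} (h : x ^ Nat.card K ^ N = x) (m : ℕ) :
    x ^ Nat.card K ^ (N * m) = x := by
  induction m with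
  | zero => simp
  | succ m ih => rw [Nat.mul_succ, pow_add, pow_mul, ih, h]

/-- Finitely many elements are fixed by a power of the Frobenius. -/
theorem exists_common_frob_pow {ι : Type*} [Finite ι] (x : ι → Ω) :
    ∃ N > 0, ∀ j, x j ^ Nat.card K ^ N = x j := by
  classical
  let _ := Fintype.ofFinite ι
  choose N hN h using fun j => exists_frob_pow_eq (K := K) (x j)
  refine ⟨∏ j, N j, Finset.prod_pos fun j _ => hN j, fun j => ?_⟩
  obtain ⟨m, hm⟩ := Finset.dvd_prod_of_mem N (Finset.mem_univ j)
  rw [hm]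
  exact pow_card_pow_mul (h j) m

theorem finite_fixed {N : ℕ} (hN : 0 < N) : Finite {x : Ω // x ^ Nat.card K ^ N = x} := by
  classical
  have h1 : 1 < Nat.card K ^ N := Nat.one_lt_pow hN.ne' (two_le_card K)
  have hP := FiniteField.X_pow_card_sub_X_ne_zero Ω h1
  refine Set.Finite.subset (Polynomial.rootSet_finite
    (Polynomial.X ^ Nat.card K ^ N - Polynomial.X : Polynomial Ω) Ω) fun x hx => ?_
  rw [Polynomial.mem_rootSet]
  refine ⟨hP, ?_⟩
  simp only [map_sub, map_pow, Polynomial.aeval_X]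
  exact sub_eq_zero.2 hx

theorem frob_comp_algebraMap : (frob K Ω : Ω →+* Ω).comp (algebraMap K Ω) = algebraMap K Ω :=
  RingHom.ext fun c => by
    have := (mem_range_algebraMap_iff (K := K) (Ω := Ω)).1 ⟨c, rfl⟩
    change frob K Ω _ = _
    rw [frob_apply, this]

namespace QRep

theorem exists_mapLin_eq {m n : ℕ} {f : (Fin m → Ω) →ₗ[Ω] (Fin n → Ω)}
    (hf : mapLin (frob K Ω : Ω →+* Ω) f = f) : ∃ f₀, mapLin (algebraMap K Ω) f₀ = f := by
  have h : ∀ a b, LinearMap.toMatrix' f a b ∈ Set.range (algebraMap K Ω) := by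
    intro a b
    rw [mem_range_algebraMap_iff, ← frob_apply]
    conv_rhs => rw [← hf, toMatrix_mapLin]
    rfl
  choose M hM using h
  refine ⟨Matrix.toLin' (Matrix.of M), LinearMap.toMatrix'.injective ?_⟩
  rw [toMatrix_mapLin, LinearMap.toMatrix'_toLin']
  ext a b
  exact hM a b

variable {I : Type u} [Quiver.{v} I] {X Y Z : QRep K I}

theorem mapLin_frob_algebraMap {m n : ℕ} (f : (Fin m → K) →ₗ[K] (Fin n → K)) :
    mapLin (frob K Ω : Ω →+* Ω) (mapLin (algebraMap K Ω) f) = mapLin (algebraMap K Ω) f := by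
  rw [mapLin_mapLin, frob_comp_algebraMap]

/-- The Frobenius on homomorphisms between representations defined over the small field. -/
def frobHom (X Y : QRep K I) : (ext (algebraMap K Ω) X ⟶ ext (algebraMap K Ω) Y) →+
    (ext (algebraMap K Ω) X ⟶ ext (algebraMap K Ω) Y) where
  toFun f := ⟨fun i => mapLin (frob K Ω : Ω →+* Ω) (f.1 i), fun i j a => by
    have h := congrArg (mapLin (frob K Ω : Ω →+* Ω)) (f.2 i j a)
    have h1 := mapLin_comp (frob K Ω : Ω →+* Ω) (f.1 j) (mapLin (algebraMap K Ω) (X.rep i j a))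
    have h2 := mapLin_comp (frob K Ω : Ω →+* Ω) (mapLin (algebraMap K Ω) (Y.rep i j a)) (f.1 i)
    rw [mapLin_frob_algebraMap] at h1 h2
    exact h1.symm.trans (h.trans h2)⟩
  map_zero' := Subtype.ext (funext fun i => map_zero (mapLin (frob K Ω : Ω →+* Ω)))
  map_add' f g := Subtype.ext (funext fun i =>
    map_add (mapLin (frob K Ω : Ω →+* Ω)) (f.1 i) (g.1 i))

theorem frobHom_smul (c : Ω) (f : ext (algebraMap K Ω) X ⟶ ext (algebraMap K Ω) Y) :
    frobHom X Y (c • f) = c ^ Nat.card K • frobHom X Y f := by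
  rw [← frob_apply]
  exact Subtype.ext (funext fun i => mapLin_smul _ c (f.1 i))

theorem frobHom_comp (f : ext (algebraMap K Ω) X ⟶ ext (algebraMap K Ω) Y)
    (g : ext (algebraMap K Ω) Y ⟶ ext (algebraMap K Ω) Z) :
    frobHom X Z (f ≫ g) = frobHom X Y f ≫ frobHom Y Z g :=
  Subtype.ext (funext fun i => mapLin_comp _ (g.1 i) (f.1 i))

theorem frobHom_eq_iff {f : ext (algebraMap K Ω) X ⟶ ext (algebraMap K Ω) Y} :
    frobHom X Y f = f ↔ ∃ f₀ : X ⟶ Y, extHom (algebraMap K Ω) f₀ = f := by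
  constructor
  · intro h
    have h' : ∀ i, ∃ f₀, mapLin (algebraMap K Ω) f₀ = f.1 i := fun i =>
      exists_mapLin_eq (congrFun (congrArg Subtype.val h) i)
    choose f₀ hf₀ using h'
    refine ⟨⟨f₀, fun i j a => mapLin_injective (algebraMap K Ω) ?_⟩, Subtype.ext (funext hf₀)⟩
    rw [mapLin_comp, mapLin_comp, hf₀, hf₀]
    exact f.2 i j a
  · rintro ⟨f₀, rfl⟩
    exact Subtype.ext (funext fun i => mapLin_frob_algebraMap _)

theorem iterate_frobHom (n : ℕ) (f : ext (algebraMap K Ω) X ⟶ ext (algebraMap K Ω) Y) (i : I) :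
    LinearMap.toMatrix' (((frobHom X Y)^[n] f).1 i) =
      (LinearMap.toMatrix' (f.1 i)).map (· ^ Nat.card K ^ n) := by
  induction n with
  | zero => ext; simp
  | succ n ih =>
    rw [Function.iterate_succ_apply']
    refine (toMatrix_mapLin _ _).trans ?_
    rw [ih]
    ext a b
    change frob K Ω (_ ^ _) = _ ^ _
    rw [frob_apply, ← pow_mul, ← pow_succ]

/-- The finitely many matrix entries of `f` lie in a common finite field. -/
theorem mem_periodicPts_frobHom [Finite I] (f : ext (algebraMap K Ω) X ⟶ ext (algebraMap K Ω) Y) :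
    f ∈ Function.periodicPts (frobHom X Y) := by
  obtain ⟨N, hN, h⟩ := exists_common_frob_pow (K := K)
    (fun x : Σ i : I, Fin (Y.dim i) × Fin (X.dim i) => LinearMap.toMatrix' (f.1 x.1) x.2.1 x.2.2)
  refine ⟨N, hN, Subtype.ext (funext fun i => LinearMap.toMatrix'.injective ?_)⟩
  rw [iterate_frobHom]
  ext a b
  exact h ⟨i, a, b⟩

variable [Finite I]

/-- A Frobenius stable subspace of homomorphisms is spanned by homomorphisms defined over the small
field. -/
theorem le_span_extHom (U : Submodule Ω (ext (algebraMap K Ω) X ⟶ ext (algebraMap K Ω) Y))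
    (hU : ∀ f ∈ U, frobHom X Y f ∈ U) :
    U ≤ Submodule.span Ω (extHom (algebraMap K Ω) '' {f₀ : X ⟶ Y | extHom (algebraMap K Ω) f₀ ∈ U}) := by
  let φ : U →+ U := ((frobHom X Y).comp U.toAddSubgroup.subtype).codRestrict U.toAddSubgroup
    fun f => hU f.1 f.2
  have hφn : ∀ (n : ℕ) (f : U), ((φ^[n] f : U) : ext (algebraMap K Ω) X ⟶ ext (algebraMap K Ω) Y) =
      (frobHom X Y)^[n] f.1 := by
    intro n f
    induction n with
    | zero => rfl
    | succ n ih =>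
      rw [Function.iterate_succ_apply', Function.iterate_succ_apply', ← ih]
      rfl
  have := span_fixed_eq_top (two_le_card K) (card_cast_eq_zero K Ω) φ
    (fun c u => Subtype.ext (frobHom_smul c u.1)) fun u => by
      obtain ⟨N, hN, h⟩ := mem_periodicPts_frobHom u.1
      exact ⟨N, hN, Subtype.ext ((hφn N u).trans h)⟩
  intro f hf
  have h1 : (⟨f, hf⟩ : U) ∈ Submodule.span Ω {u | φ u = u} := this ▸ Submodule.mem_top
  have h2 := Submodule.mem_map_of_mem (f := U.subtype) h1
  rw [Submodule.map_span] at h2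
  refine Submodule.span_mono ?_ h2
  rintro _ ⟨u, hu, rfl⟩
  obtain ⟨f₀, hf₀⟩ := frobHom_eq_iff.1 (congrArg Subtype.val hu : frobHom X Y u.1 = u.1)
  refine ⟨f₀, ?_, hf₀⟩
  change extHom _ f₀ ∈ U
  rw [hf₀]
  exact u.2

theorem span_extHom_eq_top (X Y : QRep K I) :
    Submodule.span Ω (Set.range (extHom (algebraMap K Ω) : (X ⟶ Y) → _)) = ⊤ := by
  rw [eq_top_iff]
  refine (le_span_extHom ⊤ fun _ _ => Submodule.mem_top).trans (Submodule.span_mono ?_)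
  rintro _ ⟨f, -, rfl⟩
  exact ⟨f, rfl⟩

end QRep

end frobenius
end

/-! ### Noether–Deuring and descent of Frobenius-invariant representations -/

noncomputable section

open CategoryTheory Module

set_option linter.unusedSectionVars false

namespace QRep

section functional

variable {k k' : Type w} [Field k] [Field k'] (σ : k →+* k')

theorem exists_functional_mapLin {m n : ℕ} (μ : ((Fin m → k) →ₗ[k] (Fin n → k)) →ₗ[k] k) :
    ∃ μ' : ((Fin m → k') →ₗ[k'] (Fin n → k')) →ₗ[k'] k', ∀ f, μ' (mapLin σ f) = σ (μ f) := by
  refine ⟨∑ a, ∑ b, σ (μ (Matrix.toLin' (Matrix.single a b 1))) •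
    (LinearMap.proj b ∘ₗ LinearMap.proj (φ := fun _ => Fin m → k') a) ∘ₗ
      (LinearMap.toMatrix' : _ ≃ₗ[k'] Matrix (Fin n) (Fin m) k').toLinearMap, fun f => ?_⟩
  have hf : f = ∑ a, ∑ b, LinearMap.toMatrix' f a b • Matrix.toLin' (Matrix.single a b (1 : k)) := by
    apply LinearMap.toMatrix'.injective
    simp_rw [map_sum, LinearEquiv.map_smul, LinearMap.toMatrix'_toLin', Matrix.smul_single]
    conv_lhs => rw [Matrix.matrix_eq_sum_single (LinearMap.toMatrix' f)]
    simp
  conv_rhs => rw [hf]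
  simp only [LinearMap.sum_apply, map_sum, map_smul, LinearMap.smul_apply, smul_eq_mul, map_mul]
  refine Finset.sum_congr rfl fun a _ => Finset.sum_congr rfl fun b _ => ?_
  rw [mul_comm]
  congr 1
  change LinearMap.toMatrix' (mapLin σ f) a b = _
  rw [toMatrix_mapLin]
  rfl

variable {I : Type u} [Quiver.{v} I] [Finite I] {X Y : QRep k I}

/-- The functional is extended to the product of all spaces of linear maps at the vertices, where
scalars can be extended entry by entry. This avoids identifying the homomorphisms after extension
with a tensor product. -/
theorem exists_functional (l : (X ⟶ Y) →ₗ[k] k) :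
    ∃ l' : (ext σ X ⟶ ext σ Y) →ₗ[k'] k', ∀ f, l' (extHom σ f) = σ (l f) := by
  classical
  let _ := Fintype.ofFinite I
  obtain ⟨g, hg⟩ := LinearMap.exists_extend (p := homSpace X Y) l
  choose μ hμ using fun i => exists_functional_mapLin σ (g ∘ₗ LinearMap.single k
    (fun i => (Fin (X.dim i) → k) →ₗ[k] (Fin (Y.dim i) → k)) i)
  refine ⟨∑ i, μ i ∘ₗ LinearMap.proj i ∘ₗ (homSpace (ext σ X) (ext σ Y)).subtype, fun f => ?_⟩
  have h1 : l f = g f.1 := (LinearMap.congr_fun hg f).symm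
  have h2 : f.1 = ∑ i, Pi.single i (f.1 i) := (Finset.univ_sum_single f.1).symm
  rw [h1, h2, map_sum, map_sum, LinearMap.sum_apply]
  exact Finset.sum_congr rfl fun i _ => hμ i (f.1 i)

theorem linearIndependent_extHom {ι : Type*} {f : ι → (X ⟶ Y)} (hf : LinearIndependent k f) :
    LinearIndependent k' fun i => extHom σ (f i) := by
  classical
  obtain ⟨r, hr⟩ := LinearMap.exists_leftInverse_of_injective _ (LinearMap.ker_eq_bot.2 hf)
  choose l hl using fun i => exists_functional σ (Finsupp.lapply i ∘ₗ r)
  rw [linearIndependent_iff']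
  intro s c hc i hi
  have h1 : ∀ j, l i (extHom σ (f j)) = if j = i then 1 else 0 := by
    intro j
    rw [hl]
    have := LinearMap.congr_fun hr (Finsupp.single j 1)
    rw [LinearMap.comp_apply, Finsupp.linearCombination_single, one_smul] at this
    rw [LinearMap.comp_apply, this]
    simp [Finsupp.single_apply, apply_ite σ]
  have := congrArg (l i) hc
  rw [map_sum, map_zero] at this
  simp_rw [map_smul, h1] at this
  simpa [hi] using this

end functional

/-- Positive multiplicity is positive codimension of the radical, that is, the existence of a split
monomorphism from `z.rep`. -/
theorem mult_pos_iff {k : Type w} [Field k] {I : Type u} [Quiver.{v} I] [Finite I] {X : QRep k I}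
    {z : Ind k I} : 0 < mult X z ↔ ∃ (f : z.rep ⟶ X) (g : X ⟶ z.rep), f ≫ g = 𝟙 z.rep := by
  have h1 : 0 < mult X z ↔ 0 < codim z.indec X := by
    rw [codim_eq_mult_mul]
    exact (Nat.mul_pos_iff_of_pos_right (codim_pos z.indec)).symm
  rw [h1, codim, finrank_pos_iff, Submodule.Quotient.nontrivial_iff]
  constructor
  · intro h
    obtain ⟨f, hf⟩ : ∃ f, f ∉ rad z.indec X := by
      by_contra! h'
      exact h (eq_top_iff.2 fun f _ => h' f)
    rw [mem_rad] at hf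
    push Not at hf
    obtain ⟨g, hg⟩ := hf
    exact ⟨f, g ≫ inv (f ≫ g), by rw [← Category.assoc, IsIso.hom_inv_id]⟩
  · rintro ⟨f, g, hfg⟩ h
    have : f ∈ rad z.indec X := h ▸ Submodule.mem_top
    exact this g (by rw [hfg]; infer_instance)

theorem exists_dirSum_of_mult_pos {k : Type w} [Field k] {I : Type u} [Quiver.{v} I] [Finite I]
    {X : QRep k I} {z : Ind k I} (h : 0 < mult X z) : ∃ X' : QRep k I,
      mult X = Finsupp.single z 1 + mult X' ∧ Nonempty (DirSum (fun b => cond b z.rep X') X) := by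
  classical
  obtain ⟨X', hX'⟩ := exists_mult_eq (mult X - Finsupp.single z 1)
  have h1 : mult X = Finsupp.single z 1 + mult X' := by
    rw [hX', add_tsub_cancel_of_le]
    rw [Finsupp.single_le_iff]
    exact h
  obtain ⟨X₁, ⟨D⟩⟩ := DirSum.exists_dirSum (fun b => cond b z.rep X')
  refine ⟨X', h1, ?_⟩
  have h2 : mult X₁ = mult X := by
    rw [mult_dirSum D, Fintype.sum_bool, h1, ← mult_rep z]
    rfl
  exact ⟨D.trans (mult_eq_iff.1 h2).some⟩

section

variable {K Ω : Type w} [Field K] [Finite K] [Field Ω] [Algebra K Ω] [IsAlgClosed Ω]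
  [Algebra.IsAlgebraic K Ω] {I : Type u} [Quiver.{v} I] [Finite I] {X Y Z : QRep K I}

/-- If `z.rep` were not a summand of `Y`, all composites `z.rep ⟶ Y ⟶ z.rep` would lie in the
radical. A functional on `End z.rep` that kills the radical but not the identity extends to `Ω`;
there it kills all composites through `Y`, since the homomorphisms over `Ω` are spanned by those
over `K`. But over `Ω` the identity of `z.rep` factors through `X ≅ Y`. -/
theorem mult_pos_of_ext_iso (e : ext (algebraMap K Ω) X ≅ ext (algebraMap K Ω) Y) {z : Ind K I}
    (h : 0 < mult X z) : 0 < mult Y z := by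
  obtain ⟨f₀, g₀, hfg⟩ := mult_pos_iff.1 h
  by_contra hY
  have hrad : ∀ (f : z.rep ⟶ Y) (g : Y ⟶ z.rep), f ≫ g ∈ rad z.indec z.rep := by
    intro f g
    rw [mem_rad_self]
    refine (z.indec.isIso_or_nil _).resolve_left fun hiso => hY (mult_pos_iff.2
      ⟨f, g ≫ inv (f ≫ g), by rw [← Category.assoc, IsIso.hom_inv_id]⟩)
  have h1 : 𝟙 z.rep ∉ rad z.indec z.rep := fun h1 =>
    h1 (𝟙 _) (by rw [Category.comp_id]; infer_instance)
  obtain ⟨l, hl1, hl⟩ := Submodule.exists_le_ker_of_notMem h1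
  obtain ⟨l', hl'⟩ := exists_functional (algebraMap K Ω) l
  have h2 : ∀ (f : ext (algebraMap K Ω) z.rep ⟶ ext (algebraMap K Ω) Y)
      (g : ext (algebraMap K Ω) Y ⟶ ext (algebraMap K Ω) z.rep), l' (f ≫ g) = 0 := by
    intro f g
    have hf : f ∈ Submodule.span Ω (Set.range (extHom (algebraMap K Ω) : (z.rep ⟶ Y) → _)) := by
      rw [span_extHom_eq_top]
      exact Submodule.mem_top
    have hg : g ∈ Submodule.span Ω (Set.range (extHom (algebraMap K Ω) : (Y ⟶ z.rep) → _)) := by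
      rw [span_extHom_eq_top]
      exact Submodule.mem_top
    induction hf using Submodule.span_induction with
    | zero => rw [Limits.zero_comp, map_zero]
    | add f f' _ _ h h' => rw [Preadditive.add_comp, map_add, h, h', add_zero]
    | smul c f _ h => rw [Linear.smul_comp, map_smul, h, smul_zero]
    | mem f hf =>
      obtain ⟨f, rfl⟩ := hf
      induction hg using Submodule.span_induction with
      | zero => rw [Limits.comp_zero, map_zero]
      | add f f' _ _ h h' => rw [Preadditive.comp_add, map_add, h, h', add_zero]
      | smul c f _ h => rw [Linear.comp_smul, map_smul, h, smul_zero]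
      | mem g hg =>
        obtain ⟨g, rfl⟩ := hg
        rw [← extHom_comp, hl', LinearMap.mem_ker.1 (hl (hrad f g)), map_zero]
  have h3 := h2 (extHom _ f₀ ≫ e.hom) (e.inv ≫ extHom _ g₀)
  rw [Category.assoc, Iso.hom_inv_id_assoc, ← extHom_comp, hfg, hl', map_eq_zero] at h3
  exact hl1 h3

/-- The Noether–Deuring theorem over a finite field. -/
theorem nonempty_iso_of_ext_iso (e : ext (algebraMap K Ω) X ≅ ext (algebraMap K Ω) Y) :
    Nonempty (X ≅ Y) := by
  classical
  rw [← mult_eq_iff]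
  induction hn : (mult X).degree using Nat.strong_induction_on generalizing X Y with
  | _ n ih =>
  by_cases h0 : mult X = 0
  · rw [h0, eq_comm, mult_eq_zero_iff, one_eq_zero_iff]
    rw [mult_eq_zero_iff, one_eq_zero_iff] at h0
    intro i
    rw [← h0 i]
    exact (congrFun (dim_eq_of_iso e) i).symm
  obtain ⟨z, hz⟩ := Finsupp.ne_iff.1 h0
  have hz : 0 < mult X z := Nat.pos_of_ne_zero hz
  obtain ⟨X', hX', ⟨D⟩⟩ := exists_dirSum_of_mult_pos hz
  -- The common summand is split off from both sides and cancelled over `Ω` by Krull–Schmidt; the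
  -- complements have fewer summands.
  obtain ⟨Y', hY', ⟨D'⟩⟩ := exists_dirSum_of_mult_pos (mult_pos_of_ext_iso e hz)
  have h1 := mult_iso e
  rw [mult_dirSum (D.ext (algebraMap K Ω)), mult_dirSum (D'.ext (algebraMap K Ω)), Fintype.sum_bool,
    Fintype.sum_bool] at h1
  have h2 := add_left_cancel h1
  have h3 : Nonempty (ext (algebraMap K Ω) X' ≅ ext (algebraMap K Ω) Y') := mult_eq_iff.1 h2
  rw [hX', hY', ih (mult X').degree ?_ h3.some rfl]
  rw [← hn, hX', map_add, Finsupp.degree_single]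
  omega

/-- A representation isomorphic to its Frobenius twist is defined over the small field. -/
theorem exists_ext_iso {X : QRep Ω I} [∀ i j : I, Finite (i ⟶ j)]
    (e : ext (frob K Ω : Ω →+* Ω) X ≅ X) :
    ∃ X₀ : QRep K I, Nonempty (ext (algebraMap K Ω) X₀ ≅ X) := by
  -- At each vertex `e` composed with Frobenius on coordinates is a bijective semilinear map. A
  -- basis of fixed vectors gives `h` with `g * Frob(h) = h`, the solution that Lang's theorem
  -- provides for the general linear group.
  have hB : ∀ i, ∃ h : (Fin (X.dim i) → Ω) ≃ₗ[Ω] (Fin (X.dim i) → Ω),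
      app e.hom i ∘ₗ mapLin (frob K Ω : Ω →+* Ω) h.toLinearMap = h.toLinearMap := by
    intro i
    let g : (Fin (X.dim i) → Ω) →ₗ[Ω] (Fin (X.dim i) → Ω) := app e.hom i
    let φ : (Fin (X.dim i) → Ω) →+ (Fin (X.dim i) → Ω) :=
      { toFun := fun v => g fun a => frob K Ω (v a)
        map_zero' := by
          simp only [Pi.zero_apply, map_zero]
          exact map_zero g
        map_add' := fun v w => by
          rw [← map_add]
          congr 1
          funext a
          simp }
    have hφinj : Function.Injective φ := by
      intro v w h
      have := (bijective_app e i).1 h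
      funext a
      exact (frob K Ω).injective (congrFun this a)
    have hper : ∀ v, v ∈ Function.periodicPts φ := by
      intro v
      obtain ⟨N, hN, h⟩ := exists_common_frob_pow (K := K) (fun x : Fin (X.dim i) ⊕
        (Fin (X.dim i) × Fin (X.dim i)) => Sum.elim v (fun y => LinearMap.toMatrix' g y.1 y.2) x)
      have hv : ∀ a, v a ^ Nat.card K ^ N = v a := fun a => h (Sum.inl a)
      have hg : ∀ a b, LinearMap.toMatrix' g a b ^ Nat.card K ^ N = LinearMap.toMatrix' g a b :=
        fun a b => h (Sum.inr (a, b))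
      -- The vectors with coordinates in a finite field that contains those of `v` and the entries
      -- of `g` form a finite set, stable under the injective map `φ`; so `v` is periodic.
      let S := {u : Fin (X.dim i) → Ω // ∀ a, u a ^ Nat.card K ^ N = u a}
      have : Finite S := by
        have := finite_fixed (K := K) (Ω := Ω) hN
        exact Finite.of_injective (fun u : S => fun a =>
          (⟨u.1 a, u.2 a⟩ : {x : Ω // x ^ Nat.card K ^ N = x})) fun u u' h =>
          Subtype.ext (funext fun a => congrArg Subtype.val (congrFun h a))
      have hφS : ∀ u : S, ∀ a, φ u.1 a ^ Nat.card K ^ N = φ u.1 a := by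
        intro u a
        change (g _ a) ^ _ = g _ a
        rw [← LinearMap.toMatrix'_mulVec g, Matrix.mulVec, dotProduct, ← frob_pow_apply, map_sum]
        refine Finset.sum_congr rfl fun b _ => ?_
        rw [map_mul, frob_pow_apply, frob_pow_apply, hg, ← map_pow, u.2]
      let ψ : S → S := fun u => ⟨φ u.1, hφS u⟩
      have hψ : Function.Injective ψ := fun u u' h =>
        Subtype.ext (hφinj (congrArg Subtype.val h))
      obtain ⟨M, hM, hMv⟩ := hψ.mem_periodicPts ⟨v, hv⟩
      refine ⟨M, hM, ?_⟩
      have h2 : ∀ (n : ℕ) (u : S), (ψ^[n] u).1 = φ^[n] u.1 := by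
        intro n u
        induction n with
        | zero => rfl
        | succ n ih => rw [Function.iterate_succ_apply', Function.iterate_succ_apply', ← ih]
      exact (h2 M ⟨v, hv⟩).symm.trans (congrArg Subtype.val hMv)
    have hspan := span_fixed_eq_top (two_le_card K) (card_cast_eq_zero K Ω) φ (fun c v => by
      change g _ = c ^ Nat.card K • g _
      rw [← map_smul]
      congr 1
      funext a
      simp [frob_apply, mul_pow]) hper
    let b := Basis.ofSpan hspan.ge
    have hb : ∀ x, φ (b x) = b x := fun x => Basis.ofSpan_subset hspan.ge ⟨x, rfl⟩
    let _ := FiniteDimensional.fintypeBasisIndex b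
    let b' := b.reindex (Fintype.equivFinOfCardEq ((finrank_eq_card_basis b).symm.trans
      (finrank_fin_fun Ω)))
    have hb' : ∀ x, φ (b' x) = b' x := fun x => by
      rw [Basis.reindex_apply]
      exact hb _
    refine ⟨(Pi.basisFun Ω _).equiv b' (Equiv.refl _), (Pi.basisFun Ω _).ext fun x => ?_⟩
    have h1 : ((Pi.basisFun Ω _).equiv b' (Equiv.refl _)) (Pi.basisFun Ω _ x) = b' x :=
      Basis.equiv_apply _ _ _ _
    rw [LinearMap.comp_apply, LinearEquiv.coe_coe, h1]
    conv_rhs => rw [← hb', ← h1]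
    change g _ = g _
    congr 1
    have h2 : (Pi.basisFun Ω (Fin (X.dim i)) x) =
        fun a => (frob K Ω : Ω →+* Ω) (Pi.basisFun Ω (Fin (X.dim i)) x a) := by
      funext a
      by_cases h : a = x
      · subst h; simp
      · simp [h]
    conv_lhs => rw [h2]
    exact mapLin_apply _ _ _
  choose h hh using hB
  -- In the new coordinates the representation is fixed by Frobenius, so its matrices have entries
  -- in `K`.
  have hrep : ∀ (i j : I) (a : i ⟶ j), ∃ f₀, mapLin (algebraMap K Ω) f₀ =
      (h j).symm.toLinearMap ∘ₗ X.rep i j a ∘ₗ (h i).toLinearMap := by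
    intro i j a
    apply exists_mapLin_eq
    apply LinearMap.cancel_left (f := (h j).toLinearMap) (h j).injective |>.1
    have e1 : (h j).toLinearMap ∘ₗ (h j).symm.toLinearMap = LinearMap.id := by ext; simp
    have hrhs : (h j).toLinearMap ∘ₗ (h j).symm.toLinearMap ∘ₗ X.rep i j a ∘ₗ (h i).toLinearMap =
        X.rep i j a ∘ₗ (h i).toLinearMap := by
      rw [← LinearMap.comp_assoc, e1, LinearMap.id_comp]
    rw [hrhs]
    conv_lhs => rw [← hh j]
    rw [LinearMap.comp_assoc, ← mapLin_comp, hrhs, mapLin_comp, ← LinearMap.comp_assoc]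
    have e2 : app e.hom j ∘ₗ mapLin (frob K Ω : Ω →+* Ω) (X.rep i j a) =
      X.rep i j a ∘ₗ app e.hom i := e.hom.2 i j a
    rw [e2, LinearMap.comp_assoc, hh i]
  choose R hR using hrep
  refine ⟨⟨X.dim, R⟩, ⟨isoOfBijective (homMk (fun i => (h i).toLinearMap) fun i j a v => ?_)
    fun i => (h i).bijective⟩⟩
  change h j (mapLin (algebraMap K Ω) (R i j a) v) = X.rep i j a (h i v)
  rw [hR]
  simp

end

end QRep
end

/-! ### Frobenius orbits of indecomposables -/

noncomputable section

open CategoryTheory Module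

set_option linter.unusedSectionVars false

section orbits

variable {A : Type*} {f : A → A} (hf : ∀ x, x ∈ Function.periodicPts f)

/-- The equivalence relation of being in the same orbit of a self-map all of whose points are
periodic. -/
def orbitSetoid : Setoid A where
  r x y := ∃ n : ℕ, f^[n] x = y
  iseqv :=
    { refl := fun _ => ⟨0, rfl⟩
      symm := by
        rintro x _ ⟨n, rfl⟩
        obtain ⟨N, hN, hx⟩ := hf x
        refine ⟨N * n - n, ?_⟩
        rw [← Function.iterate_add_apply, Nat.sub_add_cancel (Nat.le_mul_of_pos_left n hN)]
        exact (hx.mul_const n).eq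
      trans := by
        rintro x _ _ ⟨n, rfl⟩ ⟨m, rfl⟩
        exact ⟨m + n, Function.iterate_add_apply f m n x⟩ }

theorem orbitSetoid_apply_eq (x : A) :
    (Quotient.mk (orbitSetoid hf) (f x)) = Quotient.mk (orbitSetoid hf) x :=
  (Quotient.sound (s := orbitSetoid hf) ⟨1, rfl⟩).symm

theorem orbit_eq_image (x : A) : {y | Quotient.mk (orbitSetoid hf) y = Quotient.mk _ x} =
    (fun n => f^[n] x) '' Set.Iio (Function.minimalPeriod f x) := by
  ext y
  constructor
  · intro hy
    obtain ⟨n, hn⟩ := Quotient.exact (s := orbitSetoid hf) (Eq.symm hy)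
    refine ⟨n % Function.minimalPeriod f x,
      Nat.mod_lt _ (Function.minimalPeriod_pos_of_mem_periodicPts (hf x)), ?_⟩
    change f^[_] x = y
    rw [Function.iterate_mod_minimalPeriod_eq, hn]
  · rintro ⟨n, -, rfl⟩
    exact (Quotient.sound (s := orbitSetoid hf) ⟨n, rfl⟩).symm

theorem finite_orbit (o : Quotient (orbitSetoid hf)) : {y | Quotient.mk (orbitSetoid hf) y = o}.Finite := by
  induction o using Quotient.inductionOn with
  | _ x =>
    rw [orbit_eq_image]
    exact (Set.finite_Iio _).image _

/-- The size of an orbit. -/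
def orbitCard (o : Quotient (orbitSetoid hf)) : ℕ :=
  {y | Quotient.mk (orbitSetoid hf) y = o}.ncard

theorem orbitCard_mk (x : A) :
    orbitCard hf (Quotient.mk _ x) = Function.minimalPeriod f x := by
  rw [orbitCard, orbit_eq_image, Set.InjOn.ncard_image, ← Finset.coe_Iio, Set.ncard_coe_finset,
    Nat.card_Iio]
  intro m hm n hn h
  exact Function.iterate_injOn_Iio_minimalPeriod hm hn h

theorem orbitCard_pos (o : Quotient (orbitSetoid hf)) : 0 < orbitCard hf o := by
  induction o using Quotient.inductionOn with
  | _ x =>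
    rw [orbitCard_mk]
    exact Function.minimalPeriod_pos_of_mem_periodicPts (hf x)

/-- The finitely supported function constant on orbits with given values. -/
def orbitPull (t : Quotient (orbitSetoid hf) →₀ ℕ) : A →₀ ℕ :=
  Finsupp.ofSupportFinite (fun x => t (Quotient.mk _ x)) <| by
    have h : (Quotient.mk (orbitSetoid hf) ⁻¹' (t.support : Set _)).Finite :=
      t.support.finite_toSet.preimage' fun o _ => finite_orbit hf o
    refine h.subset fun x hx => ?_
    exact Finsupp.mem_support_iff.2 hx

theorem orbitPull_apply (t : Quotient (orbitSetoid hf) →₀ ℕ) (x : A) :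
    orbitPull hf t x = t (Quotient.mk _ x) := rfl

theorem exists_orbitPull_eq {s : A →₀ ℕ} (hs : ∀ x, s (f x) = s x) : ∃ t, orbitPull hf t = s := by
  have hn : ∀ (n : ℕ) x, s (f^[n] x) = s x := by
    intro n x
    induction n with
    | zero => rfl
    | succ n ih => rw [Function.iterate_succ_apply', hs, ih]
  let g : Quotient (orbitSetoid hf) → ℕ := Quotient.lift s (by
    rintro x _ ⟨n, rfl⟩
    exact (hn n x).symm)
  refine ⟨Finsupp.ofSupportFinite g ?_, ?_⟩
  · refine (s.support.finite_toSet.image (Quotient.mk (orbitSetoid hf))).subset fun o ho => ?_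
    induction o using Quotient.inductionOn with
    | _ x => exact ⟨x, Finsupp.mem_support_iff.2 ho, rfl⟩
  · ext x
    rfl

end orbits

namespace QRep

section ringEquiv

variable {k k' : Type w} [Field k] [Field k'] (τ : k ≃+* k')

theorem mapLin_surjective {m n : ℕ} : Function.Surjective
    (mapLin (τ : k →+* k') : ((Fin m → k) →ₗ[k] (Fin n → k)) → _) := fun f =>
  ⟨mapLin (τ.symm : k' →+* k) f, by
    rw [mapLin_mapLin, RingEquiv.comp_symm, mapLin_ringHom_id]⟩

variable {I : Type u} [Quiver.{v} I] {X Y : QRep k I}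

theorem extHom_surjective : Function.Surjective (extHom (τ : k →+* k') : (X ⟶ Y) → _) := by
  intro f
  choose g hg using fun i => mapLin_surjective τ (f.1 i)
  refine ⟨⟨g, fun i j a => mapLin_injective (τ : k →+* k') ?_⟩, Subtype.ext (funext hg)⟩
  rw [mapLin_comp, mapLin_comp, hg, hg]
  exact f.2 i j a

theorem Indec.ext (hX : Indec X) : Indec (ext (τ : k →+* k') X) where
  one_ne h := hX.one_ne (extHom_injective (τ : k →+* k') (by rw [extHom_id, extHom_zero, h]))
  idem e he := by
    obtain ⟨e, rfl⟩ := extHom_surjective τ e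
    rw [← extHom_comp] at he
    refine (hX.idem e (extHom_injective _ he)).imp (fun h => ?_) fun h => ?_
    · rw [h, extHom_zero]
    · rw [h, extHom_id]

theorem ext_symm_ext (X : QRep k I) : QRep.ext (τ.symm : k' →+* k) (QRep.ext (τ : k →+* k') X) = X := by
  rw [ext_ext, RingEquiv.symm_comp, ext_id]

end ringEquiv

end QRep

namespace Ind

variable {k k' : Type w} [Field k] [Field k'] (τ : k ≃+* k') {I : Type u} [Quiver.{v} I] [Finite I]

/-- Transport of the classes of indecomposable representations along an isomorphism of fields. -/
def map (z : Ind k I) : Ind k' I := mk (z.indec.ext τ)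

theorem map_mk {Z : QRep k I} (hZ : QRep.Indec Z) : map τ (mk hZ) = mk (hZ.ext τ) :=
  (mk_eq_mk_iff _ _).2 ((nonempty_iso_rep_mk hZ).map (QRep.extIso _))

theorem map_eq_iff {z : Ind k I} {z' : Ind k' I} :
    map τ z = z' ↔ Nonempty (QRep.ext (τ : k →+* k') z.rep ≅ z'.rep) := by
  conv_lhs => rw [← mk_rep z', map, mk_eq_mk_iff]

theorem map_symm_map (z : Ind k I) : map τ.symm (map τ z) = z := by
  change map τ.symm (mk (z.indec.ext τ)) = z
  rw [map_mk]
  conv_rhs => rw [← mk_rep z]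
  rw [mk_eq_mk_iff]
  exact ⟨eqToIso (QRep.ext_symm_ext τ _)⟩

theorem map_injective : Function.Injective (map τ : Ind k I → _) :=
  Function.LeftInverse.injective (map_symm_map τ)

theorem map_surjective : Function.Surjective (map τ : Ind k I → _) :=
  Function.RightInverse.surjective (map_symm_map τ.symm)

theorem map_iterate (τ : k ≃+* k) (n : ℕ) (z : Ind k I) : (map τ)^[n] z = map (τ ^ n) z := by
  induction n with
  | zero =>
    rw [Function.iterate_zero_apply, eq_comm, map_eq_iff]
    exact ⟨eqToIso (QRep.ext_id _)⟩
  | succ n ih =>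
    rw [Function.iterate_succ_apply', ih, eq_comm, map_eq_iff]
    have h := (map_eq_iff (τ ^ n)).1 (rfl : map (τ ^ n) z = _)
    have h' := (map_eq_iff τ).1 (rfl : map τ (map (τ ^ n) z) = _)
    have e := QRep.ext_ext ((τ ^ n : k ≃+* k) : k →+* k) (τ : k →+* k) z.rep
    have e' : (τ : k →+* k).comp ((τ ^ n : k ≃+* k) : k →+* k) = ((τ ^ (n + 1) : k ≃+* k) : k →+* k) := by
      rw [pow_succ']
      rfl
    rw [e'] at e
    exact ⟨eqToIso e.symm ≪≫ QRep.extIso _ h.some ≪≫ h'.some⟩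

theorem dim_map (z : Ind k I) : (map τ z).rep.dim = z.rep.dim := by
  obtain ⟨e⟩ := (map_eq_iff τ).1 (rfl : map τ z = _)
  exact (QRep.dim_eq_of_iso e).symm

end Ind

namespace QRep

theorem mult_ext {k k' : Type w} [Field k] [Field k'] {I : Type u} [Quiver.{v} I] [Finite I]
    (τ : k ≃+* k') (X : QRep k I) (z : Ind k I) :
    mult (ext (τ : k →+* k') X) (Ind.map τ z) = mult X z := by
  obtain ⟨ι, _, T, hT, ⟨D⟩⟩ := exists_decomposition X
  rw [mult_dirSum_indec hT D, mult_dirSum_indec (fun n => (hT n).ext τ) (D.ext (τ : k →+* k')),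
    Finsupp.finsetSum_apply, Finsupp.finsetSum_apply]
  refine Finset.sum_congr rfl fun n _ => ?_
  rw [← Ind.map_mk τ (hT n), ← Finsupp.mapDomain_single,
    Finsupp.mapDomain_apply (Ind.map_injective τ)]

section frobenius

variable {K Ω : Type w} [Field K] [Finite K] [Field Ω] [Algebra K Ω] [IsAlgClosed Ω]
  [Algebra.IsAlgebraic K Ω] {I : Type u} [Quiver.{v} I] [Finite I]

theorem exists_ext_frob_pow_eq [∀ i j : I, Finite (i ⟶ j)] (X : QRep Ω I) :
    ∃ N > 0, ext ((frob K Ω ^ N : Ω ≃+* Ω) : Ω →+* Ω) X = X := by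
  obtain ⟨N, hN, h⟩ := exists_common_frob_pow (K := K)
    (fun x : Σ (i : I) (j : I) (_ : i ⟶ j), Fin (X.dim j) × Fin (X.dim i) =>
      LinearMap.toMatrix' (X.rep x.1 x.2.1 x.2.2.1) x.2.2.2.1 x.2.2.2.2)
  refine ⟨N, hN, ?_⟩
  obtain ⟨d, r⟩ := X
  rw [ext]
  congr 1
  funext i j a
  apply LinearMap.toMatrix'.injective
  rw [toMatrix_mapLin]
  ext x y
  exact (frob_pow_apply K Ω N _).trans (h ⟨i, j, a, x, y⟩)

theorem mem_periodicPts_map_frob [∀ i j : I, Finite (i ⟶ j)] (z : Ind Ω I) :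
    z ∈ Function.periodicPts (Ind.map (frob K Ω)) := by
  obtain ⟨N, hN, h⟩ := exists_ext_frob_pow_eq (K := K) z.rep
  refine ⟨N, hN, ?_⟩
  rw [Function.IsPeriodicPt, Function.IsFixedPt, Ind.map_iterate, Ind.map_eq_iff]
  exact ⟨eqToIso h⟩

variable (K Ω I) [∀ i j : I, Finite (i ⟶ j)]

/-- The Frobenius orbits on the classes of indecomposable representations. -/
abbrev Orb : Type _ :=
  Quotient (orbitSetoid (fun z : Ind Ω I => mem_periodicPts_map_frob (K := K) z))

/-- The class of the orbit of an indecomposable representation. -/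
abbrev orb (z : Ind Ω I) : Orb K Ω I := Quotient.mk _ z

variable {K Ω I}

/-- The size of a Frobenius orbit. -/
def Orb.card (o : Orb K Ω I) : ℕ := orbitCard _ o

theorem Orb.card_pos (o : Orb K Ω I) : 0 < o.card := orbitCard_pos _ o

/-- The dimension vector of the representations in an orbit. -/
def Orb.dim (o : Orb K Ω I) : I → ℕ := o.out.rep.dim

theorem dim_orb (z : Ind Ω I) : (orb K Ω I z).dim = z.rep.dim := by
  obtain ⟨n, hn⟩ := Quotient.exact (s := orbitSetoid _) (Quotient.out_eq (orb K Ω I z)).symm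
  rw [Orb.dim, ← hn, Ind.map_iterate, Ind.dim_map]

/-- An extension of scalars from `K` equals its own Frobenius twist, so its multiplicities are
constant on orbits. -/
theorem exists_orbitPull_eq_mult (X : QRep K I) :
    ∃ t : Orb K Ω I →₀ ℕ, orbitPull _ t = mult (ext (algebraMap K Ω) X) := by
  refine exists_orbitPull_eq _ fun z => ?_
  have h := mult_ext (frob K Ω) (ext (algebraMap K Ω) X) z
  rw [ext_ext, frob_comp_algebraMap] at h
  exact h

variable (Ω) in
/-- The multiplicities of the Frobenius orbits in the extension of scalars of a representation. -/
def orbMult (X : QRep K I) : Orb K Ω I →₀ ℕ := (exists_orbitPull_eq_mult X).choose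

theorem orbMult_apply (X : QRep K I) (z : Ind Ω I) :
    orbMult Ω X (orb K Ω I z) = mult (ext (algebraMap K Ω) X) z := by
  rw [← (exists_orbitPull_eq_mult X).choose_spec]
  rfl

theorem orbMult_eq_iff {X Y : QRep K I} : orbMult Ω X = orbMult Ω Y ↔ Nonempty (X ≅ Y) := by
  constructor
  · intro h
    have : mult (ext (algebraMap K Ω) X) = mult (ext (algebraMap K Ω) Y) := by
      ext z
      rw [← orbMult_apply, ← orbMult_apply, h]
    exact nonempty_iso_of_ext_iso (mult_eq_iff.1 this).some
  · rintro ⟨e⟩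
    ext o
    induction o using Quotient.inductionOn with
    | _ z => rw [orbMult_apply, orbMult_apply, mult_iso (extIso _ e)]

theorem orbMult_dirSum {X : QRep K I} {ι : Type*} [Fintype ι] {T : ι → QRep K I} (D : DirSum T X) :
    orbMult Ω X = ∑ n, orbMult Ω (T n) := by
  ext o
  induction o using Quotient.inductionOn with
  | _ z =>
    rw [orbMult_apply, mult_dirSum (D.ext (algebraMap K Ω)), Finsupp.finsetSum_apply,
      Finsupp.finsetSum_apply]
    exact Finset.sum_congr rfl fun n _ => (orbMult_apply _ _).symm

/-- The representation over `Ω` with multiplicities constant on orbits is isomorphic to its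
Frobenius twist by Krull–Schmidt, and therefore descends. -/
theorem exists_orbMult_eq (t : Orb K Ω I →₀ ℕ) : ∃ X : QRep K I, orbMult Ω X = t := by
  obtain ⟨X, hX⟩ := exists_mult_eq (orbitPull _ t)
  have h1 : mult (ext (frob K Ω : Ω →+* Ω) X) = mult X := by
    ext z
    obtain ⟨z, rfl⟩ := Ind.map_surjective (frob K Ω) z
    rw [mult_ext, hX, orbitPull_apply, orbitPull_apply, orbitSetoid_apply_eq]
  obtain ⟨X₀, ⟨e⟩⟩ := exists_ext_iso (mult_eq_iff.1 h1).some
  refine ⟨X₀, ?_⟩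
  ext o
  induction o using Quotient.inductionOn with
  | _ z => rw [orbMult_apply, mult_iso e, hX, orbitPull_apply]

theorem orbMult_eq_zero_iff {X : QRep K I} : orbMult Ω X = 0 ↔ 𝟙 X = 0 := by
  rw [one_eq_zero_iff]
  have h : orbMult Ω X = 0 ↔ mult (ext (algebraMap K Ω) X) = 0 := by
    constructor
    · intro h
      ext z
      rw [← orbMult_apply, h]
      rfl
    · intro h
      ext o
      induction o using Quotient.inductionOn with
      | _ z => rw [orbMult_apply, h]; rfl
  rw [h, mult_eq_zero_iff, one_eq_zero_iff]

/-- Orbit multiplicities are additive, and a single orbit with multiplicity one is not a sum of two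
nonzero multisets. -/
theorem indec_of_orbMult {X : QRep K I} {o : Orb K Ω I} (h : orbMult Ω X = Finsupp.single o 1) :
    Indec X := by
  classical
  refine ⟨fun h0 => ?_, fun e he => ?_⟩
  · rw [← orbMult_eq_zero_iff (Ω := Ω), h, Finsupp.single_eq_zero] at h0
    exact one_ne_zero h0
  · obtain ⟨A, B, i, p, i', p', h1, h2, h3, h4, h5, h6⟩ := exists_binary he
    have D := DirSum.binary h1 h2 h3 h4 (by rw [h5, h6]; simp)
    have hD := orbMult_dirSum (Ω := Ω) D
    rw [Fintype.sum_bool, h] at hD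
    change _ = orbMult Ω A + orbMult Ω B at hD
    have hsum := DFunLike.congr_fun hD o
    rw [Finsupp.add_apply, Finsupp.single_eq_same] at hsum
    have hoth : ∀ o', o' ≠ o → orbMult Ω A o' = 0 ∧ orbMult Ω B o' = 0 := by
      intro o' ho
      have := DFunLike.congr_fun hD o'
      rw [Finsupp.add_apply, Finsupp.single_eq_of_ne ho] at this
      omega
    obtain hA | hB : orbMult Ω A o = 0 ∨ orbMult Ω B o = 0 := by omega
    · left
      have : orbMult Ω A = 0 := by
        ext o'
        by_cases ho : o' = o
        · rw [ho, hA]; rfl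
        · exact (hoth o' ho).1
      rw [orbMult_eq_zero_iff] at this
      rw [← h5, ← Category.comp_id p, this]
      simp
    · right
      have : orbMult Ω B = 0 := by
        ext o'
        by_cases ho : o' = o
        · rw [ho, hB]; rfl
        · exact (hoth o' ho).2
      rw [orbMult_eq_zero_iff] at this
      rw [eq_comm, ← sub_eq_zero, ← h6, ← Category.comp_id p', this]
      simp

variable (o : Orb K Ω I)

theorem exists_descent : ∃ z : Ind K I, orbMult Ω z.rep = Finsupp.single o 1 := by
  obtain ⟨X, hX⟩ := exists_orbMult_eq (Finsupp.single o 1)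
  refine ⟨Ind.mk (indec_of_orbMult hX), ?_⟩
  rw [← hX]
  exact orbMult_eq_iff.2 (Ind.nonempty_iso_rep_mk _)

/-- The indecomposable representation over the small field that an orbit comes from. -/
def Orb.descent : Ind K I := (exists_descent o).choose

theorem orbMult_descent : orbMult Ω o.descent.rep = Finsupp.single o 1 := (exists_descent o).choose_spec

theorem descent_injective : Function.Injective (Orb.descent : Orb K Ω I → Ind K I) := by
  intro o o' h
  have := orbMult_descent o
  rw [h, orbMult_descent] at this
  exact (Finsupp.single_left_injective one_ne_zero this).symm

theorem orbMult_eq_mult_sum (X : QRep K I) :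
    orbMult Ω X = (mult X).sum fun z m => m • orbMult Ω z.rep := by
  obtain ⟨ι, _, T, hT, ⟨D⟩⟩ := exists_decomposition X
  rw [mult_dirSum_indec hT D, orbMult_dirSum D, ← Finsupp.sum_finsetSum_index (by simp)
    (by intros; rw [add_smul])]
  refine Finset.sum_congr rfl fun n _ => ?_
  rw [Finsupp.sum_single_index (by simp), one_smul,
    orbMult_eq_iff.2 (Ind.nonempty_iso_rep_mk (hT n))]

/-- The indecomposables over `K` that occur in `X` are the descents of orbits: a representation with
the multiplicities on the right has the same orbit multiplicities as `X`. -/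
theorem mult_eq_mapDomain_orbMult (X : QRep K I) :
    mult X = (orbMult Ω X).mapDomain Orb.descent := by
  obtain ⟨Y, hY⟩ := exists_mult_eq ((orbMult Ω X).mapDomain Orb.descent)
  rw [← hY, mult_eq_iff, ← orbMult_eq_iff (Ω := Ω), orbMult_eq_mult_sum Y, hY,
    Finsupp.sum_mapDomain_index (by simp) (by intros; rw [add_smul])]
  simp_rw [orbMult_descent]
  simp

end frobenius

end QRep
end

/-! ### Residue fields of endomorphism rings -/

noncomputable section

open CategoryTheory Module

set_option linter.unusedSectionVars false

namespace QRep

section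

variable {k : Type w} [Field k] {I : Type u} [Quiver.{v} I] [Finite I] {X Y Z : QRep k I}

/-- An endomorphism minus one of its eigenvalues is not invertible, hence nilpotent. -/
theorem codim_self_of_isAlgClosed [IsAlgClosed k] (hZ : Indec Z) : codim hZ Z = 1 := by
  refine le_antisymm ?_ (codim_pos hZ)
  refine finrank_le_one (Submodule.Quotient.mk (𝟙 Z)) fun φ => ?_
  obtain ⟨φ, rfl⟩ := Submodule.Quotient.mk_surjective _ φ
  have : Nontrivial (End Z) := ⟨⟨𝟙 Z, 0, hZ.one_ne⟩⟩
  obtain ⟨c, hc⟩ := spectrum.nonempty_of_isAlgClosed_of_finiteDimensional k (End.of φ)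
  refine ⟨c, ?_⟩
  rw [← Submodule.Quotient.mk_smul, Submodule.Quotient.eq, mem_rad_self]
  refine (hZ.isIso_or_nil _).resolve_left fun h => ?_
  rw [spectrum.mem_iff] at hc
  refine hc ?_
  have := (isUnit_iff_isIso (c • 𝟙 Z - φ)).2 h
  rw [Algebra.algebraMap_eq_smul_one]
  exact this

theorem exists_indec_retract (h : 𝟙 X ≠ 0) : ∃ (W : QRep k I) (_ : Indec W) (a : W ⟶ X) (b : X ⟶ W),
    a ≫ b = 𝟙 W := by
  rw [Ne, ← mult_eq_zero_iff] at h
  obtain ⟨z, hz⟩ := Finsupp.ne_iff.1 h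
  obtain ⟨a, b, hab⟩ := mult_pos_iff.1 (Nat.pos_of_ne_zero hz)
  exact ⟨z.rep, z.indec, a, b, hab⟩

variable {ι : Type*} [Fintype ι] {T : ι → QRep k I}

/-- The endomorphisms of a direct sum whose diagonal components are nilpotent. -/
def diagRad (hT : ∀ n, Indec (T n)) (D : DirSum T X) : Submodule k (X ⟶ X) where
  carrier := {f | ∀ n, D.inc n ≫ f ≫ D.prj n ∈ rad (hT n) (T n)}
  zero_mem' := fun n => by
    rw [Limits.zero_comp, Limits.comp_zero]
    exact Submodule.zero_mem _
  add_mem' := by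
    intro f g hf hg n
    rw [Preadditive.add_comp, Preadditive.comp_add]
    exact Submodule.add_mem _ (hf n) (hg n)
  smul_mem' := by
    intro c f hf n
    rw [Linear.smul_comp, Linear.comp_smul]
    exact Submodule.smul_mem _ c (hf n)

theorem mem_diagRad {hT : ∀ n, Indec (T n)} {D : DirSum T X} {f : X ⟶ X} :
    f ∈ diagRad hT D ↔ ∀ n, D.inc n ≫ f ≫ D.prj n ∈ rad (hT n) (T n) := Iff.rfl

theorem finrank_diagRad [DecidableEq ι] (hT : ∀ n, Indec (T n)) (D : DirSum T X) :
    finrank k (X ⟶ X) = finrank k (diagRad hT D) + ∑ n, codim (hT n) (T n) := by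
  let φ : (X ⟶ X) →ₗ[k] (∀ n, (T n ⟶ T n) ⧸ rad (hT n) (T n)) := LinearMap.pi fun n =>
    (rad (hT n) (T n)).mkQ ∘ₗ
      { toFun := fun f => D.inc n ≫ f ≫ D.prj n
        map_add' := fun f g => by rw [Preadditive.add_comp, Preadditive.comp_add]
        map_smul' := fun c f => by
          rw [Linear.smul_comp, Linear.comp_smul, RingHom.id_apply] }
  have hker : LinearMap.ker φ = diagRad hT D := by
    ext f
    rw [LinearMap.mem_ker, funext_iff, mem_diagRad]
    exact forall_congr' fun n => Submodule.Quotient.mk_eq_zero _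
  have hsurj : Function.Surjective φ := by
    intro g
    choose f hf using fun n => Submodule.Quotient.mk_surjective _ (g n)
    refine ⟨∑ n, D.prj n ≫ f n ≫ D.inc n, funext fun n => ?_⟩
    rw [← hf n]
    change Submodule.Quotient.mk (D.inc n ≫ (∑ m, D.prj m ≫ f m ≫ D.inc m) ≫ D.prj n) = _
    rw [← Category.assoc, D.inc_sum_prj, Category.assoc, D.inc_prj, Category.comp_id]
  rw [← LinearMap.finrank_range_add_finrank_ker φ, hker, LinearMap.range_eq_top.2 hsurj, finrank_top,
    finrank_pi_fintype, add_comm]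
  rfl

/-- Taking diagonal components is multiplicative modulo the radical: the cross terms factor through
a nonisomorphic indecomposable, so they are not invertible. -/
theorem comp_diag_mem_rad (hT : ∀ n, Indec (T n)) (hne : ∀ m n, m ≠ n → ¬ Nonempty (T m ≅ T n))
    (D : DirSum T X) (f g : X ⟶ X) (n : ι) :
    D.inc n ≫ (f ≫ g) ≫ D.prj n - (D.inc n ≫ f ≫ D.prj n) ≫ (D.inc n ≫ g ≫ D.prj n) ∈
      rad (hT n) (T n) := by
  classical
  have h1 : D.inc n ≫ (f ≫ g) ≫ D.prj n =
      ∑ m, (D.inc n ≫ f ≫ D.prj m) ≫ (D.inc m ≫ g ≫ D.prj n) := by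
    have : f ≫ g = ∑ m, f ≫ D.prj m ≫ D.inc m ≫ g := by
      rw [← Preadditive.comp_sum, D.prj_inc_comp]
    rw [this, Preadditive.sum_comp, Preadditive.comp_sum]
    simp only [Category.assoc]
  rw [h1, ← Finset.add_sum_erase _ _ (Finset.mem_univ n), add_sub_cancel_left]
  refine Submodule.sum_mem _ fun m hm => ?_
  rw [mem_rad_self]
  refine ((hT n).isIso_or_nil _).resolve_left fun h => ?_
  have := (hT m).isIso_left (hT n).one_ne h
  exact hne n m (Finset.ne_of_mem_erase hm).symm ⟨asIso (D.inc n ≫ f ≫ D.prj m)⟩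

/-- For pairwise nonisomorphic summands the nilpotent endomorphisms thus form a subspace. If `f`
with nilpotent diagonal were not nilpotent, its Fitting idempotent `f ≫ g` would be nonzero, still
with diagonal in the radical, and would have an indecomposable summand `W` in its image. Expanding
the identity of `W` through the matrix of the idempotent, locality forces one entry to be an
isomorphism, on or off the diagonal, and both are excluded. -/
theorem nil_iff_mem_diagRad (hT : ∀ n, Indec (T n)) (hne : ∀ m n, m ≠ n → ¬ Nonempty (T m ≅ T n))
    (D : DirSum T X) (f : X ⟶ X) : Nil f ↔ f ∈ diagRad hT D := by
  classical
  constructor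
  · rintro ⟨N, hN⟩ n
    have h1 : ∀ m : ℕ, D.inc n ≫ (End.of f ^ m) ≫ D.prj n -
        (End.of (D.inc n ≫ f ≫ D.prj n) ^ m).asHom ∈ rad (hT n) (T n) := by
      intro m
      induction m with
      | zero =>
        have h2 : D.inc n ≫ 𝟙 X ≫ D.prj n - 𝟙 (T n) = 0 := by
          rw [Category.id_comp, D.inc_prj, sub_self]
        exact h2 ▸ Submodule.zero_mem _
      | succ m ih =>
        rw [pow_succ', pow_succ', End.mul_def, End.mul_def]
        have h2 := comp_diag_mem_rad hT hne D (End.of f ^ m) f n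
        have h3 := comp_mem_rad (hT n) ih (D.inc n ≫ f ≫ D.prj n)
        rw [Preadditive.sub_comp] at h3
        have h4 := Submodule.add_mem _ h2 h3
        rw [sub_add_sub_cancel] at h4
        exact h4
    have h2 := h1 N
    rw [hN] at h2
    rw [mem_rad_self]
    refine ((hT n).isIso_or_nil _).resolve_left fun h => ?_
    have h3 : IsUnit (End.of (D.inc n ≫ f ≫ D.prj n)) := (isUnit_iff_isIso _).2 h
    have h4 := h3.pow N
    have h5 : D.inc n ≫ (0 : X ⟶ X) ≫ D.prj n = 0 := by simp
    have h6 : -(End.of (D.inc n ≫ f ≫ D.prj n) ^ N).asHom ∈ rad (hT n) (T n) := by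
      have h7 : D.inc n ≫ (0 : X ⟶ X) ≫ D.prj n - (End.of (D.inc n ≫ f ≫ D.prj n) ^ N).asHom ∈
        rad (hT n) (T n) := h2
      rwa [h5, zero_sub] at h7
    have h8 := (Submodule.neg_mem_iff _).1 h6
    rw [mem_rad_self] at h8
    exact not_isIso_of_nil (hT n).one_ne h8 ((isUnit_iff_isIso _).1 h4)
  · intro hf
    obtain ⟨g, -, he, h0, -⟩ := exists_idem f
    apply h0
    by_contra hne0
    have heD : ∀ n, D.inc n ≫ (f ≫ g) ≫ D.prj n ∈ rad (hT n) (T n) := by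
      intro n
      have h1 := comp_diag_mem_rad hT hne D f g n
      have h2 := comp_mem_rad (hT n) (hf n) (D.inc n ≫ g ≫ D.prj n)
      have h3 := Submodule.add_mem _ h1 h2
      rwa [sub_add_cancel] at h3
    obtain ⟨A, i, p, h1, h2⟩ := exists_split he
    have hA : 𝟙 A ≠ 0 := fun h => hne0 (by rw [← h2, ← Category.comp_id p, h]; simp)
    obtain ⟨W, hW, a, b, hab⟩ := exists_indec_retract hA
    have key : ∑ n, ∑ m, (a ≫ i ≫ D.prj n) ≫ (D.inc n ≫ (f ≫ g) ≫ D.prj m) ≫ (D.inc m ≫ p ≫ b) =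
        𝟙 W := by
      have e1 : ∀ n, ∑ m, (a ≫ i ≫ D.prj n) ≫ (D.inc n ≫ (f ≫ g) ≫ D.prj m) ≫ (D.inc m ≫ p ≫ b) =
          a ≫ i ≫ D.prj n ≫ D.inc n ≫ (f ≫ g) ≫ p ≫ b := by
        intro n
        have := D.prj_inc_comp (p ≫ b)
        conv_rhs => rw [← this]
        simp only [Preadditive.comp_sum, Category.assoc]
      simp_rw [e1]
      have e2 := D.prj_inc_comp ((f ≫ g) ≫ p ≫ b)
      rw [← Preadditive.comp_sum, ← Preadditive.comp_sum, e2, ← h2]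
      have e3 : i ≫ (p ≫ i) ≫ p ≫ b = b := by
        rw [Category.assoc, ← Category.assoc, h1, Category.id_comp, ← Category.assoc, h1,
          Category.id_comp]
      rw [e3, hab]
    have hiso : IsIso (∑ n, ∑ m, (a ≫ i ≫ D.prj n) ≫ (D.inc n ≫ (f ≫ g) ≫ D.prj m) ≫
        (D.inc m ≫ p ≫ b)) := by
      rw [key]
      infer_instance
    obtain ⟨n, -, hn⟩ := hW.exists_isIso_of_sum _ _ hiso
    obtain ⟨m, -, hm⟩ := hW.exists_isIso_of_sum _ _ hn
    have i1 := (hT n).isIso_left hW.one_ne hm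
    have i2 : IsIso ((D.inc n ≫ (f ≫ g) ≫ D.prj m) ≫ (D.inc m ≫ p ≫ b)) :=
      IsIso.of_isIso_comp_left (a ≫ i ≫ D.prj n) _
    have i3 : IsIso (D.inc m ≫ p ≫ b) := by
      rw [← Category.assoc] at hm
      exact (hT m).isIso_right hW.one_ne hm
    have i4 : IsIso (D.inc n ≫ (f ≫ g) ≫ D.prj m) := IsIso.of_isIso_comp_right _ (D.inc m ≫ p ≫ b)
    by_cases hnm : n = m
    · subst hnm
      have := heD n
      rw [mem_rad_self] at this
      exact not_isIso_of_nil (hT n).one_ne this i4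
    · exact hne n m hnm ⟨asIso (D.inc n ≫ (f ≫ g) ≫ D.prj m)⟩

theorem codim_add_finrank_rad (hZ : Indec Z) : codim hZ X + finrank k (rad hZ X) = finrank k (Z ⟶ X) :=
  Submodule.finrank_quotient_add_finrank _

end

section frobenius

variable {K Ω : Type w} [Field K] [Finite K] [Field Ω] [Algebra K Ω] [IsAlgClosed Ω]
  [Algebra.IsAlgebraic K Ω] {I : Type u} [Quiver.{v} I] [Finite I] {X Y : QRep K I}

/-- A basis of `S` remains independent over `Ω`, and it spans `U` because a Frobenius stable
subspace is spanned by its elements over `K`. -/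
theorem finrank_eq_of_frob_stable {S : Submodule K (X ⟶ Y)}
    {U : Submodule Ω (ext (algebraMap K Ω) X ⟶ ext (algebraMap K Ω) Y)}
    (hU : ∀ f ∈ U, frobHom X Y f ∈ U) (h : ∀ f, extHom (algebraMap K Ω) f ∈ U ↔ f ∈ S) :
    finrank K S = finrank Ω U := by
  let b := finBasis K S
  have hb : LinearIndependent K fun n => (b n : X ⟶ Y) :=
    b.linearIndependent.map' S.subtype (Submodule.ker_subtype _)
  have hli := linearIndependent_extHom (algebraMap K Ω) hb
  have hspan : U = Submodule.span Ω (Set.range fun n => extHom (algebraMap K Ω) (b n : X ⟶ Y)) := by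
    apply le_antisymm
    · refine (le_span_extHom U hU).trans (Submodule.span_le.2 ?_)
      rintro _ ⟨f, hf, rfl⟩
      have hf' : f ∈ S := (h f).1 hf
      have h1 := congrArg Subtype.val (b.sum_repr ⟨f, hf'⟩)
      simp only [Submodule.coe_sum, Submodule.coe_smul] at h1
      rw [SetLike.mem_coe, ← h1, extHom_sum]
      refine Submodule.sum_mem _ fun n _ => ?_
      rw [extHom_smul]
      exact Submodule.smul_mem _ _ (Submodule.subset_span ⟨n, rfl⟩)
    · rw [Submodule.span_le]
      rintro _ ⟨n, rfl⟩
      exact (h _).2 (b n).2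
  rw [hspan, finrank_span_eq_card hli, Fintype.card_fin]

theorem finrank_ext_hom (X Y : QRep K I) :
    finrank K (X ⟶ Y) = finrank Ω (ext (algebraMap K Ω) X ⟶ ext (algebraMap K Ω) Y) := by
  have := finrank_eq_of_frob_stable (Ω := Ω) (X := X) (Y := Y) (S := ⊤) (U := ⊤)
    (fun _ _ => Submodule.mem_top) (fun f => by simp)
  rwa [finrank_top, finrank_top] at this

theorem nil_extHom_iff {k k' : Type w} [Field k] [Field k'] (σ : k →+* k') {X : QRep k I} (f : X ⟶ X) :
    Nil (extHom σ f) ↔ Nil f := by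
  have h : ∀ n : ℕ, End.of (extHom σ f) ^ n = extHom σ (End.of f ^ n) := by
    intro n
    induction n with
    | zero => exact (extHom_id σ X).symm
    | succ n ih =>
      rw [pow_succ, ih, pow_succ]
      exact (extHom_comp σ _ _).symm
  refine exists_congr fun n => ?_
  rw [h]
  constructor
  · intro h0
    exact extHom_injective σ (h0.trans (extHom_zero σ).symm)
  · intro h0
    rw [h0]
    exact extHom_zero σ

theorem nil_frobHom {f : ext (algebraMap K Ω) X ⟶ ext (algebraMap K Ω) X} (hf : Nil f) :
    Nil (frobHom X X f) := by
  have h : ∀ n : ℕ, End.of (frobHom X X f) ^ n = frobHom X X (End.of f ^ n) := by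
    intro n
    induction n with
    | zero =>
      have : frobHom X X (𝟙 (ext (algebraMap K Ω) X)) = 𝟙 _ :=
        frobHom_eq_iff.2 ⟨𝟙 X, extHom_id _ X⟩
      exact this.symm
    | succ n ih =>
      rw [pow_succ, ih, pow_succ]
      exact (frobHom_comp _ _).symm
  obtain ⟨n, hn⟩ := hf
  refine ⟨n, ?_⟩
  rw [h, hn]
  exact map_zero (frobHom X X)

/-- Over `Ω` the descent of `o` is the direct sum of the members of the orbit, each once. Its
nilpotent endomorphisms form the subspace `diagRad`, of codimension one for each member. This
subspace is Frobenius stable and descends to the radical over `K`. So the residue field of the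
endomorphism ring has degree `o.card` over `K`. -/
theorem codim_descent [∀ i j : I, Finite (i ⟶ j)] (o : Orb K Ω I) :
    codim o.descent.indec o.descent.rep = o.card := by
  classical
  set Z := o.descent.rep with hZ
  let ι := {z : Ind Ω I // orb K Ω I z = o}
  have : Finite ι := finite_orbit _ o
  let _ := Fintype.ofFinite ι
  let T : ι → QRep Ω I := fun z => z.1.rep
  have hT : ∀ z, Indec (T z) := fun z => z.1.indec
  have hne : ∀ z z', z ≠ z' → ¬ Nonempty (T z ≅ T z') := by
    intro z z' h h'
    refine h (Subtype.ext ?_)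
    rw [← Ind.mk_rep z.1, ← Ind.mk_rep z'.1, Ind.mk_eq_mk_iff]
    exact h'
  obtain ⟨X, ⟨D⟩⟩ := DirSum.exists_dirSum T
  have hX : mult X = mult (ext (algebraMap K Ω) Z) := by
    rw [mult_dirSum D]
    ext z
    rw [← orbMult_apply, orbMult_descent, Finsupp.finsetSum_apply]
    simp_rw [T, mult_rep, Finsupp.single_apply]
    by_cases hz : orb K Ω I z = o
    · rw [if_pos hz.symm, Finset.sum_eq_single ⟨z, hz⟩]
      · simp
      · intro z' _ hz'
        rw [if_neg fun h => hz' (Subtype.ext h)]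
      · intro h
        exact absurd (Finset.mem_univ _) h
    · rw [if_neg fun h => hz h.symm]
      refine Finset.sum_eq_zero fun z' _ => if_neg ?_
      rintro rfl
      exact hz z'.2
  have D' := D.trans (mult_eq_iff.1 hX).some
  have h1 : finrank K (rad o.descent.indec Z) = finrank Ω (diagRad hT D') := by
    refine finrank_eq_of_frob_stable (fun f hf => ?_) fun f => ?_
    · rw [← nil_iff_mem_diagRad hT hne] at hf ⊢
      exact nil_frobHom hf
    · rw [← nil_iff_mem_diagRad hT hne, nil_extHom_iff, mem_rad_self]
  have h2 := codim_add_finrank_rad (X := Z) o.descent.indec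
  have h3 := finrank_diagRad hT D'
  rw [← finrank_ext_hom, ← h1, ← h2, add_comm] at h3
  rw [add_left_cancel h3]
  simp_rw [codim_self_of_isAlgClosed]
  rw [Finset.sum_const, Finset.card_univ, smul_eq_mul, mul_one, ← Nat.card_eq_fintype_card]
  rfl

end frobenius

end QRep
end

/-! ### Counting automorphisms -/

noncomputable section

open CategoryTheory Module

set_option linter.unusedSectionVars false

/-- The proportion of the invertible matrices of size `m` over a field with `Q` elements. -/
def glFrac (Q : ℚ) (m : ℕ) : ℚ := ∏ j ∈ Finset.range m, (1 - (Q ^ (j + 1))⁻¹)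

theorem sum_nilFrac {Q : ℚ} (hQ : 1 < Q) (m : ℕ) :
    ∑ k ∈ Finset.range (m + 1), Plethysm.nilFrac Q k = (glFrac Q m)⁻¹ := by
  have hQ0 : Q ≠ 0 := by positivity
  -- This is the proportion of nilpotent matrices among all matrices of size `m`. With it the sum
  -- over `k`, multiplied by `glFrac`, telescopes to 1.
  have h1 : ∀ m, Plethysm.nilFrac Q m * glFrac Q m = (Q ^ m)⁻¹ := by
    intro m
    induction m with
    | zero => simp [Plethysm.nilFrac_zero, glFrac]
    | succ m ih =>
      have h2 := Plethysm.nilFrac_succ hQ m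
      rw [glFrac, Finset.prod_range_succ, ← glFrac]
      have h3 : 1 - (Q ^ (m + 1))⁻¹ = (Q ^ (m + 1) - 1) * (Q ^ (m + 1))⁻¹ := by
        rw [sub_mul, one_mul, mul_inv_cancel₀ (pow_ne_zero _ hQ0)]
      rw [h3]
      calc Plethysm.nilFrac Q (m + 1) * (glFrac Q m * ((Q ^ (m + 1) - 1) * (Q ^ (m + 1))⁻¹))
          = (Plethysm.nilFrac Q (m + 1) * (Q ^ (m + 1) - 1)) * glFrac Q m * (Q ^ (m + 1))⁻¹ := by ring
        _ = Q ^ m * (Plethysm.nilFrac Q m * glFrac Q m) * (Q ^ (m + 1))⁻¹ := by rw [h2]; ring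
        _ = (Q ^ (m + 1))⁻¹ := by rw [ih, mul_inv_cancel₀ (pow_ne_zero _ hQ0), one_mul]
  refine eq_inv_of_mul_eq_one_left ?_
  induction m with
  | zero => simp [Plethysm.nilFrac_zero, glFrac]
  | succ m ih =>
    rw [Finset.sum_range_succ, add_mul, h1]
    rw [glFrac, Finset.prod_range_succ, ← glFrac, ← mul_assoc, ih]
    ring

namespace Finsupp

theorem sum_Iic_prod {A : Type*} {R : Type*} [CommRing R] [DecidableEq A] (s : A →₀ ℕ) (h : A → ℕ → R)
    (h0 : ∀ a, h a 0 = 1) :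
    ∑ r ∈ Finset.Iic s, r.prod h = s.prod fun a m => ∑ k ∈ Finset.range (m + 1), h a k := by
  have hI : Finset.Iic s = s.support.finsupp fun a => Finset.range (s a + 1) := by
    ext r
    rw [Finset.mem_Iic, Finset.mem_finsupp_iff]
    constructor
    · intro hr
      refine ⟨fun a ha => ?_, fun a _ => Finset.mem_range_succ_iff.2 (hr a)⟩
      rw [mem_support_iff] at ha ⊢
      have := hr a
      omega
    · rintro ⟨h1, h2⟩ a
      by_cases ha : a ∈ s.support
      · exact Finset.mem_range_succ_iff.1 (h2 a ha)
      · have : r a = 0 := by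
          by_contra hne
          exact ha (h1 (mem_support_iff.2 hne))
        rw [this]
        exact Nat.zero_le _
  rw [Finsupp.prod, Finset.prod_sum, hI, Finset.finsupp, Finset.sum_map]
  refine Finset.sum_congr (by congr!) fun p _ => ?_
  rw [Finsupp.prod_of_support_subset (s := s.support) _ _ _ fun a _ => h0 a]
  · rw [← Finset.prod_attach]
    refine Finset.prod_congr rfl fun a _ => ?_
    congr 1
    exact Finsupp.indicator_of_mem a.2 _
  · exact Finsupp.support_indicator_subset _ _

end Finsupp

/-- The relation between an endomorphism and the idempotent of its Fitting decomposition that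
projects to the nilpotent part. -/
def IsFitting {R : Type*} [Ring R] (x e : R) : Prop :=
  e * e = e ∧ x * e = e * x ∧ (∃ n : ℕ, x ^ n * e = 0) ∧ ∃ y, y * x = 1 - e ∧ x * y = 1 - e

/-- A power of `x` kills `e`, while `x` is invertible on `1 - e'`; so `(1 - e') e` and `e (1 - e')`
vanish. By symmetry each of the two idempotents absorbs the other. -/
theorem IsFitting.unique {R : Type*} [Ring R] {x e e' : R} (h : IsFitting x e)
    (h' : IsFitting x e') : e = e' := by
  have key : ∀ {e e' : R}, IsFitting x e → IsFitting x e' → e * e' = e ∧ e' * e = e := by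
    rintro e e' ⟨-, hxe, ⟨n, hn⟩, -⟩ ⟨he', hxe', -, y, hyx, hxy⟩
    have hcomm : Commute x y := hxy.trans hyx.symm
    have hidem : ∀ m : ℕ, m ≠ 0 → (1 - e') ^ m = 1 - e' := by
      have : IsIdempotentElem (1 - e') := IsIdempotentElem.one_sub he'
      intro m hm
      obtain ⟨m, rfl⟩ := Nat.exists_eq_succ_of_ne_zero hm
      exact this.pow_succ_eq m
    have hn' : x ^ (n + 1) * e = 0 := by rw [pow_succ', mul_assoc, hn, mul_zero]
    have hpow : y ^ (n + 1) * x ^ (n + 1) = 1 - e' := by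
      rw [← hcomm.symm.mul_pow, hyx, hidem _ n.succ_ne_zero]
    have hpow' : x ^ (n + 1) * y ^ (n + 1) = 1 - e' := by
      rw [← hcomm.mul_pow, hxy, hidem _ n.succ_ne_zero]
    have hce : Commute (x ^ (n + 1)) e := Commute.pow_left hxe _
    have e1 : (1 - e') * e = 0 := by rw [← hpow, mul_assoc, hn', mul_zero]
    have e2 : e * (1 - e') = 0 := by rw [← hpow', ← mul_assoc, ← hce.eq, hn', zero_mul]
    rw [sub_mul, one_mul, sub_eq_zero] at e1
    rw [mul_sub, mul_one, sub_eq_zero] at e2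
    exact ⟨e2.symm, e1.symm⟩
  rw [← (key h h').1, (key h' h).2]

theorem exists_isFitting (k : Type*) [Field k] {R : Type*} [Ring R] [Algebra k R]
    [FiniteDimensional k R] (x : R) : ∃ e, IsFitting x e := by
  obtain ⟨y, n, hc, he, hn⟩ := exists_idempotent_of_finite k x
  refine ⟨1 - x * y, IsIdempotentElem.one_sub he, ?_, ⟨n, hn⟩, y, ?_, ?_⟩
  · rw [mul_sub, sub_mul, mul_one, one_mul, mul_assoc, hc.eq]
  · rw [sub_sub_cancel, hc.eq]
  · rw [sub_sub_cancel]

namespace QRep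

variable {k : Type w} [Field k] {I : Type u} [Quiver.{v} I] [Finite I] {X Y Z : QRep k I}

section diag

variable {A B A' B' A'' B'' X' X'' : QRep k I} (D : DirSum (fun b => cond b A B) X)
  (D' : DirSum (fun b => cond b A' B') X') (D'' : DirSum (fun b => cond b A'' B'') X'')

namespace DirSum

/-- The inclusion of the first of two summands. -/
def inl : A ⟶ X := D.inc true

/-- The inclusion of the second of two summands. -/
def inr : B ⟶ X := D.inc false

/-- The projection to the first of two summands. -/
def fst : X ⟶ A := D.prj true

/-- The projection to the second of two summands. -/
def snd : X ⟶ B := D.prj false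

@[simp] theorem inl_fst : D.inl ≫ D.fst = 𝟙 A := D.inc_prj true

@[simp] theorem inr_snd : D.inr ≫ D.snd = 𝟙 B := D.inc_prj false

@[simp] theorem inl_snd : D.inl ≫ D.snd = 0 := D.inc_prj_ne true false (by simp)

@[simp] theorem inr_fst : D.inr ≫ D.fst = 0 := D.inc_prj_ne false true (by simp)

@[simp] theorem inl_fst_assoc (f : A ⟶ Y) : D.inl ≫ D.fst ≫ f = f := by
  rw [← Category.assoc, inl_fst, Category.id_comp]

@[simp] theorem inr_snd_assoc (f : B ⟶ Y) : D.inr ≫ D.snd ≫ f = f := by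
  rw [← Category.assoc, inr_snd, Category.id_comp]

@[simp] theorem inl_snd_assoc (f : B ⟶ Y) : D.inl ≫ D.snd ≫ f = 0 := by
  rw [← Category.assoc, inl_snd, Limits.zero_comp]

@[simp] theorem inr_fst_assoc (f : A ⟶ Y) : D.inr ≫ D.fst ≫ f = 0 := by
  rw [← Category.assoc, inr_fst, Limits.zero_comp]

theorem fst_inl_add : D.fst ≫ D.inl + D.snd ≫ D.inr = 𝟙 X := by
  rw [← D.sum, Fintype.sum_bool]
  rfl

theorem hom_ext_bool {f g : X ⟶ Y} (h : D.inl ≫ f = D.inl ≫ g) (h' : D.inr ≫ f = D.inr ≫ g) :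
    f = g :=
  D.hom_ext_left (by
    rintro (_ | _)
    · exact h'
    · exact h)

/-- The diagonal homomorphism between two direct sums. -/
def diag (α : A ⟶ A') (β : B ⟶ B') : X ⟶ X' := D.fst ≫ α ≫ D'.inl + D.snd ≫ β ≫ D'.inr

variable {D D' D''}

@[simp] theorem inl_diag (α : A ⟶ A') (β : B ⟶ B') : D.inl ≫ diag D D' α β = α ≫ D'.inl := by
  rw [diag, Preadditive.comp_add]; simp

@[simp] theorem inr_diag (α : A ⟶ A') (β : B ⟶ B') : D.inr ≫ diag D D' α β = β ≫ D'.inr := by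
  rw [diag, Preadditive.comp_add]; simp

@[simp] theorem diag_fst (α : A ⟶ A') (β : B ⟶ B') : diag D D' α β ≫ D'.fst = D.fst ≫ α := by
  rw [diag, Preadditive.add_comp]; simp

@[simp] theorem diag_snd (α : A ⟶ A') (β : B ⟶ B') : diag D D' α β ≫ D'.snd = D.snd ≫ β := by
  rw [diag, Preadditive.add_comp]; simp

theorem diag_comp (α : A ⟶ A') (β : B ⟶ B') (α' : A' ⟶ A'') (β' : B' ⟶ B'') :
    diag D D' α β ≫ diag D' D'' α' β' = diag D D'' (α ≫ α') (β ≫ β') := by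
  apply D.hom_ext_bool
  · rw [← Category.assoc, inl_diag, Category.assoc, inl_diag, inl_diag, Category.assoc]
  · rw [← Category.assoc, inr_diag, Category.assoc, inr_diag, inr_diag, Category.assoc]

theorem diag_id : diag D D (𝟙 A) (𝟙 B) = 𝟙 X := by
  rw [diag, Category.id_comp, Category.id_comp, D.fst_inl_add]

theorem isIso_diag (α : A ⟶ A') (β : B ⟶ B') [IsIso α] [IsIso β] : IsIso (diag D D' α β) :=
  ⟨diag D' D (inv α) (inv β), by rw [diag_comp, IsIso.hom_inv_id, IsIso.hom_inv_id, diag_id],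
    by rw [diag_comp, IsIso.inv_hom_id, IsIso.inv_hom_id, diag_id]⟩

theorem diag_injective {α α₁ : A ⟶ A'} {β β₁ : B ⟶ B'} (h : diag D D' α β = diag D D' α₁ β₁) :
    α = α₁ ∧ β = β₁ := by
  constructor
  · have := congrArg (fun f => D.inl ≫ f ≫ D'.fst) h
    simpa using this
  · have := congrArg (fun f => D.inr ≫ f ≫ D'.snd) h
    simpa using this

variable (D D') in
theorem exists_diag_of_comm {f : X ⟶ X'} (h : (D.fst ≫ D.inl) ≫ f = f ≫ D'.fst ≫ D'.inl) :
    f = diag D D' (D.inl ≫ f ≫ D'.fst) (D.inr ≫ f ≫ D'.snd) := by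
  have h1 : D.inl ≫ f = D.inl ≫ f ≫ D'.fst ≫ D'.inl := by
    rw [← h]; simp
  have h2 : D.inr ≫ f = D.inr ≫ f ≫ D'.snd ≫ D'.inr := by
    have h3 : D.inr ≫ f ≫ D'.fst ≫ D'.inl = 0 := by rw [← h]; simp
    have h4 : D.inr ≫ f ≫ (D'.fst ≫ D'.inl + D'.snd ≫ D'.inr) = D.inr ≫ f := by
      rw [D'.fst_inl_add, Category.comp_id]
    rw [Preadditive.comp_add, Preadditive.comp_add, h3, zero_add] at h4
    exact h4.symm
  apply D.hom_ext_bool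
  · rw [inl_diag, Category.assoc, Category.assoc, ← h1]
  · rw [inr_diag, Category.assoc, Category.assoc, ← h2]

end DirSum

end diag

/-- The number of automorphisms. -/
def autCard (X : QRep k I) : ℕ := Nat.card {f : X ⟶ X // IsIso f}

/-- The number of nilpotent endomorphisms. -/
def nilCard (X : QRep k I) : ℕ := Nat.card {f : X ⟶ X // Nil f}

theorem card_isIso_of_iso (e : X ≅ Y) : Nat.card {f : X ⟶ Y // IsIso f} = autCard X := by
  refine Nat.card_congr
    { toFun := fun f => ⟨f.1 ≫ e.inv, ?_⟩
      invFun := fun f => ⟨f.1 ≫ e.hom, ?_⟩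
      left_inv := fun f => Subtype.ext (by simp)
      right_inv := fun f => Subtype.ext (by simp) }
  · have := f.2; infer_instance
  · have := f.2; infer_instance

theorem autCard_iso (e : X ≅ Y) : autCard X = autCard Y := by
  rw [← card_isIso_of_iso e]
  refine Nat.card_congr
    { toFun := fun f => ⟨e.inv ≫ f.1, ?_⟩
      invFun := fun f => ⟨e.hom ≫ f.1, ?_⟩
      left_inv := fun f => Subtype.ext (by simp)
      right_inv := fun f => Subtype.ext (by simp) }
  · have := f.2; infer_instance
  · have := f.2; infer_instance

theorem nilCard_iso (e : X ≅ Y) : nilCard X = nilCard Y := by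
  have key : ∀ {X Y : QRep k I} (e : X ≅ Y) {f : X ⟶ X}, Nil f → Nil (e.inv ≫ f ≫ e.hom) := by
    intro X Y e f hf
    have h : f = (f ≫ e.hom) ≫ e.inv := by simp
    rw [h] at hf
    exact hf.comm
  exact Nat.card_congr
    { toFun := fun f => ⟨e.inv ≫ f.1 ≫ e.hom, key e f.2⟩
      invFun := fun f => ⟨e.hom ≫ f.1 ≫ e.inv, key e.symm f.2⟩
      left_inv := fun f => Subtype.ext (by simp)
      right_inv := fun f => Subtype.ext (by simp) }

variable [Finite k]

theorem finite_hom (X Y : QRep k I) : Finite (X ⟶ Y) := Module.finite_of_finite k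

attribute [local instance] finite_hom

theorem autCard_pos (X : QRep k I) : 0 < autCard X :=
  have : Nonempty {f : X ⟶ X // IsIso f} := ⟨⟨𝟙 X, inferInstance⟩⟩
  Nat.card_pos

/-- The automorphisms of `X` act transitively on the split monomorphisms `z.rep ⟶ X`, because by
Krull–Schmidt all complements are isomorphic to `Y`. The stabiliser of the inclusion consists of the
triangular matrices `M h u` with `u` an automorphism of `Y`. -/
theorem autCard_dirSum (z : Ind k I) (D : DirSum (fun b => cond b z.rep Y) X) :
    autCard X = Nat.card {f : z.rep ⟶ X // f ∉ rad z.indec X} * (Nat.card (Y ⟶ z.rep) * autCard Y) := by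
  have hex : ∀ f : {f : z.rep ⟶ X // f ∉ rad z.indec X}, ∃ θ : X ⟶ X, IsIso θ ∧ D.inl ≫ θ = f.1 := by
    rintro ⟨f, hf⟩
    rw [mem_rad] at hf
    push Not at hf
    obtain ⟨g, hg⟩ := hf
    obtain ⟨g', hfg⟩ : ∃ g', f ≫ g' = 𝟙 z.rep :=
      ⟨g ≫ inv (f ≫ g), by rw [← Category.assoc, IsIso.hom_inv_id]⟩
    have he : (𝟙 X - g' ≫ f) ≫ (𝟙 X - g' ≫ f) = 𝟙 X - g' ≫ f := by
      have : (g' ≫ f) ≫ (g' ≫ f) = g' ≫ f := by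
        rw [Category.assoc, ← Category.assoc f, hfg, Category.id_comp]
      rw [Preadditive.sub_comp, Preadditive.comp_sub, Preadditive.comp_sub, this]
      simp
    obtain ⟨B, i, p, h1, h2⟩ := exists_split he
    have h3 : f ≫ p = 0 := by
      have : f ≫ p = (f ≫ p ≫ i) ≫ p := by rw [Category.assoc, Category.assoc, h1, Category.comp_id]
      rw [this, h2, Preadditive.comp_sub, ← Category.assoc f, hfg]
      simp
    have h4 : i ≫ g' = 0 := by
      have : i ≫ g' = i ≫ (p ≫ i) ≫ g' := by rw [Category.assoc, ← Category.assoc, h1, Category.id_comp]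
      rw [this, h2, Preadditive.sub_comp, Category.assoc, hfg]
      simp
    let D' : DirSum (fun b => cond b z.rep B) X := DirSum.binary hfg h1 h3 h4 (by rw [h2]; simp)
    have hB : mult Y = mult B := by
      have e1 := mult_dirSum D
      rw [mult_dirSum D', Fintype.sum_bool, Fintype.sum_bool] at e1
      exact (add_left_cancel e1).symm
    obtain ⟨e⟩ := mult_eq_iff.1 hB
    refine ⟨DirSum.diag D D' (𝟙 z.rep) e.hom, DirSum.isIso_diag _ _, ?_⟩
    rw [DirSum.inl_diag, Category.id_comp]
    rfl
  choose θ hθ hθf using hex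
  let M : (Y ⟶ z.rep) → (Y ⟶ Y) → (X ⟶ X) := fun h u =>
    D.fst ≫ D.inl + D.snd ≫ (h ≫ D.inl + u ≫ D.inr)
  have hMl : ∀ h u, D.inl ≫ M h u = D.inl := fun h u => by
    simp only [M, Preadditive.comp_add]; simp
  have hMr : ∀ h u, D.inr ≫ M h u = h ≫ D.inl + u ≫ D.inr := fun h u => by
    simp only [M, Preadditive.comp_add]; simp
  have hMM : ∀ h u h' u', M h u ≫ M h' u' = M (h + u ≫ h') (u ≫ u') := by
    intro h u h' u'
    apply D.hom_ext_bool
    · rw [← Category.assoc, hMl, hMl, hMl]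
    · rw [← Category.assoc, hMr, hMr, Preadditive.add_comp, Category.assoc, Category.assoc, hMl, hMr,
        Preadditive.comp_add, Preadditive.add_comp, Category.assoc, Category.assoc, add_assoc]
  have hM1 : M 0 (𝟙 Y) = 𝟙 X := by
    simp only [M, Limits.zero_comp, zero_add, Category.id_comp, D.fst_inl_add]
  have hMiso : ∀ h u, IsIso u → IsIso (M h u) := by
    intro h u hu
    refine ⟨M (-(inv u ≫ h)) (inv u), ?_, ?_⟩
    · rw [hMM, IsIso.hom_inv_id, Preadditive.comp_neg, IsIso.hom_inv_id_assoc, add_neg_cancel, hM1]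
    · rw [hMM, IsIso.inv_hom_id, neg_add_cancel, hM1]
  let Φ : {f : z.rep ⟶ X // f ∉ rad z.indec X} × ((Y ⟶ z.rep) × {u : Y ⟶ Y // IsIso u}) →
      {θ : X ⟶ X // IsIso θ} := fun x =>
    ⟨M x.2.1 x.2.2.1 ≫ θ x.1, by
      have := hMiso x.2.1 _ x.2.2.2
      have := hθ x.1
      infer_instance⟩
  have hΦ : Function.Bijective Φ := by
    constructor
    · rintro ⟨f, h, u, hu⟩ ⟨f', h', u', hu'⟩ hh
      have hh : M h u ≫ θ f = M h' u' ≫ θ f' := congrArg Subtype.val hh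
      have hf : f = f' := by
        apply Subtype.ext
        have h1 := congrArg (D.inl ≫ ·) hh
        simp only [← Category.assoc, hMl, hθf] at h1
        exact h1
      subst hf
      have := hθ f
      have hMe := (cancel_mono (θ f)).1 hh
      have h1 := congrArg (fun t => D.inr ≫ t ≫ D.fst) hMe
      have h2 := congrArg (fun t => D.inr ≫ t ≫ D.snd) hMe
      simp only [← Category.assoc, hMr, Preadditive.add_comp] at h1 h2
      simp only [Category.assoc, DirSum.inl_fst, DirSum.inr_fst, DirSum.inl_snd, DirSum.inr_snd,
        Limits.comp_zero, add_zero, zero_add, Category.comp_id] at h1 h2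
      subst h1 h2
      rfl
    · rintro ⟨ψ, hψ⟩
      have hf : D.inl ≫ ψ ∉ rad z.indec X := fun hr => hr (inv ψ ≫ D.fst) (by
        rw [Category.assoc, IsIso.hom_inv_id_assoc, DirSum.inl_fst]
        infer_instance)
      have := hθ ⟨_, hf⟩
      let ρ := ψ ≫ inv (θ ⟨_, hf⟩)
      have hρ : IsIso ρ := inferInstance
      have hρl : D.inl ≫ ρ = D.inl := by
        change D.inl ≫ ψ ≫ inv (θ ⟨_, hf⟩) = _
        rw [← Category.assoc, IsIso.comp_inv_eq, hθf]
      have hρl' : D.inl ≫ inv ρ = D.inl := by rw [IsIso.comp_inv_eq, hρl]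
      have key : ∀ a b : X ⟶ X, D.inl ≫ b = D.inl →
          (D.inr ≫ a ≫ D.snd) ≫ (D.inr ≫ b ≫ D.snd) = D.inr ≫ (a ≫ b) ≫ D.snd := by
        intro a b hb
        have h1 : a ≫ b = a ≫ (D.fst ≫ D.inl + D.snd ≫ D.inr) ≫ b := by
          rw [D.fst_inl_add, Category.id_comp]
        rw [h1]
        simp only [Preadditive.add_comp, Preadditive.comp_add, Category.assoc]
        have h2 : D.inl ≫ b ≫ D.snd = 0 := by rw [← Category.assoc, hb, DirSum.inl_snd]
        rw [h2]
        simp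
      have hu : IsIso (D.inr ≫ ρ ≫ D.snd) :=
        ⟨D.inr ≫ inv ρ ≫ D.snd, by rw [key _ _ hρl', IsIso.hom_inv_id]; simp,
          by rw [key _ _ hρl, IsIso.inv_hom_id]; simp⟩
      refine ⟨⟨⟨_, hf⟩, D.inr ≫ ρ ≫ D.fst, ⟨D.inr ≫ ρ ≫ D.snd, hu⟩⟩, Subtype.ext ?_⟩
      change M (D.inr ≫ ρ ≫ D.fst) (D.inr ≫ ρ ≫ D.snd) ≫ θ ⟨_, hf⟩ = ψ
      have hM : M (D.inr ≫ ρ ≫ D.fst) (D.inr ≫ ρ ≫ D.snd) = ρ := by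
        apply D.hom_ext_bool
        · rw [hMl, hρl]
        · rw [hMr]
          simp only [Category.assoc]
          rw [← Preadditive.comp_add, ← Preadditive.comp_add, D.fst_inl_add, Category.comp_id]
      rw [hM]
      simp [ρ]
  rw [autCard, ← Nat.card_congr (Equiv.ofBijective Φ hΦ), Nat.card_prod, Nat.card_prod]
  rfl

theorem endCard_dirSum {A B : QRep k I} (D : DirSum (fun b => cond b A B) X) :
    Nat.card (X ⟶ X) = Nat.card (A ⟶ X) * (Nat.card (B ⟶ A) * Nat.card (B ⟶ B)) := by
  have e1 : ∀ Z : QRep k I, Nat.card (X ⟶ Z) = Nat.card (A ⟶ Z) * Nat.card (B ⟶ Z) := by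
    intro Z
    rw [Nat.card_congr (D.homEquiv' Z).toEquiv, Nat.card_pi, Fintype.prod_bool]
    rfl
  have e2 : ∀ Z : QRep k I, Nat.card (Z ⟶ X) = Nat.card (Z ⟶ A) * Nat.card (Z ⟶ B) := by
    intro Z
    rw [Nat.card_congr (D.homEquiv Z).toEquiv, Nat.card_pi, Fintype.prod_bool]
    rfl
  rw [e1, e2 B]

/-- The size of the residue field of the endomorphism ring of an indecomposable representation. -/
def resCard (z : Ind k I) : ℕ := Nat.card k ^ codim z.indec z.rep

theorem one_lt_resCard (z : Ind k I) : (1 : ℚ) < resCard z := by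
  exact_mod_cast Nat.one_lt_pow (codim_pos z.indec).ne' Finite.one_lt_card

theorem card_notMem_rad (z : Ind k I) (X : QRep k I) :
    (Nat.card {f : z.rep ⟶ X // f ∉ rad z.indec X} : ℚ) =
      Nat.card (z.rep ⟶ X) * (1 - ((resCard z : ℚ) ^ mult X z)⁻¹) := by
  have h1 : Nat.card (z.rep ⟶ X) = Nat.card (rad z.indec X) * resCard z ^ mult X z := by
    rw [Submodule.card_eq_card_quotient_mul_card (rad z.indec X),
      Module.natCard_eq_pow_finrank (K := k) (V := (z.rep ⟶ X) ⧸ rad z.indec X), resCard, ← pow_mul,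
      mul_comm (codim _ _), ← codim_eq_mult_mul, codim, mul_comm]
  have h2 : Nat.card {f : z.rep ⟶ X // f ∉ rad z.indec X} + Nat.card (rad z.indec X) =
      Nat.card (z.rep ⟶ X) := by
    classical
    rw [← Nat.card_sum]
    exact Nat.card_congr ((Equiv.sumComm _ _).trans
      (Equiv.sumCompl fun f : z.rep ⟶ X => f ∈ rad z.indec X))
  have h3 : ((resCard z : ℚ) ^ mult X z) ≠ 0 :=
    pow_ne_zero _ (by have := one_lt_resCard z; positivity)
  have h4 : (Nat.card {f : z.rep ⟶ X // f ∉ rad z.indec X} : ℚ) =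
      Nat.card (z.rep ⟶ X) - Nat.card (rad z.indec X) := by
    rw [← h2]; push_cast; ring
  have h5 : (Nat.card (z.rep ⟶ X) : ℚ) = Nat.card (rad z.indec X) * (resCard z : ℚ) ^ mult X z := by
    rw [h1]; push_cast; ring
  rw [h4, mul_sub, mul_one, h5, mul_assoc, mul_inv_cancel₀ h3, mul_one]

/-- Splitting off one copy of `z` multiplies the proportion by that of the split monomorphisms among
all homomorphisms `z.rep ⟶ X`, which is `1 - Q ^ (-m)` with `Q` the size of the residue field and
`m` the multiplicity of `z`. -/
theorem autCard_div_endCard (X : QRep k I) : (autCard X : ℚ) / Nat.card (X ⟶ X) =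
    (mult X).prod fun z m => glFrac (resCard z) m := by
  classical
  induction hn : (mult X).degree using Nat.strong_induction_on generalizing X with
  | _ n ih =>
  by_cases h0 : mult X = 0
  · rw [h0, Finsupp.prod_zero_index]
    rw [mult_eq_zero_iff] at h0
    have hsub : Subsingleton (X ⟶ X) := ⟨fun f g => by
      rw [← Category.comp_id f, ← Category.comp_id g, h0]; simp⟩
    have : autCard X = Nat.card (X ⟶ X) := by
      refine Nat.card_congr (Equiv.subtypeUnivEquiv fun f => ?_)
      rw [Subsingleton.elim f (𝟙 X)]
      infer_instance
    rw [this, div_self]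
    exact_mod_cast Nat.card_pos.ne'
  obtain ⟨z, hz⟩ := Finsupp.ne_iff.1 h0
  obtain ⟨Y, hY, ⟨D⟩⟩ := exists_dirSum_of_mult_pos (Nat.pos_of_ne_zero hz)
  have hd : (mult Y).degree < n := by
    rw [← hn, hY, map_add, Finsupp.degree_single]
    omega
  have hY' := ih _ hd Y rfl
  have hpos : ∀ A B : QRep k I, (Nat.card (A ⟶ B) : ℚ) ≠ 0 := fun A B => by
    exact_mod_cast Nat.card_pos.ne'
  have h1 : (autCard X : ℚ) / Nat.card (X ⟶ X) = (1 - ((resCard z : ℚ) ^ mult X z)⁻¹) *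
      ((autCard Y : ℚ) / Nat.card (Y ⟶ Y)) := by
    rw [autCard_dirSum z D, endCard_dirSum D]
    push_cast
    rw [card_notMem_rad]
    have a1 := hpos z.rep X
    have a2 := hpos Y z.rep
    have a3 := hpos Y Y
    field_simp
  rw [h1, hY']
  have h00 : ∀ z : Ind k I, glFrac (resCard z) 0 = 1 := fun z => by simp [glFrac]
  have hsub : (mult Y).support ⊆ (mult X).support := by
    intro a ha
    rw [Finsupp.mem_support_iff] at ha ⊢
    rw [hY, Finsupp.add_apply]
    omega
  have hzm : z ∈ (mult X).support := Finsupp.mem_support_iff.2 hz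
  rw [Finsupp.prod_of_support_subset _ hsub _ fun z _ => h00 z, Finsupp.prod,
    ← Finset.mul_prod_erase _ _ hzm, ← Finset.mul_prod_erase _ _ hzm, ← mul_assoc]
  congr 1
  · have : mult X z = mult Y z + 1 := by rw [hY, Finsupp.add_apply, Finsupp.single_eq_same, add_comm]
    rw [this, glFrac, glFrac, Finset.prod_range_succ, mul_comm]
  · refine Finset.prod_congr rfl fun a ha => ?_
    rw [hY, Finsupp.add_apply, Finsupp.single_eq_of_ne (Finset.ne_of_mem_erase ha), zero_add]

end QRep
end

/-! ### Counting nilpotent endomorphisms -/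

noncomputable section

open CategoryTheory Module

set_option linter.unusedSectionVars false

namespace QRep

variable {k : Type w} [Field k] {I : Type u} [Quiver.{v} I] [Finite I] {X Y Z : QRep k I}

theorem exists_dirSum_of_idem {e : X ⟶ X} (he : e ≫ e = e) : ∃ (A B : QRep k I)
    (D : DirSum (fun b => cond b A B) X), D.fst ≫ D.inl = e := by
  obtain ⟨A, B, i, p, i', p', h1, h2, h3, h4, h5, h6⟩ := exists_binary he
  exact ⟨A, B, DirSum.binary h1 h2 h3 h4 (by rw [h5, h6]; simp), h5⟩

namespace DirSum

variable {A B : QRep k I} (D : DirSum (fun b => cond b A B) X)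

theorem of_diag_pow (ν : A ⟶ A) (u : B ⟶ B) (n : ℕ) :
    End.of (diag D D ν u) ^ n = diag D D (End.of ν ^ n).asHom (End.of u ^ n).asHom := by
  induction n with
  | zero => exact (diag_id (D := D)).symm
  | succ n ih =>
    rw [pow_succ, ih, pow_succ, pow_succ]
    exact diag_comp _ _ _ _

theorem diag_one_zero : diag D D (𝟙 A) (0 : B ⟶ B) = D.fst ≫ D.inl := by
  rw [diag]; simp

theorem diag_zero_one : diag D D (0 : A ⟶ A) (𝟙 B) = 𝟙 X - D.fst ≫ D.inl := by
  rw [eq_sub_iff_add_eq, add_comm, ← D.fst_inl_add, diag]; simp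

theorem diag_zero_zero : diag D D (0 : A ⟶ A) (0 : B ⟶ B) = 0 := by
  rw [diag]; simp

/-- This turns the unique Fitting idempotent of an endomorphism into a block decomposition. -/
theorem isFitting_diag_iff {ν : A ⟶ A} {u : B ⟶ B} :
    IsFitting (End.of (diag D D ν u)) (End.of (D.fst ≫ D.inl)) ↔ Nil ν ∧ IsIso u := by
  have hpow : ∀ n : ℕ, End.of (diag D D ν u) ^ n * End.of (D.fst ≫ D.inl) =
      diag D D (End.of ν ^ n).asHom 0 := by
    intro n
    rw [of_diag_pow, ← diag_one_zero]
    refine (diag_comp _ _ _ _).trans ?_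
    rw [Category.id_comp, Limits.zero_comp]
  constructor
  · rintro ⟨-, -, ⟨n, hn⟩, y, hyx, hxy⟩
    refine ⟨⟨n, ?_⟩, D.inr ≫ y ≫ D.snd, ?_, ?_⟩
    · rw [hpow] at hn
      exact (diag_injective (hn.trans D.diag_zero_zero.symm)).1
    · have h : diag D D ν u ≫ y = 𝟙 X - D.fst ≫ D.inl := hyx
      have h1 := congrArg (fun f => D.inr ≫ f ≫ D.snd) h
      rw [← diag_zero_one] at h1
      simpa only [← Category.assoc, inr_diag, diag_snd, Category.comp_id, Category.id_comp, inr_snd]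
        using h1
    · have h : y ≫ diag D D ν u = 𝟙 X - D.fst ≫ D.inl := hxy
      have h1 := congrArg (fun f => D.inr ≫ f ≫ D.snd) h
      rw [← diag_zero_one] at h1
      simpa only [Category.assoc, inr_diag, diag_snd, Category.comp_id, Category.id_comp, inr_snd]
        using h1
  · rintro ⟨⟨n, hn⟩, hu⟩
    refine ⟨?_, ?_, ⟨n, ?_⟩, End.of (diag D D 0 (inv u)), ?_, ?_⟩
    · change (D.fst ≫ D.inl) ≫ D.fst ≫ D.inl = D.fst ≫ D.inl
      simp
    · rw [← diag_one_zero]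
      refine (diag_comp _ _ _ _).trans (Eq.trans ?_ (diag_comp _ _ _ _).symm)
      rw [Category.id_comp, Category.comp_id, Limits.zero_comp, Limits.comp_zero]
    · rw [hpow, hn]
      exact D.diag_zero_zero
    · refine (diag_comp _ _ _ _).trans ?_
      rw [Limits.comp_zero, IsIso.hom_inv_id]
      exact D.diag_zero_one
    · refine (diag_comp _ _ _ _).trans ?_
      rw [Limits.zero_comp, IsIso.inv_hom_id]
      exact D.diag_zero_one

end DirSum

/-- A representation with given multiplicities of the indecomposable summands. -/
def obj (s : Ind k I →₀ ℕ) : QRep k I := (exists_mult_eq s).choose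

theorem mult_obj (s : Ind k I →₀ ℕ) : mult (obj s) = s := (exists_mult_eq s).choose_spec

variable [Finite k]

attribute [local instance] finite_hom

theorem endCard_div_autCard (X : QRep k I) : (Nat.card (X ⟶ X) : ℚ) / autCard X =
    (mult X).prod fun z m => (glFrac (resCard z) m)⁻¹ := by
  rw [← inv_div, autCard_div_endCard, Finsupp.prod, Finsupp.prod, Finset.prod_inv_distrib]

-- Each endomorphism is, for a unique idempotent `e`, nilpotent on the image of `e` and invertible
-- on that of `1 - e`. The idempotents whose image has multiplicities `r` form one conjugacy class
-- under the automorphisms, with stabiliser the product of the automorphism groups of the two parts.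
open scoped Classical in
theorem endCard_div_autCard_eq_sum (X : QRep k I) : (Nat.card (X ⟶ X) : ℚ) / autCard X =
    ∑ r ∈ Finset.Iic (mult X), (nilCard (obj r) : ℚ) / autCard (obj r) := by
  let E := {e : X ⟶ X // e ≫ e = e}
  let _ : Fintype E := Fintype.ofFinite E
  choose A B D hD using fun e : E => exists_dirSum_of_idem e.2
  have hAB : ∀ e, mult X = mult (A e) + mult (B e) := fun e => by
    rw [mult_dirSum (D e), Fintype.sum_bool]
    rfl
  let Ψ : (Σ e : E, {ν : A e ⟶ A e // Nil ν} × {t : B e ⟶ B e // IsIso t}) → (X ⟶ X) :=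
    fun x => DirSum.diag (D x.1) (D x.1) x.2.1.1 x.2.2.1
  have hΨ : Function.Bijective Ψ := by
    constructor
    · rintro ⟨e, ⟨ν, hν⟩, ⟨t, ht⟩⟩ ⟨e', ⟨ν', hν'⟩, ⟨t', ht'⟩⟩ h
      change DirSum.diag (D e) (D e) ν t = DirSum.diag (D e') (D e') ν' t' at h
      have h1 := ((D e).isFitting_diag_iff).2 ⟨hν, ht⟩
      have h2 := ((D e').isFitting_diag_iff).2 ⟨hν', ht'⟩
      rw [hD] at h1 h2
      rw [h] at h1
      have he : e = e' := Subtype.ext (h1.unique h2)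
      subst he
      obtain ⟨rfl, rfl⟩ := DirSum.diag_injective h
      rfl
    · intro x
      obtain ⟨e, he⟩ := exists_isFitting k (End.of x)
      let e' : E := ⟨e, he.1⟩
      have hx : x = DirSum.diag (D e') (D e') _ _ := DirSum.exists_diag_of_comm (D e') (D e') (by
        rw [hD]
        exact he.2.1)
      have he' : IsFitting (End.of x) (End.of ((D e').fst ≫ (D e').inl)) := by
        rw [hD]
        exact he
      rw [hx, DirSum.isFitting_diag_iff] at he'
      exact ⟨⟨e', ⟨_, he'.1⟩, ⟨_, he'.2⟩⟩, hx.symm⟩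
  -- Fitting decompositions count all endomorphisms.
  have h1 : Nat.card (X ⟶ X) = ∑ e, nilCard (A e) * autCard (B e) := by
    rw [← Nat.card_congr (Equiv.ofBijective Ψ hΨ), Nat.card_sigma]
    exact Finset.sum_congr rfl fun e _ => Nat.card_prod _ _
  -- The isomorphisms from a fixed direct sum `W` to `X` are counted by the idempotent of `X` to
  -- which they carry the first projection of `W`.
  have h2 : ∀ r ∈ Finset.Iic (mult X), Nat.card {e : E // mult (A e) = r} *
      (autCard (obj r) * autCard (obj (mult X - r))) = autCard X := by
    intro r hr
    rw [Finset.mem_Iic] at hr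
    obtain ⟨W, ⟨DW⟩⟩ := DirSum.exists_dirSum (fun b => cond b (obj r) (obj (mult X - r)))
    have hW : mult W = mult X := by
      rw [mult_dirSum DW, Fintype.sum_bool]
      change mult (obj r) + mult (obj (mult X - r)) = _
      rw [mult_obj, mult_obj, add_tsub_cancel_of_le hr]
    let Θ : (Σ e : {e : E // mult (A e) = r}, {α : obj r ⟶ A e.1 // IsIso α} ×
        {β : obj (mult X - r) ⟶ B e.1 // IsIso β}) → {θ : W ⟶ X // IsIso θ} :=
      fun x => ⟨DirSum.diag DW (D x.1.1) x.2.1.1 x.2.2.1, by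
        have := x.2.1.2
        have := x.2.2.2
        exact DirSum.isIso_diag _ _⟩
    have hΘ : Function.Bijective Θ := by
      constructor
      · rintro ⟨⟨e, he⟩, ⟨α, hα⟩, ⟨β, hβ⟩⟩ ⟨⟨e', he'⟩, ⟨α', hα'⟩, ⟨β', hβ'⟩⟩ h
        have h : DirSum.diag DW (D e) α β = DirSum.diag DW (D e') α' β' := congrArg Subtype.val h
        have key : ∀ (e : E) (α : obj r ⟶ A e) (β : obj (mult X - r) ⟶ B e),
            DirSum.diag DW (D e) α β ≫ e.1 = (DW.fst ≫ DW.inl) ≫ DirSum.diag DW (D e) α β := by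
          intro e α β
          rw [← hD e]
          simp only [← Category.assoc, DirSum.diag_fst]
          simp only [Category.assoc, DirSum.inl_diag]
        have hee : e = e' := by
          apply Subtype.ext
          have h1 := key e α β
          rw [h, ← key] at h1
          have : IsIso (DirSum.diag DW (D e') α' β') := DirSum.isIso_diag _ _
          exact (cancel_epi _).1 h1
        subst hee
        obtain ⟨rfl, rfl⟩ := DirSum.diag_injective h
        rfl
      · rintro ⟨θ, hθ⟩
        let e : E := ⟨inv θ ≫ (DW.fst ≫ DW.inl) ≫ θ, by simp⟩
        have he : (DW.fst ≫ DW.inl) ≫ θ = θ ≫ (D e).fst ≫ (D e).inl := by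
          rw [hD]
          simp [e]
        have he' : ((D e).fst ≫ (D e).inl) ≫ inv θ = inv θ ≫ DW.fst ≫ DW.inl := by
          rw [hD]
          simp [e]
        have hd := DirSum.exists_diag_of_comm DW (D e) he
        have hd' := DirSum.exists_diag_of_comm (D e) DW he'
        set α := DW.inl ≫ θ ≫ (D e).fst
        set β := DW.inr ≫ θ ≫ (D e).snd
        set α' := (D e).inl ≫ inv θ ≫ DW.fst
        set β' := (D e).inr ≫ inv θ ≫ DW.snd
        have e1 : θ ≫ inv θ = 𝟙 W := IsIso.hom_inv_id θ
        have e2 : inv θ ≫ θ = 𝟙 X := IsIso.inv_hom_id θ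
        rw [hd', hd, DirSum.diag_comp, ← DirSum.diag_id (D := D e)] at e2
        rw [hd', hd, DirSum.diag_comp, ← DirSum.diag_id (D := DW)] at e1
        obtain ⟨a1, b1⟩ := DirSum.diag_injective e1
        obtain ⟨a2, b2⟩ := DirSum.diag_injective e2
        have hα : IsIso α := ⟨α', a1, a2⟩
        have hβ : IsIso β := ⟨β', b1, b2⟩
        have hAe : mult (A e) = r := by
          rw [← mult_iso (asIso α), mult_obj]
        exact ⟨⟨⟨e, hAe⟩, ⟨α, hα⟩, ⟨β, hβ⟩⟩, Subtype.ext hd.symm⟩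
    have h3 := Nat.card_congr (Equiv.ofBijective Θ hΘ)
    rw [card_sigma_const (autCard (obj r) * autCard (obj (mult X - r))),
      card_isIso_of_iso (mult_eq_iff.1 hW).some, autCard_iso (mult_eq_iff.1 hW).some] at h3
    · exact h3
    · rintro ⟨e, he⟩
      have hA : mult (obj r) = mult (A e) := by rw [mult_obj, he]
      have hB : mult (obj (mult X - r)) = mult (B e) := by
        rw [mult_obj, hAB e, ← he, add_tsub_cancel_left]
      rw [Nat.card_prod, card_isIso_of_iso (mult_eq_iff.1 hA).some,
        card_isIso_of_iso (mult_eq_iff.1 hB).some]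
  have h3 : ∀ e, mult (A e) ∈ Finset.Iic (mult X) := fun e => by
    rw [Finset.mem_Iic, hAB e]
    exact le_self_add
  have hX : (autCard X : ℚ) ≠ 0 := by exact_mod_cast (autCard_pos X).ne'
  rw [div_eq_iff hX, Finset.sum_mul, h1, ← Finset.sum_fiberwise_of_maps_to (fun e _ => h3 e),
    Nat.cast_sum]
  refine Finset.sum_congr rfl fun r hr => ?_
  have h4 : ∀ e ∈ Finset.univ.filter (fun e => mult (A e) = r),
      nilCard (A e) * autCard (B e) = nilCard (obj r) * autCard (obj (mult X - r)) := by
    intro e he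
    have he : mult (A e) = r := (Finset.mem_filter.1 he).2
    have hA : mult (A e) = mult (obj r) := by rw [mult_obj, he]
    have hB : mult (B e) = mult (obj (mult X - r)) := by
      rw [mult_obj, hAB e, ← he, add_tsub_cancel_left]
    rw [nilCard_iso (mult_eq_iff.1 hA).some, autCard_iso (mult_eq_iff.1 hB).some]
  rw [Finset.sum_congr rfl h4, Finset.sum_const, ← Fintype.card_subtype, ← Nat.card_eq_fintype_card,
    ← h2 r hr]
  have h5 : (autCard (obj r) : ℚ) ≠ 0 := by exact_mod_cast (autCard_pos _).ne'
  push_cast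
  rw [smul_eq_mul]
  push_cast
  field_simp

/-- The proportion of nilpotent endomorphisms among automorphisms. -/
theorem nilCard_div_autCard (X : QRep k I) : (nilCard X : ℚ) / autCard X =
    (mult X).prod fun z m => Plethysm.nilFrac (resCard z) m := by
  classical
  have key : ∀ s : Ind k I →₀ ℕ, (nilCard (obj s) : ℚ) / autCard (obj s) =
      s.prod fun z m => Plethysm.nilFrac (resCard z) m := by
    intro s
    induction hn : s.degree using Nat.strong_induction_on generalizing s with
    | _ n ih =>
    have h1 := endCard_div_autCard_eq_sum (obj s)
    rw [endCard_div_autCard, mult_obj] at h1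
    simp_rw [← sum_nilFrac (one_lt_resCard _)] at h1
    -- The claimed products and the true ratios have the same sum over all `r ≤ s`, namely the
    -- number of endomorphisms over that of automorphisms. By induction the terms with `r < s`
    -- agree, and so does the last one.
    have h2 := Finsupp.sum_Iic_prod s (fun z m => Plethysm.nilFrac (resCard z) m)
      fun z => Plethysm.nilFrac_zero _
    have h3 := h2.trans h1
    rw [← Finset.Iio_insert, Finset.sum_insert (by simp), Finset.sum_insert (by simp),
      Finset.sum_congr rfl fun r hr => (ih r.degree ?_ r rfl).symm] at h3
    · have h4 := add_right_cancel h3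
      rw [h4]
    · rw [Finset.mem_Iio] at hr
      rw [← hn, ← add_tsub_cancel_of_le hr.le, map_add, lt_add_iff_pos_right]
      refine Nat.pos_of_ne_zero fun h => ?_
      rw [Finsupp.degree_eq_zero_iff, tsub_eq_zero_iff_le] at h
      exact absurd h hr.not_ge
  have h : mult (obj (mult X)) = mult X := mult_obj _
  obtain ⟨e⟩ := mult_eq_iff.1 h
  rw [← nilCard_iso e, ← autCard_iso e, key]

end QRep
end

/-! ### Comparison with subrepresentations, components and level -/

noncomputable section

open CategoryTheory Module

set_option linter.unusedSectionVars false

namespace QuiverRep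

theorem Indecomposable.of_isomorphic {k : Type*} [Field k] {I : Type*} [Quiver I] {V W : I → Type*}
    [∀ i, AddCommGroup (V i)] [∀ i, Module k (V i)] [∀ i, AddCommGroup (W i)] [∀ i, Module k (W i)]
    {R : QuiverRep k V} {S : QuiverRep k W} (hR : Indecomposable R) (h : Isomorphic R S) :
    Indecomposable S := by
  obtain ⟨e, he⟩ := h
  let pull : Sub S → Sub R := fun N =>
    { space := fun i => (N.space i).comap (e i).toLinearMap
      map_mem := fun i j a x hx => by
        change e j (R i j a x) ∈ N.space j
        rw [he]
        exact N.map_mem i j a _ hx }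
  have hbot : ∀ (N : Sub S) i, (pull N).space i = ⊥ → N.space i = ⊥ := by
    intro N i h
    rw [Submodule.eq_bot_iff] at h ⊢
    intro y hy
    have := h ((e i).symm y) (by
      change e i _ ∈ N.space i
      rwa [LinearEquiv.apply_symm_apply])
    rwa [LinearEquiv.map_eq_zero_iff] at this
  obtain ⟨⟨i, hi⟩, hdec⟩ := hR
  refine ⟨⟨i, (e i).injective.nontrivial⟩, fun N N' hc => ?_⟩
  refine (hdec (pull N) (pull N') fun i => ?_).imp (fun h i => hbot N i (h i))
    fun h i => hbot N' i (h i)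
  exact (Submodule.orderIsoMapComap (e i)).symm.isCompl (hc i)

end QuiverRep

namespace QRep

section

variable {k V ι : Type*} [Field k] [AddCommGroup V] [Module k V] [Fintype ι] [DecidableEq ι]
  (A : ι → Submodule k V)

theorem coeLinearMap_eq_sum (x : DirectSum ι fun n => A n) :
    DirectSum.coeLinearMap A x = ∑ n, (x n : V) := by
  have : DirectSum.coeLinearMap A = ∑ n, (A n).subtype ∘ₗ DirectSum.component k ι _ n := by
    refine DirectSum.linearMap_ext k fun n => LinearMap.ext fun y => ?_
    simp only [LinearMap.comp_apply, DirectSum.coeLinearMap_lof, LinearMap.sum_apply]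
    rw [Finset.sum_eq_single n, DirectSum.component.lof_self, Submodule.subtype_apply]
    · intro n' _ hne
      rw [DirectSum.component.of, dif_neg (Ne.symm hne), map_zero]
    · simp
  rw [this, LinearMap.sum_apply]
  rfl

theorem isInternal_of_proj (p : ∀ n, V →ₗ[k] A n) (h : ∀ n (y : A n), p n y = y)
    (h' : ∀ n n', n ≠ n' → ∀ y : A n, p n' y = 0) (hs : ∀ x, ∑ n, (p n x : V) = x) :
    DirectSum.IsInternal A := by
  constructor
  · intro x y hxy
    change DirectSum.coeLinearMap A x = DirectSum.coeLinearMap A y at hxy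
    have key : ∀ x n, p n (DirectSum.coeLinearMap A x) = x n := fun x n => by
      rw [coeLinearMap_eq_sum, map_sum, Finset.sum_eq_single n (fun n' _ hne => h' _ _ hne _)
        (by simp), h]
    exact DFinsupp.ext fun n => by rw [← key, hxy, key]
  · intro v
    refine ⟨∑ n, DirectSum.lof k ι _ n (p n v), ?_⟩
    change DirectSum.coeLinearMap A _ = v
    rw [map_sum]
    simpa only [DirectSum.coeLinearMap_lof] using hs v

end

section

variable {k : Type w} [Field k] {I : Type u} [Quiver.{v} I] {X Y : QRep k I}

/-- Decompositions into two subrepresentations correspond to idempotents through range and kernel in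
one direction and projections in the other. -/
theorem indecomposable_iff : QuiverRep.Indecomposable X.rep ↔ Indec X := by
  have hn : (∃ i, Nontrivial (Fin (X.dim i) → k)) ↔ 𝟙 X ≠ 0 := by
    rw [Ne, one_eq_zero_iff]
    push Not
    refine exists_congr fun i => ?_
    rw [← finrank_pos_iff (R := k), finrank_fin_fun, Nat.pos_iff_ne_zero]
  constructor
  · rintro ⟨h1, h2⟩
    refine ⟨hn.1 h1, fun e he => ?_⟩
    have hee : ∀ i v, app e i (app e i v) = app e i v := fun i v => by rw [← app_comp, he]
    let N : QuiverRep.Sub X.rep :=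
      { space := fun i => LinearMap.range (app e i)
        map_mem := by
          rintro i j a _ ⟨v, rfl⟩
          exact ⟨X.rep i j a v, app_rep e a v⟩ }
    let N' : QuiverRep.Sub X.rep :=
      { space := fun i => LinearMap.ker (app e i)
        map_mem := by
          intro i j a v hv
          rw [LinearMap.mem_ker] at hv ⊢
          rw [app_rep, hv, map_zero] }
    refine (h2 N N' fun i => LinearMap.IsIdempotentElem.isCompl (LinearMap.ext (hee i))).imp
      (fun h => hom_ext fun i v => ?_) fun h => hom_ext fun i v => ?_
    · have : app e i v ∈ N.space i := ⟨v, rfl⟩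
      rwa [h i, Submodule.mem_bot] at this
    · have : app e i v - v ∈ N'.space i := by
        change app e i _ = 0
        rw [map_sub, hee, sub_self]
      rwa [h i, Submodule.mem_bot, sub_eq_zero] at this
  · intro hX
    refine ⟨hn.2 hX.one_ne, fun N N' hc => ?_⟩
    let e : X ⟶ X := homMk (fun i => (N.space i).projection (N'.space i) (hc i)) (by
      intro i j a v
      obtain ⟨y, hy, z, hz, rfl⟩ : ∃ y ∈ N.space i, ∃ z ∈ N'.space i, y + z = v :=
        Submodule.mem_sup.1 ((hc i).sup_eq_top ▸ Submodule.mem_top)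
      have h0 : ∀ l (z : Fin (X.dim l) → k), z ∈ N'.space l →
          (N.space l).projection (N'.space l) (hc l) z = 0 := fun l z hz => by
        rw [Submodule.projection_apply, (Submodule.projectionOnto_apply_eq_zero_iff _).2 hz]
        rfl
      simp only [map_add]
      rw [Submodule.projection_apply_of_mem_left _ hy, h0 _ _ hz,
        Submodule.projection_apply_of_mem_left _ (N.map_mem i j a y hy),
        h0 _ _ (N'.map_mem i j a z hz), map_zero])
    have hmem : ∀ i v, app e i v ∈ N.space i := fun i v => Submodule.projection_apply_mem _ _
    have hfix : ∀ i v, v ∈ N.space i → app e i v = v := fun i v hv =>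
      Submodule.projection_apply_of_mem_left _ hv
    have he : e ≫ e = e := hom_ext fun i v => hfix i _ (hmem i v)
    refine (hX.idem e he).imp (fun h i => ?_) fun h i => ?_
    · rw [Submodule.eq_bot_iff]
      intro v hv
      rw [← hfix i v hv, h, app_zero]
    · rw [Submodule.eq_bot_iff]
      intro v hv
      have : app e i v = 0 := by
        change (N.space i).projection (N'.space i) (hc i) v = 0
        rw [Submodule.projection_apply, (Submodule.projectionOnto_apply_eq_zero_iff _).2 hv]
        rfl
      rw [← this, h, app_id]

variable [Finite I] {V : I → Type*} [∀ i, AddCommGroup (V i)] [∀ i, Module k (V i)]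
  [∀ i, FiniteDimensional k (V i)] {R : QuiverRep k V}

theorem indecomposable_iff_of_isomorphic (h : QuiverRep.Isomorphic R X.rep) :
    QuiverRep.Indecomposable R ↔ Indec X := by
  rw [← indecomposable_iff]
  exact ⟨fun h' => h'.of_isomorphic h, fun h' => h'.of_isomorphic h.symm⟩

/-- Internal direct sums of subrepresentations and categorical direct sums are translated into each
other; Krull–Schmidt makes the classes of the summands independent of the decomposition. -/
theorem componentDims_eq (h : QuiverRep.Isomorphic R X.rep) :
    QuiverRep.componentDims R = (fun z : Ind k I => z.rep.dim) '' (mult X).support := by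
  classical
  obtain ⟨e, he⟩ := h
  have he' : ∀ (i j : I) (a : i ⟶ j) w, (e j).symm (X.rep i j a w) = R i j a ((e i).symm w) :=
    fun i j a w => by rw [LinearEquiv.symm_apply_eq, he, LinearEquiv.apply_symm_apply]
  ext β
  constructor
  · rintro ⟨h, N, ⟨hint, hN⟩, m, rfl⟩
    choose T hTd f hf using fun n => exists_iso_abstract (N n).toRep
    have hf' : ∀ n (i j : I) (a : i ⟶ j) w,
        (f n j).symm ((T n).rep i j a w) = (N n).toRep i j a ((f n i).symm w) :=
      fun n i j a w => by rw [LinearEquiv.symm_apply_eq, hf, LinearEquiv.apply_symm_apply]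
    have hT : ∀ n, Indec (T n) := fun n => (indecomposable_iff_of_isomorphic ⟨f n, hf n⟩).1 (hN n)
    let F := fun i => LinearEquiv.ofBijective
      (DirectSum.coeLinearMap fun n => (N n).space i) (hint i)
    have hF : ∀ i n (y : (N n).space i), F i (DirectSum.lof k _ _ n y) = y := fun i n y =>
      DirectSum.coeLinearMap_lof _ _ _
    have hFs : ∀ i n (y : (N n).space i), (F i).symm y = DirectSum.lof k _ _ n y := fun i n y => by
      rw [LinearEquiv.symm_apply_eq, hF]
    have hcomm : ∀ i j (a : i ⟶ j) x, R i j a (F i x) =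
        F j (DirectSum.lmap (fun n => (N n).toRep i j a) x) := by
      intro i j a x
      have : R i j a ∘ₗ (F i).toLinearMap =
          (F j).toLinearMap ∘ₗ DirectSum.lmap (fun n => (N n).toRep i j a) := by
        refine DirectSum.linearMap_ext k fun n => LinearMap.ext fun y => ?_
        simp only [LinearMap.comp_apply, LinearEquiv.coe_coe, hF, DirectSum.lmap_lof]
        rfl
      exact LinearMap.congr_fun this x
    have hcomm' : ∀ i j (a : i ⟶ j) x, (F j).symm (R i j a x) =
        DirectSum.lmap (fun n => (N n).toRep i j a) ((F i).symm x) := by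
      intro i j a x
      rw [LinearEquiv.symm_apply_eq, ← hcomm, LinearEquiv.apply_symm_apply]
    let D : DirSum T X :=
      { inc := fun n => homMk (fun i => (e i).toLinearMap ∘ₗ ((N n).space i).subtype ∘ₗ
          (f n i).symm.toLinearMap) fun i j a w => by
            simp only [LinearMap.comp_apply, LinearEquiv.coe_coe, hf']
            rw [← he]
            rfl
        prj := fun n => homMk (fun i => (f n i).toLinearMap ∘ₗ DirectSum.component k _ _ n ∘ₗ
          (F i).symm.toLinearMap ∘ₗ (e i).symm.toLinearMap) fun i j a w => by
            simp only [LinearMap.comp_apply, LinearEquiv.coe_coe]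
            rw [he', hcomm', ← hf]
            rfl
        inc_prj := fun n => hom_ext fun i w => by
          simp only [app_comp, app_homMk, LinearMap.comp_apply, LinearEquiv.coe_coe,
            LinearEquiv.symm_apply_apply, Submodule.subtype_apply, hFs, DirectSum.component.lof_self,
            LinearEquiv.apply_symm_apply, app_id]
        inc_prj_ne := fun n n' hne => hom_ext fun i w => by
          simp only [app_comp, app_homMk, LinearMap.comp_apply, LinearEquiv.coe_coe,
            LinearEquiv.symm_apply_apply, Submodule.subtype_apply, hFs, app_zero]
          rw [DirectSum.component.of, dif_neg hne, map_zero]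
        sum := hom_ext fun i w => by
          rw [app_sum]
          simp only [app_comp, app_homMk, LinearMap.comp_apply, LinearEquiv.coe_coe,
            LinearEquiv.symm_apply_apply, app_id]
          rw [← map_sum, ← LinearEquiv.eq_symm_apply]
          have h1 : ∀ x, ∑ n, ((N n).space i).subtype (DirectSum.component k _ _ n x) = F i x := by
            intro x
            exact (coeLinearMap_eq_sum _ x).symm
          rw [h1, LinearEquiv.apply_symm_apply] }
    refine ⟨Ind.mk (hT m), ?_, ?_⟩
    · rw [mult_dirSum_indec hT D]
      simp only [SetLike.mem_coe, Finsupp.mem_support_iff, Finsupp.finsetSum_apply, Ne,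
        Finset.sum_eq_zero_iff, Finset.mem_univ, true_implies, not_forall]
      exact ⟨m, by simp⟩
    · change (Ind.mk (hT m)).rep.dim = _
      rw [dim_eq_of_iso (Ind.nonempty_iso_rep_mk (hT m)).some]
      exact funext (hTd m)
  · rintro ⟨z, hz, rfl⟩
    obtain ⟨ι, _, T, hT, ⟨D⟩⟩ := exists_decomposition X
    rw [mult_dirSum_indec hT D] at hz
    simp only [SetLike.mem_coe, Finsupp.mem_support_iff, Finsupp.finsetSum_apply, Ne,
        Finset.sum_eq_zero_iff, Finset.mem_univ, true_implies, not_forall] at hz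
    obtain ⟨n₀, hn₀⟩ := hz
    have hz' : Ind.mk (hT n₀) = z := by
      by_contra h
      exact hn₀ (Finsupp.single_eq_of_ne (Ne.symm h))
    let g : ∀ n i, (Fin ((T n).dim i) → k) →ₗ[k] V i := fun n i =>
      (e i).symm.toLinearMap ∘ₗ app (D.inc n) i
    let p : ∀ n i, V i →ₗ[k] (Fin ((T n).dim i) → k) := fun n i =>
      app (D.prj n) i ∘ₗ (e i).toLinearMap
    have hpg : ∀ n i w, p n i (g n i w) = w := fun n i w => by
      change app (D.prj n) i (e i ((e i).symm (app (D.inc n) i w))) = w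
      rw [LinearEquiv.apply_symm_apply, ← app_comp, D.inc_prj, app_id]
    have hpg' : ∀ n n', n ≠ n' → ∀ i w, p n' i (g n i w) = 0 := fun n n' hne i w => by
      change app (D.prj n') i (e i ((e i).symm (app (D.inc n) i w))) = 0
      rw [LinearEquiv.apply_symm_apply, ← app_comp, D.inc_prj_ne _ _ hne, app_zero]
    have hgp : ∀ i x, ∑ n, g n i (p n i x) = x := fun i x => by
      change ∑ n, (e i).symm (app (D.inc n) i (app (D.prj n) i (e i x))) = x
      rw [← map_sum, LinearEquiv.symm_apply_eq]
      simp_rw [← app_comp]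
      rw [← app_sum, D.sum, app_id]
    have hgi : ∀ n i, Function.Injective (g n i) := fun n i =>
      Function.LeftInverse.injective (hpg n i)
    have hgR : ∀ n (i j : I) (a : i ⟶ j) w, g n j ((T n).rep i j a w) = R i j a (g n i w) := by
      intro n i j a w
      change (e j).symm (app (D.inc n) j _) = R i j a ((e i).symm (app (D.inc n) i w))
      rw [app_rep, he']
    let σ := Fintype.equivFin ι
    let N : Fin (Fintype.card ι) → QuiverRep.Sub R := fun n =>
      { space := fun i => LinearMap.range (g (σ.symm n) i)
        map_mem := by
          rintro i j a _ ⟨w, rfl⟩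
          exact ⟨_, hgR _ i j a w⟩ }
    have hiso : ∀ n, QuiverRep.Isomorphic (T (σ.symm n)).rep (N n).toRep := fun n =>
      ⟨fun i => LinearEquiv.ofInjective _ (hgi _ i), fun i j a w => Subtype.ext (hgR _ i j a w)⟩
    refine ⟨Fintype.card ι, N, ⟨fun i => ?_, fun n =>
      (indecomposable_iff.2 (hT _)).of_isomorphic (hiso n)⟩, σ n₀, ?_⟩
    · refine isInternal_of_proj _ (fun n => (g (σ.symm n) i).rangeRestrict ∘ₗ p (σ.symm n) i)
        (fun n => ?_) (fun n n' hne => ?_) fun x => ?_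
      · rintro ⟨_, w, rfl⟩
        exact Subtype.ext (congrArg (g (σ.symm n) i) (hpg _ _ _))
      · rintro ⟨_, w, rfl⟩
        refine Subtype.ext ((congrArg (g (σ.symm n') i) (hpg' _ _ ?_ _ _)).trans (map_zero _))
        exact fun h => hne (σ.symm.injective h)
      · exact (Fintype.sum_equiv σ.symm _ (fun n => g n i (p n i x)) fun _ => rfl).trans (hgp i x)
    · funext i
      have h1 := (hiso (σ n₀)).choose i
      have h2 := h1.finrank_eq
      rw [finrank_fin_fun, Equiv.symm_apply_apply] at h2
      rw [QuiverRep.Sub.dim, ← h2, ← hz']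
      exact congrFun (dim_eq_of_iso (Ind.nonempty_iso_rep_mk (hT n₀)).some) i

end

section

variable {K : Type w} [Field K] {I : Type u} [Quiver.{v} I]

theorem isomorphic_geometric (X : QRep K I) : QuiverRep.Isomorphic (QuiverRep.geometric X.rep)
    (ext (algebraMap K (AlgebraicClosure K)) X).rep := by
  refine ⟨fun i => TensorProduct.piScalarRight K (AlgebraicClosure K) (AlgebraicClosure K)
    (Fin (X.dim i)), fun i j a x => ?_⟩
  induction x using TensorProduct.induction_on with
  | zero => simp only [map_zero]
  | add x y hx hy => simp only [map_add, hx, hy]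
  | tmul x f =>
    have h : ∀ l (f : Fin (X.dim l) → K), (fun j => f j • x) =
        x • fun j => algebraMap K (AlgebraicClosure K) (f j) := fun l f =>
      funext fun j => by rw [Pi.smul_apply, Algebra.smul_def, smul_eq_mul, mul_comm]
    simp only [QuiverRep.geometric, LinearMap.baseChange_tmul, TensorProduct.piScalarRight_apply,
      TensorProduct.piScalarRightHom_tmul, h, map_smul]
    rw [mapLin_apply]

variable [Finite I]

theorem absolutelyIndecomposable_iff {X : QRep K I} :
    QuiverRep.AbsolutelyIndecomposable X.rep ↔
      Indec (ext (algebraMap K (AlgebraicClosure K)) X) :=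
  indecomposable_iff_of_isomorphic (isomorphic_geometric X)

variable [Finite K] [∀ i j : I, Finite (i ⟶ j)]

theorem levelAtMost_iff {X : QRep K I} {V : Set (I → ℕ)} :
    QuiverRep.LevelAtMost V X.rep ↔
      ∀ o ∈ (orbMult (AlgebraicClosure K) X).support, o.dim ∈ V := by
  rw [QuiverRep.LevelAtMost, componentDims_eq (isomorphic_geometric X), Set.image_subset_iff]
  constructor
  · intro h o
    induction o using Quotient.inductionOn with
    | _ z =>
      intro hz
      rw [Finsupp.mem_support_iff, orbMult_apply] at hz
      rw [dim_orb]
      exact h (Finsupp.mem_support_iff.2 hz)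
  · intro h z hz
    rw [SetLike.mem_coe, Finsupp.mem_support_iff, ← orbMult_apply] at hz
    have := h _ (Finsupp.mem_support_iff.2 hz)
    rwa [dim_orb] at this

end

end QRep
end

/-! ### Isomorphism classes as multisets of Frobenius orbits -/

noncomputable section

open CategoryTheory Module Plethysm

set_option linter.unusedSectionVars false

namespace QRep

variable {K Ω : Type w} [Field K] [Finite K] [Field Ω] [Algebra K Ω] [IsAlgClosed Ω]
  [Algebra.IsAlgebraic K Ω] {I : Type u} [Quiver.{v} I] [Finite I] [∀ i j : I, Finite (i ⟶ j)]

theorem mult_ext_descent (o : Orb K Ω I) (z : Ind Ω I) [Decidable (orb K Ω I z = o)] :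
    mult (ext (algebraMap K Ω) o.descent.rep) z = if orb K Ω I z = o then 1 else 0 := by
  rw [← orbMult_apply, orbMult_descent]
  split_ifs with h
  · rw [h, Finsupp.single_eq_same]
  · rw [Finsupp.single_eq_of_ne h]

/-- Over `Ω` the descent is the sum of the `o.card` members of the orbit, which share one dimension
vector. -/
theorem dim_descent (o : Orb K Ω I) (i : I) : o.descent.rep.dim i = o.card * o.dim i := by
  classical
  have h : o.descent.rep.dim i = (ext (algebraMap K Ω) o.descent.rep).dim i := rfl
  rw [h, dim_eq_mult_sum, Finsupp.sum, Orb.card, orbitCard, ← smul_eq_mul,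
    Set.ncard_eq_toFinset_card _ (finite_orbit _ o)]
  have hs : (mult (ext (algebraMap K Ω) o.descent.rep)).support = (finite_orbit _ o).toFinset := by
    ext z
    rw [Finsupp.mem_support_iff, mult_ext_descent, Set.Finite.mem_toFinset]
    simp
  rw [hs]
  refine Finset.sum_eq_card_nsmul fun z hz => ?_
  rw [Set.Finite.mem_toFinset, Set.mem_ofPred_eq] at hz
  rw [mult_ext_descent, if_pos hz, one_mul, ← hz, dim_orb]

/-- The dimension vector of the representations in an orbit, as a multi-index. -/
def Orb.vec (o : Orb K Ω I) : I →₀ ℕ := Finsupp.equivFunOnFinite.symm o.dim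

theorem Orb.vec_apply (o : Orb K Ω I) (i : I) : o.vec i = o.dim i := rfl

theorem Orb.coe_vec (o : Orb K Ω I) : ⇑o.vec = o.dim := rfl

theorem Orb.vec_ne_zero (o : Orb K Ω I) : o.vec ≠ 0 := by
  intro h
  refine o.out.indec.one_ne ?_
  rw [one_eq_zero_iff]
  exact fun i => DFunLike.congr_fun h i

theorem dim_eq_total (X : QRep K I) :
    X.dim = ⇑(total Orb.card Orb.vec (orbMult Ω X)) := by
  funext i
  rw [dim_eq_mult_sum, mult_eq_mapDomain_orbMult (Ω := Ω),
    Finsupp.sum_mapDomain_index (by simp) (by intros; rw [add_mul]), total, Finsupp.sum_apply]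
  refine Finsupp.sum_congr fun o _ => ?_
  rw [dim_descent, Finsupp.smul_apply, Orb.vec_apply, smul_eq_mul, mul_assoc]

section

variable {α : I → ℕ}

theorem total_orbMult_mk (X : QuiverRep.OfDim K α) :
    ⇑(total Orb.card Orb.vec (orbMult Ω (⟨α, X⟩ : QRep K I))) = α :=
  (dim_eq_total _).symm

theorem orbMult_mk_eq_iff {X Y : QuiverRep.OfDim K α} :
    orbMult Ω (⟨α, X⟩ : QRep K I) = orbMult Ω (⟨α, Y⟩ : QRep K I) ↔ QuiverRep.Isomorphic X Y := by
  rw [orbMult_eq_iff, nonempty_iso_iff]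

theorem exists_orbMult_mk_eq {t : Orb K Ω I →₀ ℕ} (h : ⇑(total Orb.card Orb.vec t) = α) :
    ∃ X : QuiverRep.OfDim K α, orbMult Ω (⟨α, X⟩ : QRep K I) = t := by
  obtain ⟨⟨d, R⟩, rfl⟩ := exists_orbMult_eq t
  rw [← dim_eq_total] at h
  subst h
  exact ⟨R, rfl⟩

/-- The map `orbMult` is a bijection from isomorphism classes over `K` to multisets of orbits, under
which the dimension vector becomes `total`. -/
theorem numIso_eq_card {P : QuiverRep.OfDim K α → Prop} {Q : (Orb K Ω I →₀ ℕ) → Prop}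
    (h : ∀ X, P X ↔ Q (orbMult Ω (⟨α, X⟩ : QRep K I))) :
    QuiverRep.numIso K α P = Nat.card {t // ⇑(total Orb.card Orb.vec t) = α ∧ Q t} := by
  refine Nat.card_congr (Equiv.ofBijective (fun c => ⟨orbMult Ω (⟨α, c.1.out⟩ : QRep K I),
    total_orbMult_mk _, ?_⟩) ⟨fun c c' hc => ?_, ?_⟩)
  · obtain ⟨c, X, hX, hP⟩ := c
    have : QuiverRep.Isomorphic c.out X :=
      Quotient.exact (s := QuiverRep.isoSetoid K α) ((Quotient.out_eq c).trans hX.symm)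
    rw [orbMult_mk_eq_iff.2 this]
    exact (h X).1 hP
  · have := orbMult_mk_eq_iff.1 (Subtype.mk.inj hc)
    have := Quotient.sound (s := QuiverRep.isoSetoid K α) this
    rw [Quotient.out_eq, Quotient.out_eq] at this
    exact Subtype.ext this
  · rintro ⟨t, ht, hQ⟩
    obtain ⟨X, rfl⟩ := exists_orbMult_mk_eq ht
    refine ⟨⟨Quotient.mk _ X, X, rfl, (h X).2 hQ⟩, Subtype.ext ?_⟩
    exact orbMult_mk_eq_iff.2 (Quotient.exact (s := QuiverRep.isoSetoid K α) (Quotient.out_eq _))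

theorem finite_total_eq (α : I → ℕ) :
    {t : Orb K Ω I →₀ ℕ | ⇑(total Orb.card Orb.vec t) = α}.Finite := by
  have : ∀ i j, Finite ((Fin (α i) → K) →ₗ[K] (Fin (α j) → K)) := fun i j =>
    finite_linearMap K _ _
  refine (Set.finite_range fun X : QuiverRep.OfDim K α => orbMult Ω (⟨α, X⟩ : QRep K I)).subset ?_
  exact fun t ht => exists_orbMult_mk_eq ht

end

theorem finite_vec_eq (n : ℕ) (hn : n ≠ 0) (δ : I →₀ ℕ) :
    {o : Orb K Ω I | o.vec = δ ∧ o.card ∣ n}.Finite := by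
  have : {o : Orb K Ω I | o.vec = δ ∧ o.card ∣ n} ⊆ ⋃ c ∈ n.divisors,
      (fun o => Finsupp.single o 1) ⁻¹' {t | ⇑(total Orb.card Orb.vec t) = ⇑(c • δ)} := by
    rintro o ⟨rfl, ho⟩
    simp only [Set.mem_iUnion]
    refine ⟨o.card, Nat.mem_divisors.2 ⟨ho, hn⟩, ?_⟩
    rw [Set.mem_preimage, Set.mem_ofPred_eq, total, Finsupp.sum_single_index (by simp), one_mul]
  refine ((n.divisors.finite_toSet).biUnion fun c _ => ?_).subset this
  exact (finite_total_eq _).preimage (Finsupp.single_left_injective one_ne_zero).injOn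

/-- The extension is realised inside `Ω` as the fixed field of a power of Frobenius, so that `Ω` and
its indecomposables serve all the extensions of `K` at once. -/
theorem exists_extension (K Ω : Type w) [Field K] [Finite K] [Field Ω] [Algebra K Ω]
    [IsAlgClosed Ω] [Algebra.IsAlgebraic K Ω] {n : ℕ} (hn : n ≠ 0) :
    ∃ (L : Type w) (_ : Field L) (_ : Finite L) (_ : Algebra L Ω),
      Algebra.IsAlgebraic L Ω ∧ Nat.card L = Nat.card K ^ n := by
  let L : Subfield Ω := RingHom.eqLocusField ((frob K Ω ^ n : Ω ≃+* Ω) : Ω →+* Ω) (RingHom.id Ω)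
  have hmem : ∀ x, x ∈ L ↔ x ^ Nat.card K ^ n = x := fun x => by
    rw [← frob_pow_apply]
    rfl
  have hK : ∀ x : K, algebraMap K Ω x ∈ L := fun x => by
    rw [hmem, ← frob_pow_apply]
    have : ∀ m : ℕ, (frob K Ω ^ m : Ω ≃+* Ω) (algebraMap K Ω x) = algebraMap K Ω x := by
      intro m
      induction m with
      | zero => rfl
      | succ m ih =>
        rw [pow_succ', RingAut.mul_apply, ih]
        exact RingHom.congr_fun frob_comp_algebraMap x
    exact this n
  have hfin : Finite L := by
    have := finite_fixed (K := K) (Ω := Ω) (Nat.pos_of_ne_zero hn)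
    exact Finite.of_injective (fun x : L => (⟨x.1, (hmem _).1 x.2⟩ : {x // x ^ Nat.card K ^ n = x}))
      fun x y h => Subtype.ext (Subtype.mk.inj h)
  refine ⟨L, inferInstance, hfin, inferInstance, ?_, ?_⟩
  · let := ((algebraMap K Ω).codRestrict L hK).toAlgebra
    have : IsScalarTower K L Ω := IsScalarTower.of_algebraMap_eq fun _ => rfl
    exact Algebra.IsAlgebraic.tower_top (K := K) L
  · have h1 : 1 < Nat.card K ^ n := Nat.one_lt_pow hn (two_le_card K)
    have h0 : ((Nat.card K ^ n : ℕ) : Ω) = 0 := by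
      rw [Nat.cast_pow, card_cast_eq_zero, zero_pow hn]
    let P : Polynomial Ω := Polynomial.X ^ Nat.card K ^ n - Polynomial.X
    have hd : P.derivative = -1 := by
      simp [P, Polynomial.derivative_X_pow, h0]
    have hsep : P.Separable := by
      rw [Polynomial.Separable, hd]
      exact isCoprime_one_right.neg_right
    have hne : P ≠ 0 := FiniteField.X_pow_card_sub_X_ne_zero Ω h1
    have hc := Polynomial.card_rootSet_eq_natDegree (K := Ω) hsep (IsAlgClosed.splits _)
    rw [FiniteField.X_pow_card_sub_X_natDegree_eq Ω h1, ← Nat.card_eq_fintype_card] at hc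
    rw [← hc]
    refine Nat.card_congr (Equiv.subtypeEquivRight fun x => ?_)
    rw [Polynomial.mem_rootSet_of_ne hne, hmem]
    simp [P, sub_eq_zero]

/-- Absolutely indecomposable representations are the fixed points of Frobenius. -/
theorem numIso_absolutelyIndecomposable (K Ω : Type w) [Field K] [Finite K] [Field Ω] [Algebra K Ω]
    [IsAlgClosed Ω] [Algebra.IsAlgebraic K Ω] (α : I → ℕ) :
    QuiverRep.numIso K α QuiverRep.AbsolutelyIndecomposable =
      Nat.card {z : Ind Ω I // z.rep.dim = α ∧ Ind.map (frob K Ω) z = z} := by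
  have hI : ∀ X : QuiverRep.OfDim K α, QuiverRep.AbsolutelyIndecomposable X ↔
      Indec (ext (algebraMap K Ω) ⟨α, X⟩) := by
    intro X
    have : IsAlgClosure K Ω := ⟨inferInstance, inferInstance⟩
    let τ : AlgebraicClosure K ≃ₐ[K] Ω := IsAlgClosure.equiv K _ _
    have h : ∀ Y : QRep K I, ext ((τ : AlgebraicClosure K ≃+* Ω) : AlgebraicClosure K →+* Ω)
        (ext (algebraMap K (AlgebraicClosure K)) Y) = ext (algebraMap K Ω) Y := fun Y => by
      rw [ext_ext]
      exact congrArg (ext · Y) τ.toAlgHom.comp_algebraMap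
    refine (absolutelyIndecomposable_iff (X := ⟨α, X⟩)).trans ⟨fun hX => ?_, fun hX => ?_⟩
    · have := hX.ext (τ : AlgebraicClosure K ≃+* Ω)
      rwa [h] at this
    · rw [← h] at hX
      have := hX.ext (τ : AlgebraicClosure K ≃+* Ω).symm
      rwa [ext_symm_ext] at this
  have hP : ∀ c : {c : Quotient (QuiverRep.isoSetoid K α) // ∃ X : QuiverRep.OfDim K α,
      Quotient.mk _ X = c ∧ QuiverRep.AbsolutelyIndecomposable X},
      Indec (ext (algebraMap K Ω) (⟨α, c.1.out⟩ : QRep K I)) := by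
    rintro ⟨c, X, hX, h⟩
    have : QuiverRep.Isomorphic X c.out :=
      Quotient.exact (s := QuiverRep.isoSetoid K α) (hX.trans (Quotient.out_eq c).symm)
    exact ((hI X).1 h).of_iso (extIso _ (nonempty_iso_iff.2 this).some)
  refine Nat.card_congr (Equiv.ofBijective (fun c => ⟨Ind.mk (hP c), ?_, ?_⟩)
    ⟨fun c c' hc => ?_, ?_⟩)
  · exact dim_eq_of_iso (Ind.nonempty_iso_rep_mk (hP c)).some
  · rw [Ind.map_mk, Ind.mk_eq_mk_iff, ext_ext, frob_comp_algebraMap]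
    exact ⟨Iso.refl _⟩
  · have h1 := (Ind.mk_eq_mk_iff (hP c) (hP c')).1 (Subtype.mk.inj hc)
    have h2 := nonempty_iso_iff.1 (nonempty_iso_of_ext_iso h1.some)
    have := Quotient.sound (s := QuiverRep.isoSetoid K α) h2
    rw [Quotient.out_eq, Quotient.out_eq] at this
    exact Subtype.ext this
  -- A class fixed by Frobenius descends to `K`; injectivity was Noether–Deuring.
  · rintro ⟨z, hd, hz⟩
    obtain ⟨⟨d, R⟩, ⟨e⟩⟩ := exists_ext_iso ((Ind.map_eq_iff _).1 hz).some
    have : d = α := (dim_eq_of_iso e).trans hd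
    subst this
    have hA : QuiverRep.AbsolutelyIndecomposable R := (hI R).2 (z.indec.of_iso e.symm)
    refine ⟨⟨Quotient.mk _ R, R, rfl, hA⟩, Subtype.ext ?_⟩
    have h1 : QuiverRep.Isomorphic (Quotient.mk (QuiverRep.isoSetoid K d) R).out R :=
      Quotient.exact (s := QuiverRep.isoSetoid K d) (Quotient.out_eq _)
    have h2 := (nonempty_iso_iff (X := (⟨d, _⟩ : QRep K I)) (Y := ⟨d, R⟩)).2 h1
    refine Eq.trans ?_ (Ind.mk_rep z)
    rw [Ind.mk_eq_mk_iff]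
    exact ⟨(extIso _ h2.some).trans e⟩

/-- The Frobenius of `L` is the `n`-th power of that of `K`, and it fixes a class exactly when the
size of its orbit divides `n`; the whole orbit is then fixed and contributes its size. -/
theorem numIso_absolutelyIndecomposable_eq_sum (Ω : Type w) [Field Ω] [Algebra K Ω]
    [IsAlgClosed Ω] [Algebra.IsAlgebraic K Ω] {n : ℕ} (hn : n ≠ 0)
    (L : Type w) [Field L] [Finite L] [Algebra L Ω] [Algebra.IsAlgebraic L Ω]
    (hL : Nat.card L = Nat.card K ^ n) (δ : I →₀ ℕ) :
    QuiverRep.numIso L (⇑δ) QuiverRep.AbsolutelyIndecomposable =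
      ∑ o ∈ (finite_vec_eq (K := K) (Ω := Ω) n hn δ).toFinset, o.card := by
  classical
  have hf : frob L Ω = frob K Ω ^ n := RingEquiv.ext fun x => by
    rw [frob_apply, frob_pow_apply, hL]
  rw [numIso_absolutelyIndecomposable L Ω, hf]
  set F := (finite_vec_eq (K := K) (Ω := Ω) n hn δ).toFinset
  have h : ∀ z : Ind Ω I, (z.rep.dim = ⇑δ ∧ Ind.map (frob K Ω ^ n) z = z) ↔ orb K Ω I z ∈ F := by
    intro z
    rw [Set.Finite.mem_toFinset, Set.mem_ofPred_eq, ← DFunLike.coe_injective.eq_iff (a := Orb.vec _), Orb.coe_vec, dim_orb,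
      Orb.card, orbitCard_mk, ← Function.isPeriodicPt_iff_minimalPeriod_dvd,
      Function.IsPeriodicPt, Function.IsFixedPt, Ind.map_iterate]
  have e := Equiv.sigmaSubtypeFiberEquivSubtype (orb K Ω I) h
  have : ∀ o : Orb K Ω I, Finite {z : Ind Ω I // orb K Ω I z = o} := fun o => finite_orbit _ o
  rw [← Nat.card_congr e, Nat.card_sigma, ← Finset.sum_coe_sort F]
  rfl

end QRep
end

/-! ### Nilpotent pairs in terms of Frobenius orbits -/

noncomputable section

open CategoryTheory Module Plethysm

set_option linter.unusedSectionVars false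

namespace QRep

section

variable {k : Type w} [Field k] {I : Type u} [Quiver.{v} I] [Finite I] {X Y : QRep k I}

theorem app_pow (f : X ⟶ X) (n : ℕ) (i : I) : app (End.of f ^ n).asHom i =
    (app f i : End k (Fin (X.dim i) → k)) ^ n := by
  induction n with
  | zero => rfl
  | succ n ih =>
    rw [pow_succ, pow_succ, ← ih]
    rfl

theorem nil_iff (f : X ⟶ X) :
    Nil f ↔ ∀ i, IsNilpotent (app f i : End k (Fin (X.dim i) → k)) := by
  cases nonempty_fintype I
  constructor
  · rintro ⟨n, hn⟩ i
    refine ⟨n, ?_⟩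
    rw [← app_pow, hn]
    rfl
  · intro h
    choose n hn using h
    refine ⟨∑ i, n i, hom_ext fun i v => ?_⟩
    have h1 : (app f i : End k (Fin (X.dim i) → k)) ^ ∑ i, n i = 0 :=
      pow_eq_zero_of_le (Finset.single_le_sum (fun _ _ => Nat.zero_le _) (Finset.mem_univ i)) (hn i)
    exact LinearMap.congr_fun ((app_pow f _ i).trans h1) v

theorem isIso_iff (f : X ⟶ Y) : IsIso f ↔ ∀ i, Function.Bijective (app f i) := by
  constructor
  · intro h
    exact bijective_app (asIso f)
  · intro h
    exact (isoOfBijective f h).isIso_hom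

variable {α : I → ℕ}

/-- A pair of a representation and a nilpotent endomorphism, in coordinates. -/
def nilPairEquiv : NilPair k α ≃
    Σ R : QuiverRep.OfDim k α, {f : (⟨α, R⟩ : QRep k I) ⟶ ⟨α, R⟩ // Nil f} where
  toFun x := ⟨x.1.1, ⟨x.1.2, fun i j a => (x.2.2 i j a).symm⟩, (nil_iff _).2 x.2.1⟩
  invFun y := ⟨(y.1, fun i => app y.2.1 i), (nil_iff _).1 y.2.2,
    fun _ _ a => (LinearMap.ext (app_rep y.2.1 a)).symm⟩
  left_inv _ := rfl
  right_inv _ := rfl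

/-- Change of coordinates in a representation. -/
def coordEquiv (R : QuiverRep.OfDim k α) :
    (∀ i, {f : (Fin (α i) → k) →ₗ[k] (Fin (α i) → k) // Function.Injective f}) ≃
    Σ S : QuiverRep.OfDim k α, {f : (⟨α, R⟩ : QRep k I) ⟶ ⟨α, S⟩ // IsIso f} where
  toFun g :=
    let e := fun i => LinearEquiv.ofInjectiveEndo (g i).1 (g i).2
    ⟨fun i j a => (e j).toLinearMap ∘ₗ R i j a ∘ₗ (e i).symm.toLinearMap,
      homMk (fun i => (g i).1) (fun i j a v => by
        change _ = e j (R i j a ((e i).symm (e i v)))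
        rw [LinearEquiv.symm_apply_apply]
        rfl), (isIso_iff _).2 fun i => (e i).bijective⟩
  invFun y i := ⟨app y.2.1 i, ((isIso_iff _).1 y.2.2 i).1⟩
  left_inv _ := rfl
  right_inv := by
    rintro ⟨S, f, hf⟩
    have hb := (isIso_iff f).1 hf
    have hS : (fun i j a => (LinearEquiv.ofInjectiveEndo (app f j) (hb j).1).toLinearMap ∘ₗ
        R i j a ∘ₗ (LinearEquiv.ofInjectiveEndo (app f i) (hb i).1).symm.toLinearMap) = S := by
      funext i j a
      refine LinearMap.ext fun v => ?_
      obtain ⟨w, rfl⟩ := (LinearEquiv.ofInjectiveEndo (app f i) (hb i).1).surjective v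
      simp only [LinearMap.comp_apply, LinearEquiv.coe_coe, LinearEquiv.symm_apply_apply]
      exact app_rep f a w
    have key : ∀ S', S' = S → ∀ (f' : (⟨α, R⟩ : QRep k I) ⟶ ⟨α, S'⟩) (hf' : IsIso f'),
        (∀ i v, app f' i v = app f i v) → (⟨S', f', hf'⟩ : Σ S : QuiverRep.OfDim k α,
          {f : (⟨α, R⟩ : QRep k I) ⟶ ⟨α, S⟩ // IsIso f}) = ⟨S, f, hf⟩ := by
      rintro _ rfl f' hf' h
      obtain rfl := hom_ext h
      rfl
    exact key _ hS _ _ fun _ _ => rfl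

end

variable {K Ω : Type w} [Field K] [Finite K] [Field Ω] [Algebra K Ω] [IsAlgClosed Ω]
  [Algebra.IsAlgebraic K Ω] {I : Type u} [Quiver.{v} I] [Finite I] [∀ i j : I, Finite (i ⟶ j)]

attribute [local instance] finite_hom

theorem nilCard_div_autCard_eq_orbMult (X : QRep K I) : (nilCard X : ℚ) / autCard X =
    (orbMult Ω X).prod fun o m => nilFrac ((Nat.card K : ℚ) ^ o.card) m := by
  rw [nilCard_div_autCard, mult_eq_mapDomain_orbMult (Ω := Ω),
    Finsupp.prod_mapDomain_index_inj descent_injective]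
  refine Finsupp.prod_congr fun o _ => ?_
  rw [resCard, codim_descent, Nat.cast_pow]

/-- The count of pairs of a representation and a nilpotent endomorphism, in terms of Frobenius
orbits. -/
theorem card_nilPair_div (K Ω : Type w) [Field K] [Finite K] [Field Ω] [Algebra K Ω]
    [IsAlgClosed Ω] [Algebra.IsAlgebraic K Ω] (α : I → ℕ) :
    (Nat.card (NilPair K α) : ℚ) / ∏ᶠ i, (Nat.card
      {f : (Fin (α i) → K) →ₗ[K] (Fin (α i) → K) // Function.Injective f} : ℚ) =
    ∑ t ∈ (finite_total_eq (K := K) (Ω := Ω) α).toFinset,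
      t.prod fun o m => nilFrac ((Nat.card K : ℚ) ^ o.card) m := by
  classical
  cases nonempty_fintype I
  have : ∀ i j, Finite ((Fin (α i) → K) →ₗ[K] (Fin (α j) → K)) := fun i j =>
    finite_linearMap K _ _
  have hfin : Finite (QuiverRep.OfDim K α) := inferInstance
  cases nonempty_fintype (QuiverRep.OfDim K α)
  let m : QuiverRep.OfDim K α → (Orb K Ω I →₀ ℕ) := fun R => orbMult Ω (⟨α, R⟩ : QRep K I)
  let G := ∀ i, {f : (Fin (α i) → K) →ₗ[K] (Fin (α i) → K) // Function.Injective f}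
  have hG : (∏ᶠ i, (Nat.card
      {f : (Fin (α i) → K) →ₗ[K] (Fin (α i) → K) // Function.Injective f} : ℚ)) = Nat.card G := by
    rw [finprod_eq_prod_of_fintype, Nat.card_pi, Nat.cast_prod]
  have hG0 : (Nat.card G : ℚ) ≠ 0 := by
    have : Nonempty G := ⟨fun i => ⟨LinearMap.id, Function.injective_id⟩⟩
    exact_mod_cast Nat.card_pos.ne'
  have hN : Nat.card (NilPair K α) = ∑ R, nilCard (⟨α, R⟩ : QRep K I) := by
    rw [Nat.card_congr nilPairEquiv, Nat.card_sigma]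
    rfl
  -- Orbit–stabiliser for the base change group: a base change is a representation `S` together with
  -- an isomorphism from `R` to it.
  have hO : ∀ R, Nat.card G =
      (Finset.univ.filter fun S => m S = m R).card * autCard (⟨α, R⟩ : QRep K I) := by
    intro R
    rw [Nat.card_congr (coordEquiv R), Nat.card_sigma, ← smul_eq_mul, ← Finset.sum_const,
      Finset.sum_filter]
    refine Finset.sum_congr rfl fun S _ => ?_
    split_ifs with h
    · exact card_isIso_of_iso (orbMult_eq_iff.1 h.symm).some
    · have : IsEmpty {f : (⟨α, R⟩ : QRep K I) ⟶ ⟨α, S⟩ // IsIso f} := ⟨fun f => h <|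
        have := f.2
        orbMult_eq_iff.2 ⟨(asIso f.1).symm⟩⟩
      exact Nat.card_of_isEmpty
  rw [hG, hN, ← Finset.sum_fiberwise_of_maps_to (g := m)
    (t := (finite_total_eq (K := K) (Ω := Ω) α).toFinset)
    (fun R _ => (Set.Finite.mem_toFinset _).2 (total_orbMult_mk R)), Nat.cast_sum, Finset.sum_div]
  refine Finset.sum_congr rfl fun t ht => ?_
  rw [Set.Finite.mem_toFinset] at ht
  obtain ⟨R, rfl⟩ := exists_orbMult_mk_eq ht
  have h1 : ∀ S ∈ Finset.univ.filter fun S => m S = m R,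
      nilCard (⟨α, S⟩ : QRep K I) = nilCard (⟨α, R⟩ : QRep K I) := fun S hS =>
    nilCard_iso (orbMult_eq_iff.1 (Finset.mem_filter.1 hS).2).some
  have h2 : (autCard (⟨α, R⟩ : QRep K I) : ℚ) ≠ 0 := by exact_mod_cast (autCard_pos _).ne'
  have h3 := hO R
  rw [Finset.sum_congr rfl h1, Finset.sum_const, ← nilCard_div_autCard_eq_orbMult, div_eq_div_iff hG0 h2,
    h3, smul_eq_mul]
  push_cast
  ring

end QRep
end

/-! ### Comparison of series and transfer to `ℚ(t)` -/

noncomputable section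

namespace Plethysm

open MvPowerSeries Finset

section

variable {I : Type*} {A B : Type*} [CommRing A] [CommRing B]

/-- The series agree strictly below `β`, so all terms of the convolution at `β` cancel except that
of `L` with the constant term 1. In the induction for the Kac polynomials this isolates the unknown
value at `β`. -/
theorem coeff_sub_of_euler_eq [Algebra ℚ A] {f g L L' : MvPowerSeries I A} {β : I →₀ ℕ}
    (hL : constantCoeff L = 0) (hL' : constantCoeff L' = 0)
    (hLL : ∀ γ < β, coeff γ L = coeff γ L') (hf : euler f = L * f)
    (hg : euler g = L' * g) (hf0 : constantCoeff f = 1) (hg0 : constantCoeff g = 1) :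
    (β.degree : A) * (coeff β f - coeff β g) = coeff β L - coeff β L' := by
  classical
  rw [mul_sub, ← coeff_euler, ← coeff_euler, hf, hg, coeff_mul, coeff_mul, ← sum_sub_distrib,
    sum_eq_single (β, 0)]
  · simp only [coeff_zero_eq_constantCoeff_apply, hf0, hg0, mul_one]
  · rintro ⟨γ, δ⟩ hp hne
    rw [HasAntidiagonal.mem_antidiagonal] at hp
    change γ + δ = β at hp
    change coeff γ L * coeff δ f - coeff γ L' * coeff δ g = 0
    have hγ : γ < β := by
      refine lt_of_le_of_ne (hp ▸ le_self_add) ?_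
      rintro rfl
      exact hne (by rw [add_eq_left.1 hp])
    by_cases h0 : γ = 0
    · subst h0
      rw [coeff_zero_eq_constantCoeff_apply, coeff_zero_eq_constantCoeff_apply, hL, hL']
      ring
    have hδ : δ < β := by
      refine lt_of_le_of_ne (hp ▸ le_add_self) ?_
      rintro rfl
      exact h0 (add_eq_right.1 hp)
    rw [hLL γ hγ, coeff_eq_of_euler_eq hL (fun ε hε => hLL ε (hε.trans_lt hδ)) hf hg
      (hf0.trans hg0.symm) le_rfl, sub_self]
  · intro h
    exact absurd (HasAntidiagonal.mem_antidiagonal.2 (add_zero β)) h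

theorem map_euler (φ : A →+* B) (f : MvPowerSeries I A) :
    MvPowerSeries.map φ (euler f) = euler (MvPowerSeries.map φ f) := by
  ext γ
  rw [MvPowerSeries.coeff_map, coeff_euler, coeff_euler, MvPowerSeries.coeff_map, map_mul,
    map_natCast]

open scoped Classical in
/-- The series with coefficients `∑ |δ| w_n(δ)`, the sum over the pairs with `n δ = γ`. -/
def eulerSum (w : ℕ → (I →₀ ℕ) → A) : MvPowerSeries I A :=
  fun γ => ∑ n ∈ Icc 1 γ.degree, ∑ δ ∈ Iic γ, if n • δ = γ then (δ.degree : A) * w n δ else 0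

open scoped Classical in
theorem coeff_eulerSum (w : ℕ → (I →₀ ℕ) → A) (γ : I →₀ ℕ) : coeff γ (eulerSum w) =
    ∑ n ∈ Icc 1 γ.degree, ∑ δ ∈ Iic γ, if n • δ = γ then (δ.degree : A) * w n δ else 0 := rfl

theorem constantCoeff_eulerSum (w : ℕ → (I →₀ ℕ) → A) : constantCoeff (eulerSum w) = 0 := by
  rw [← coeff_zero_eq_constantCoeff_apply, coeff_eulerSum]
  simp

theorem coeff_eulerSum_congr {w w' : ℕ → (I →₀ ℕ) → A} {γ : I →₀ ℕ}
    (h : ∀ n ≠ 0, ∀ δ ≠ 0, n • δ = γ → w n δ = w' n δ) :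
    coeff γ (eulerSum w) = coeff γ (eulerSum w') := by
  classical
  rw [coeff_eulerSum, coeff_eulerSum]
  refine sum_congr rfl fun n hn => sum_congr rfl fun δ _ => ?_
  split_ifs with hδ
  · by_cases h0 : δ = 0
    · subst h0; simp
    · rw [h n (Nat.one_le_iff_ne_zero.1 (mem_Icc.1 hn).1) δ h0 hδ]
  · rfl

/-- Only the term `n = 1` involves the weight at `γ` itself; the others concern proper divisors of
`γ`. -/
theorem coeff_eulerSum_sub {w w' : ℕ → (I →₀ ℕ) → A} {γ : I →₀ ℕ} (hγ : γ ≠ 0)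
    (h : ∀ n, 1 < n → ∀ δ ≠ 0, n • δ = γ → w n δ = w' n δ) :
    coeff γ (eulerSum w) - coeff γ (eulerSum w') = γ.degree * (w 1 γ - w' 1 γ) := by
  classical
  have hd : γ.degree ≠ 0 := fun h => hγ ((Finsupp.degree_eq_zero_iff γ).1 h)
  rw [coeff_eulerSum, coeff_eulerSum, ← sum_sub_distrib, sum_eq_single 1, ← sum_sub_distrib,
    sum_eq_single γ]
  · rw [one_smul, if_pos rfl, if_pos rfl, mul_sub]
  · intro δ _ hne
    rw [one_smul, if_neg hne, if_neg hne, sub_self]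
  · simp
  · intro n hn hne
    rw [mem_Icc] at hn
    rw [sub_eq_zero]
    refine sum_congr rfl fun δ _ => ?_
    split_ifs with hδ
    · by_cases h0 : δ = 0
      · subst h0; simp
      · rw [h n (by omega) δ h0 hδ]
    · rfl
  · intro h
    exact absurd (mem_Icc.2 ⟨le_rfl, Nat.one_le_iff_ne_zero.2 hd⟩) h

theorem map_dlog (φ : A →+* B) (ψ : ℕ → A →+ A) (f : MvPowerSeries I A) :
    MvPowerSeries.map φ (dlog ψ f) = eulerSum fun n δ => φ (ψ n (coeff δ f)) := by
  classical
  ext γ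
  rw [MvPowerSeries.coeff_map, coeff_dlog, coeff_eulerSum, map_sum]
  refine sum_congr rfl fun n _ => ?_
  rw [map_sum]
  refine sum_congr rfl fun δ _ => ?_
  rw [apply_ite φ, map_mul, map_natCast, map_zero]

theorem dlog_eq_eulerSum (ψ : ℕ → A →+ A) (f : MvPowerSeries I A) :
    dlog ψ f = eulerSum fun n δ => ψ n (coeff δ f) := rfl

/-- The Adams operations on `ℤ[t]`, with value `0` at `n = 0`. -/
def adamsZ (n : ℕ) : ℤ[X] →+ ℤ[X] :=
  if n ≠ 0 then (Polynomial.expand ℤ n : ℤ[X] →ₐ[ℤ] ℤ[X]).toRingHom.toAddMonoidHom else 0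

theorem adamsZ_apply {n : ℕ} (hn : n ≠ 0) (p : ℤ[X]) : adamsZ n p = Polynomial.expand ℤ n p := by
  rw [adamsZ, if_pos hn]
  rfl

theorem adamsQ_apply (n : ℕ) (f : QBase → ℚ) (q : QBase) : adamsQ n f q = f (q.pow n) := rfl

theorem polyFun_adamsZ {n : ℕ} (hn : n ≠ 0) (p : ℤ[X]) :
    polyFun (adamsZ n p) = adamsQ n (polyFun p) := by
  ext q
  rw [adamsQ_apply, polyFun_apply, polyFun_apply, adamsZ_apply hn, Polynomial.expand_eval,
    q.coe_pow hn, Nat.cast_pow]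

/-- An integral polynomial as a rational function. -/
def toRatFunc : ℤ[X] →+* RatFunc ℚ :=
  (algebraMap ℚ[X] (RatFunc ℚ)).comp (Polynomial.mapRingHom (Int.castRingHom ℚ))

theorem toRatFunc_adamsZ {n : ℕ} (hn : n ≠ 0) (p : ℤ[X]) :
    toRatFunc (adamsZ n p) = adamsT n (toRatFunc p) := by
  rw [adamsT, dif_pos hn, adamsZ_apply hn]
  have h := RatFunc.map_apply_div (Polynomial.expand ℚ n)
    (nonZeroDivisors_le_comap_nonZeroDivisors_of_injective _
      (Polynomial.expand_injective (Nat.pos_of_ne_zero hn))) (p.map (Int.castRingHom ℚ)) 1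
  simp only [map_one, div_one] at h
  change algebraMap ℚ[X] (RatFunc ℚ) ((Polynomial.expand ℤ n p).map (Int.castRingHom ℚ)) = _
  rw [Polynomial.map_expand]
  exact h.symm

/-- The differential equation holds for functions of `q`, hence over `ℤ[t]` since `polyFun` is
injective, hence over `ℚ(t)`; both passages commute with the Adams operations. There it
characterises `plexp`. -/
theorem plexp_map_toRatFunc {a M : MvPowerSeries I ℤ[X]} {S : Subring (QBase → ℚ)}
    (h : IsPlexp adamsQ S (MvPowerSeries.map polyFun a) (MvPowerSeries.map polyFun M)) :
    plexp (MvPowerSeries.map toRatFunc a) = MvPowerSeries.map toRatFunc M := by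
  have hinj : Function.Injective (MvPowerSeries.map (σ := I) polyFun) := fun f g hfg => by
    ext1 γ
    refine polyFun_injective ?_
    rw [← MvPowerSeries.coeff_map, ← MvPowerSeries.coeff_map, hfg]
  have h1 : MvPowerSeries.map polyFun (dlog adamsZ a) =
      dlog adamsQ (MvPowerSeries.map polyFun a) := by
    rw [map_dlog, dlog_eq_eulerSum]
    ext1 γ
    refine coeff_eulerSum_congr fun n hn δ _ _ => ?_
    rw [polyFun_adamsZ hn, MvPowerSeries.coeff_map]
  have h2 : MvPowerSeries.map toRatFunc (dlog adamsZ a) =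
      dlog adamsT (MvPowerSeries.map toRatFunc a) := by
    rw [map_dlog, dlog_eq_eulerSum]
    ext1 γ
    refine coeff_eulerSum_congr fun n hn δ _ _ => ?_
    rw [toRatFunc_adamsZ hn, MvPowerSeries.coeff_map]
  have h3 : euler M = dlog adamsZ a * M := by
    apply hinj
    rw [map_euler, map_mul, h1, h.euler_eq]
  have h4 : constantCoeff M = 1 := by
    apply polyFun_injective
    rw [← constantCoeff_map, h.constantCoeff_eq, map_one]
  refine plexp_eq_of_euler ?_ ?_
  · rw [constantCoeff_map, h4, map_one]
  · rw [← map_euler, h3, map_mul, h2]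

end

end Plethysm
end

/-! ### Kac polynomials and the plethystic identity -/

noncomputable section

open CategoryTheory Module Plethysm MvPowerSeries

set_option linter.unusedSectionVars false

namespace QRep

section

variable (K : Type w) [Field K] [Finite K] {I : Type u} [Quiver.{v} I] [Finite I]
  [∀ i j : I, Finite (i ⟶ j)]

/-- The Frobenius orbits with dimension vector `δ` and size dividing `n`, for `n ≠ 0`. -/
def orbFinset (n : ℕ) (δ : I →₀ ℕ) : Finset (Orb K (AlgebraicClosure K) I) :=
  if hn : n ≠ 0 then (finite_vec_eq n hn δ).toFinset else ∅

variable {K} in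
theorem mem_orbFinset {n : ℕ} (hn : n ≠ 0) (δ : I →₀ ℕ) (o : Orb K (AlgebraicClosure K) I) :
    o ∈ orbFinset K n δ ↔ o.vec = δ ∧ o.card ∣ n := by
  rw [orbFinset, dif_pos hn, Set.Finite.mem_toFinset]
  rfl

/-- The number of absolutely indecomposable representations of dimension vector `δ` over the
extension of degree `n` of `K`. -/
def kacNum (n : ℕ) (δ : I →₀ ℕ) : ℕ := ∑ o ∈ orbFinset K n δ, o.card

theorem kacNum_one (δ : I →₀ ℕ) :
    kacNum K 1 δ = QuiverRep.numIso K (⇑δ) QuiverRep.AbsolutelyIndecomposable := by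
  rw [numIso_absolutelyIndecomposable_eq_sum (AlgebraicClosure K) one_ne_zero K (pow_one _).symm]
  rfl

variable {K} in
-- The Kac polynomial is applied to the extension of degree `n`; this is how the Adams operation `t
-- ↦ t ^ n` matches the orbit sums.
theorem kacNum_eq_polyFun {n : ℕ} (hn : n ≠ 0) {δ : I →₀ ℕ} {p : ℤ[X]}
    (hp : QuiverRep.IsKacPolynomial.{w} (⇑δ) p) :
    (kacNum K n δ : ℚ) = polyFun p ((qBase K).pow n) := by
  obtain ⟨L, _, _, _, _, hL⟩ := exists_extension K (AlgebraicClosure K) hn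
  have h := numIso_absolutelyIndecomposable_eq_sum (AlgebraicClosure K) hn L hL δ
  have h1 : kacNum K n δ = QuiverRep.numIso L (⇑δ) QuiverRep.AbsolutelyIndecomposable := by
    rw [h, kacNum, orbFinset, dif_pos hn]
  rw [h1, polyFun_apply, QBase.coe_pow _ hn]
  have h2 := hp L
  rw [hL] at h2
  change _ = ((p.eval ((Nat.card K ^ n : ℕ) : ℤ) : ℤ) : ℚ)
  rw [h2]
  rfl

theorem kacNum_zero (n : ℕ) : kacNum K n (0 : I →₀ ℕ) = 0 := by
  refine Finset.sum_eq_zero fun o ho => ?_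
  by_cases hn : n = 0
  · subst hn
    simp [orbFinset] at ho
  · exact absurd ((mem_orbFinset hn _ _).1 ho).1 o.vec_ne_zero

/-- The generating series of the pairs of a representation and a nilpotent endomorphism. -/
def nilSeries (I : Type u) [Quiver.{v} I] : MvPowerSeries I ℚ := fun α =>
  (Nat.card (NilPair K (⇑α)) : ℚ) / ∏ᶠ i, (Nat.card
    {f : (Fin (α i) → K) →ₗ[K] (Fin (α i) → K) // Function.Injective f} : ℚ)

theorem coeff_nilSeries (α : I →₀ ℕ) : coeff α (nilSeries K I) =
    ∑ t ∈ (finite_total_eq (K := K) (Ω := AlgebraicClosure K) (⇑α)).toFinset,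
      t.prod fun o m => nilFrac ((Nat.card K : ℚ) ^ o.card) m :=
  card_nilPair_div K (AlgebraicClosure K) (⇑α)

theorem mem_toFinset_total {α : I →₀ ℕ} {t : Orb K (AlgebraicClosure K) I →₀ ℕ} :
    t ∈ (finite_total_eq (K := K) (Ω := AlgebraicClosure K) (⇑α)).toFinset ↔
      total Orb.card Orb.vec t = α := by
  rw [Set.Finite.mem_toFinset]
  exact DFunLike.coe_injective.eq_iff

theorem total_eq_zero_iff {I O : Type*} {d : O → ℕ} {b : O → I →₀ ℕ} (hd : ∀ o, d o ≠ 0)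
    (hb : ∀ o, b o ≠ 0) (t : O →₀ ℕ) : total d b t = 0 ↔ t = 0 := by
  constructor
  · intro h
    have h1 := degree_total (d := d) (b := b) t
    rw [h, map_zero, Finsupp.sum] at h1
    ext o
    by_contra h0
    have h2 := Finset.sum_eq_zero_iff.1 h1.symm o (Finsupp.mem_support_iff.2 h0)
    have h3 : (b o).degree ≠ 0 := fun h => hb o ((Finsupp.degree_eq_zero_iff _).1 h)
    simp only [mul_eq_zero, hd, h3, or_false] at h2
    exact h0 h2
  · rintro rfl
    simp [total]

theorem constantCoeff_nilSeries : constantCoeff (nilSeries K I) = 1 := by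
  rw [← coeff_zero_eq_constantCoeff_apply, coeff_nilSeries, Finset.sum_eq_single 0]
  · simp
  · intro t ht h0
    rw [mem_toFinset_total, total_eq_zero_iff (fun o => o.card_pos.ne') fun o => o.vec_ne_zero] at ht
    exact absurd ht h0
  · intro h
    rw [mem_toFinset_total, total_eq_zero_iff (fun o => o.card_pos.ne') fun o => o.vec_ne_zero] at h
    exact absurd rfl h

/-- The factor of an orbit of size `d` is the series of `nilFrac (q ^ d)`, whose power sums are `1 /
(q ^ (k d) - 1)`; thus the series looks like the plethystic exponential of the Kac generating
function over `t - 1`. -/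
theorem euler_nilSeries : euler (nilSeries K I) =
    eulerSum (fun n δ => ((Nat.card K : ℚ) ^ n - 1)⁻¹ * kacNum K n δ) * nilSeries K I := by
  have hq : (1 : ℚ) < Nat.card K := by exact_mod_cast two_le_card K
  refine euler_sum_prod (d := Orb.card) (b := Orb.vec)
    (e := fun n m => nilFrac ((Nat.card K : ℚ) ^ n) m) (c := fun n => ((Nat.card K : ℚ) ^ n - 1)⁻¹)
    (fun n => nilFrac_zero _) (fun n m hn => ?_) (fun o => o.card_pos.ne')
    (fun o => o.vec_ne_zero) (fun α => (finite_total_eq (⇑α)).toFinset)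
    (fun α t => mem_toFinset_total K) (orbFinset K) (fun n hn δ o => mem_orbFinset hn δ o) _ _
    (fun α => coeff_nilSeries K α) fun γ => coeff_eulerSum _ _
  rw [mul_nilFrac (one_lt_pow₀ hq hn)]
  refine Finset.sum_congr rfl fun k _ => ?_
  rw [← pow_mul, mul_comm n k, one_div]

theorem exists_finite_field (N : ℕ) : ∃ (K : Type w) (_ : Field K) (_ : Finite K),
    N ≤ Nat.card K := by
  obtain ⟨p, hp, hpp⟩ := Nat.exists_infinite_primes N
  have := Fact.mk hpp
  exact ⟨ULift (ZMod p), inferInstance, inferInstance, by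
    rw [Nat.card_congr Equiv.ulift, Nat.card_zmod]; exact hp⟩

/-- Existence of the Kac polynomials. -/
theorem exists_isKacPolynomial (I : Type u) [Quiver.{v} I] [Finite I] [∀ i j : I, Finite (i ⟶ j)]
    (β : I →₀ ℕ) : ∃ p, QuiverRep.IsKacPolynomial.{w} (⇑β) p := by
  induction hN : β.degree using Nat.strong_induction_on generalizing β with
  | _ N ih =>
  by_cases hβ : β = 0
  · refine ⟨0, fun K _ _ => ?_⟩
    rw [← kacNum_one, hβ, kacNum_zero]
    simp
  classical
  -- The Kac polynomials of smaller degree, completed by 0, in particular at `β`. The exponential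
  -- `P` of this truncation differs from the true series at `β` by `a_β / (t - 1)` only.
  let a : (I →₀ ℕ) → ℤ[X] := fun δ => if h : δ.degree < N then (ih _ h δ rfl).choose else 0
  have ha : ∀ δ : I →₀ ℕ, δ.degree < N → QuiverRep.IsKacPolynomial.{w} (⇑δ) (a δ) := by
    intro δ h
    have : a δ = (ih _ h δ rfl).choose := dif_pos h
    rw [this]
    exact (ih _ h δ rfl).choose_spec
  have haβ : a β = 0 := dif_neg (by omega)
  obtain ⟨P, hP⟩ := exists_isPlexp_invSubOne a
  obtain ⟨r, hr, hrK⟩ := exists_card_nilPair.{w} (⇑β)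
  -- So `a_β(q) = (q - 1) (r - P_β)`, with `r` the rational function that counts nilpotent pairs.
  have hg : ∀ (K : Type w) [Field K] [Finite K],
      (polyFun (Polynomial.X - 1) * (r - coeff β P)) (qBase K) =
        QuiverRep.numIso K (⇑β) QuiverRep.AbsolutelyIndecomposable := by
    intro K _ _
    let ev : (QBase → ℚ) →+* ℚ := Pi.evalRingHom _ (qBase K)
    have h1 : euler (MvPowerSeries.map ev P) = eulerSum (fun n δ =>
        ((Nat.card K : ℚ) ^ n - 1)⁻¹ * polyFun (a δ) ((qBase K).pow n)) *
        MvPowerSeries.map ev P := by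
      rw [← map_euler, hP.euler_eq, map_mul]
      refine congrArg (· * _) ((map_dlog ev adamsQ _).trans ?_)
      ext1 γ
      refine coeff_eulerSum_congr fun n hn δ _ _ => ?_
      change polyFun (a δ) ((qBase K).pow n) * ((((qBase K).pow n).1 : ℚ) - 1)⁻¹ = _
      rw [QBase.coe_pow _ hn, mul_comm, Nat.cast_pow]
      rfl
    have h2 : constantCoeff (MvPowerSeries.map ev P) = 1 := by
      rw [constantCoeff_map, hP.constantCoeff_eq, map_one]
    have hlow : ∀ n ≠ 0, ∀ δ : I →₀ ℕ, δ.degree < N →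
        ((Nat.card K : ℚ) ^ n - 1)⁻¹ * (kacNum K n δ : ℚ) =
          ((Nat.card K : ℚ) ^ n - 1)⁻¹ * polyFun (a δ) ((qBase K).pow n) := by
      intro n hn δ hδ
      rw [kacNum_eq_polyFun hn (ha δ hδ)]
    have h3 := coeff_sub_of_euler_eq (constantCoeff_eulerSum _) (constantCoeff_eulerSum _)
      (fun γ hγ => coeff_eulerSum_congr fun n hn δ _ hδ => hlow n hn δ ?_)
      (euler_nilSeries K) h1 (constantCoeff_nilSeries K) h2 (β := β)
    · rw [coeff_eulerSum_sub hβ fun n hn δ hδ h => hlow n (by omega) δ ?_] at h3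
      · have hd : (β.degree : ℚ) ≠ 0 := by
          exact_mod_cast fun h => hβ ((Finsupp.degree_eq_zero_iff β).1 h)
        have h4 := mul_left_cancel₀ hd h3
        have h5 : coeff β (nilSeries K I) = r (qBase K) := hrK K
        have hq : (1 : ℚ) < Nat.card K := by exact_mod_cast two_le_card K
        have hq' : (Nat.card K : ℚ) - 1 ≠ 0 := (sub_pos.2 hq).ne'
        rw [haβ, map_zero, pow_one, Pi.zero_apply, mul_zero, sub_zero, h5, MvPowerSeries.coeff_map,
          kacNum_one] at h4
        change polyFun (Polynomial.X - 1) (qBase K) * (r (qBase K) - coeff β P (qBase K)) = _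
        change r (qBase K) - coeff β P (qBase K) = _ at h4
        have h6 : polyFun (Polynomial.X - 1) (qBase K) = (Nat.card K : ℚ) - 1 := by
          rw [polyFun_apply]
          simp [qBase]
        rw [h4, h6, mul_inv_cancel_left₀ hq']
      · have h7 := congrArg Finsupp.degree h
        rw [map_nsmul, smul_eq_mul, hN] at h7
        have : δ.degree ≠ 0 := fun h => hδ ((Finsupp.degree_eq_zero_iff δ).1 h)
        nlinarith [Nat.pos_of_ne_zero this]
    · have h7 := congrArg Finsupp.degree hδ
      have h8 : γ.degree < N := by
        obtain ⟨ε, rfl⟩ := exists_add_of_le hγ.le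
        rw [← hN, map_add]
        have : ε.degree ≠ 0 := fun h => hγ.ne (by
          rw [(Finsupp.degree_eq_zero_iff ε).1 h, add_zero])
        omega
      rw [map_nsmul, smul_eq_mul] at h7
      nlinarith [Nat.pos_of_ne_zero hn]
  -- The right-hand side is a rational function with monic denominator, and it is a number of
  -- isomorphism classes at each prime `q`, so at arbitrarily large `q`.
  obtain ⟨p, hp⟩ := exists_polyFun_eq
    (monicFun.mul_mem (polyFun_mem_monicFun (Polynomial.X - 1))
      (monicFun.sub_mem hr (hP.coeff_mem β))) fun M => by
        obtain ⟨K, _, _, hK⟩ := exists_finite_field.{w} M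
        exact ⟨qBase K, hK, (QuiverRep.numIso K (⇑β) QuiverRep.AbsolutelyIndecomposable : ℕ), by
          rw [hg K, Int.cast_natCast]⟩
  refine ⟨p, fun K _ _ => ?_⟩
  have h := hg K
  rw [hp, polyFun_apply] at h
  exact_mod_cast h

end

section

variable (K : Type w) [Field K] [Finite K] {I : Type u} [Quiver.{v} I] [Finite I]
  [∀ i j : I, Finite (i ⟶ j)] (V : Set (I → ℕ))

/-- The Frobenius orbits with dimension vector in `V`. -/
abbrev OrbIn : Type _ := {o : Orb K (AlgebraicClosure K) I // o.dim ∈ V}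

theorem mapDomain_val_support {O : Type*} {p : O → Prop} (s : {o // p o} →₀ ℕ) :
    ∀ o ∈ (s.mapDomain Subtype.val).support, p o := by
  classical
  intro o ho
  obtain ⟨o, -, rfl⟩ := Finset.mem_image.1 (Finsupp.mapDomain_support ho)
  exact o.2

theorem exists_mapDomain_val_eq {O : Type*} {p : O → Prop} (t : O →₀ ℕ) (h : ∀ o ∈ t.support, p o) :
    ∃ s : {o // p o} →₀ ℕ, s.mapDomain Subtype.val = t := by
  classical
  refine ⟨t.subtypeDomain p, Finsupp.ext fun o => ?_⟩
  by_cases ho : p o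
  · exact Finsupp.mapDomain_apply Subtype.val_injective _ (⟨o, ho⟩ : {o // p o})
  · rw [Finsupp.notMem_support_iff.1 fun h' => ho (h o h'),
      Finsupp.notMem_support_iff.1 fun h' => ho (mapDomain_val_support _ o h')]

theorem total_mapDomain_val {I O : Type*} {d : O → ℕ} {b : O → I →₀ ℕ} {p : O → Prop}
    (s : {o // p o} →₀ ℕ) : total d b (s.mapDomain Subtype.val) =
      total (fun o : {o // p o} => d o) (fun o => b o) s := by
  rw [total, Finsupp.sum_mapDomain_index (by simp) (by intros; rw [add_mul, add_smul])]
  rfl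

theorem finite_total_orbIn (α : I →₀ ℕ) :
    {s : OrbIn K V →₀ ℕ | total (fun o => o.1.card) (fun o => o.1.vec) s = α}.Finite := by
  refine ((finite_total_eq (K := K) (Ω := AlgebraicClosure K) ⇑α).preimage
    (Finsupp.mapDomain_injective Subtype.val_injective).injOn).subset fun s hs => ?_
  exact congrArg _ ((total_mapDomain_val s).trans hs)

theorem numIso_levelAtMost (α : I →₀ ℕ) :
    QuiverRep.numIso K (⇑α) (QuiverRep.LevelAtMost V) =
      (finite_total_orbIn K V α).toFinset.card := by
  rw [numIso_eq_card (Ω := AlgebraicClosure K) (Q := fun t => ∀ o ∈ t.support, o.dim ∈ V)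
    fun X => levelAtMost_iff (X := ⟨⇑α, X⟩), ← Nat.card_eq_card_finite_toFinset]
  symm
  refine Nat.card_congr (Equiv.ofBijective (fun s => ⟨s.1.mapDomain Subtype.val,
    congrArg _ ((total_mapDomain_val s.1).trans s.2), mapDomain_val_support _⟩)
    ⟨fun s s' h => ?_, ?_⟩)
  · exact Subtype.ext (Finsupp.mapDomain_injective Subtype.val_injective (Subtype.mk.inj h))
  · rintro ⟨t, ht, htV⟩
    obtain ⟨s, rfl⟩ := exists_mapDomain_val_eq t htV
    exact ⟨⟨s, (total_mapDomain_val s).symm.trans (DFunLike.coe_injective ht)⟩, rfl⟩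

/-- The generating series of the representations of level at most `V`. -/
def levelSeries : MvPowerSeries I ℚ := fun α =>
  (QuiverRep.numIso K (⇑α) (QuiverRep.LevelAtMost V) : ℚ)

theorem coeff_levelSeries (α : I →₀ ℕ) : coeff α (levelSeries K V) =
    (QuiverRep.numIso K (⇑α) (QuiverRep.LevelAtMost V) : ℚ) := rfl

theorem constantCoeff_levelSeries : constantCoeff (levelSeries K V) = 1 := by
  rw [← coeff_zero_eq_constantCoeff_apply, coeff_levelSeries, numIso_levelAtMost]
  have : (finite_total_orbIn K V 0).toFinset = {0} := by
    ext s
    rw [Set.Finite.mem_toFinset, Finset.mem_singleton]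
    exact total_eq_zero_iff (fun o => o.1.card_pos.ne') (fun o => o.1.vec_ne_zero) s
  rw [this, Finset.card_singleton, Nat.cast_one]

-- The Euler product with all `e` and `c` equal to 1: each admissible orbit contributes a geometric
-- series, and each multiset is counted once.
open scoped Classical in
theorem euler_levelSeries : euler (levelSeries K V) =
    eulerSum (fun n δ => if ⇑δ ∈ V then (kacNum K n δ : ℚ) else 0) * levelSeries K V := by
  refine euler_sum_prod (d := fun o : OrbIn K V => o.1.card) (b := fun o => o.1.vec)
    (e := fun _ _ => 1) (c := fun _ => 1) (fun _ => rfl) (fun n m _ => by simp)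
    (fun o => o.1.card_pos.ne') (fun o => o.1.vec_ne_zero)
    (fun α => (finite_total_orbIn K V α).toFinset) (fun α s => by
      rw [Set.Finite.mem_toFinset]; rfl)
    (fun n δ => (orbFinset K n δ).subtype fun o => o.dim ∈ V)
    (fun n hn δ o => by rw [Finset.mem_subtype, mem_orbFinset hn]) _ _
    (fun α => by
      rw [coeff_levelSeries, numIso_levelAtMost]
      simp [Finsupp.prod]) fun γ => ?_
  rw [coeff_eulerSum]
  refine Finset.sum_congr rfl fun n hn => Finset.sum_congr rfl fun δ _ => ?_
  congr 2
  have hn0 : n ≠ 0 := Nat.one_le_iff_ne_zero.1 (Finset.mem_Icc.1 hn).1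
  rw [one_mul, Finset.sum_subtype_eq_sum_filter]
  split_ifs with h
  · rw [kacNum, Finset.filter_true_of_mem]
    intro o ho
    rw [← o.coe_vec, ((mem_orbFinset hn0 _ _).1 ho).1]
    exact h
  · rw [Finset.filter_false_of_mem, Finset.sum_empty, Nat.cast_zero]
    intro o ho
    rw [← o.coe_vec, ((mem_orbFinset hn0 _ _).1 ho).1]
    exact h

end

/-- The series of counting polynomials of level at most `V`. -/
theorem exists_countsLevelAtMost {I : Type u} [Quiver.{v} I] [Finite I] [∀ i j : I, Finite (i ⟶ j)]
    {a : (I → ℕ) → ℤ[X]} (ha : ∀ β : I → ℕ, QuiverRep.IsKacPolynomial.{w} β (a β))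
    (V : Set (I → ℕ)) : ∃ M : (I → ℕ) → ℤ[X],
      (∀ α : I → ℕ, QuiverRep.CountsLevelAtMost.{w} V α (M α)) ∧
      plexp (genFun (V.indicator a)) = genFun M := by
  classical
  obtain ⟨P, hP⟩ := exists_isPlexp_polyFun fun β : I →₀ ℕ => V.indicator a ⇑β
  choose m hm using hP.coeff_mem
  have hPm : P = MvPowerSeries.map polyFun (m : MvPowerSeries I ℤ[X]) := by
    ext1 γ
    exact (hm γ).symm
  have hcoe : ∀ γ : I →₀ ℕ, Finsupp.equivFunOnFinite.symm ⇑γ = γ :=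
    Finsupp.equivFunOnFinite_symm_coe
  refine ⟨fun α => m (Finsupp.equivFunOnFinite.symm α), fun α K _ _ => ?_, ?_⟩
  · let ev : (QBase → ℚ) →+* ℚ := Pi.evalRingHom _ (qBase K)
    have h1 : euler (MvPowerSeries.map ev P) =
        eulerSum (fun n δ => if ⇑δ ∈ V then (kacNum K n δ : ℚ) else 0) *
          MvPowerSeries.map ev P := by
      rw [← map_euler, hP.euler_eq, map_mul]
      refine congrArg (· * _) ((map_dlog ev adamsQ _).trans ?_)
      ext1 γ
      refine coeff_eulerSum_congr fun n hn δ _ _ => ?_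
      change polyFun (V.indicator a ⇑δ) ((qBase K).pow n) = _
      split_ifs with h
      · rw [Set.indicator_of_mem h, kacNum_eq_polyFun hn (ha _)]
      · rw [Set.indicator_of_notMem h, map_zero, Pi.zero_apply]
    -- At `q` both series have constant term 1 and the same logarithmic derivative.
    have h2 : MvPowerSeries.map ev P = levelSeries K V :=
      eq_of_euler_eq (constantCoeff_eulerSum _) h1 (euler_levelSeries K V) (by
        rw [constantCoeff_levelSeries, constantCoeff_map, hP.constantCoeff_eq, map_one])
    have h3 := congrArg (coeff (Finsupp.equivFunOnFinite.symm α)) h2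
    rw [coeff_levelSeries, MvPowerSeries.coeff_map, ← hm] at h3
    change polyFun (m (Finsupp.equivFunOnFinite.symm α)) (qBase K) = _ at h3
    rw [polyFun_apply] at h3
    exact_mod_cast h3
  · rw [hPm] at hP
    have h := plexp_map_toRatFunc (a := fun γ => V.indicator a ⇑γ) hP
    have h' : genFun (fun α => m (Finsupp.equivFunOnFinite.symm α)) =
        MvPowerSeries.map toRatFunc (m : MvPowerSeries I ℤ[X]) := by
      ext1 γ
      change toRatFunc (m (Finsupp.equivFunOnFinite.symm ⇑γ)) = toRatFunc (m γ)
      rw [hcoe]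
    rw [h', ← h]
    rfl

end QRep

end

theorem lemma3 {I : Type u} [Quiver.{v} I] [Finite I] [∀ i j : I, Finite (i ⟶ j)] :
    ∃ a : (I → ℕ) → ℤ[X],
      (∀ β : I → ℕ, QuiverRep.IsKacPolynomial.{w} β (a β)) ∧
      ∀ V : Set (I → ℕ), ∃ M : (I → ℕ) → ℤ[X],
        (∀ α : I → ℕ, QuiverRep.CountsLevelAtMost.{w} V α (M α)) ∧
        Plethysm.plexp (Plethysm.genFun (V.indicator a)) = Plethysm.genFun M := by
  have h : ∀ β : I → ℕ, ∃ p, QuiverRep.IsKacPolynomial.{w} β p := fun β =>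
    QRep.exists_isKacPolynomial I (Finsupp.equivFunOnFinite.symm β)
  choose a ha using h
  exact ⟨a, ha, fun V => QRep.exists_countsLevelAtMost ha V⟩
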